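/- **Model and conventions.** Algorithms are deterministic word-RAM algorithms with unit-cost operations on words of $O(\log n)$ bits, where $n$ is the bit length of the input. An input is a sequence of numbers (names of states, letters, stack symbols, vertices, ...); its bit length $n$ is the number of entries times the number of bits needed for the largest entry. A machine is written down by listing its states (final ones marked), tape symbols, stack symbols and transitions; a graph by listing its vertices and labelled edges. An algorithm is *truly subcubic* if its worst-case running time is $O(n^{3-\varepsilon})$ for some constant $\varepsilon>0$, and *linear-time* if it is $O(n)$. A *two-way nondeterministic pushdown automaton* (2NPDA) has a finite set $Q$ of states, a finite tape alphabet $\Sigma$ containing two endmarkers $\lhd,\rhd$, a finite stack alphabet $\Gamma$ containing an end-of-stack symbol $Z_0$, an initial state $q_0$, a set $F\subseteq Q$ of final states, and a transition relation $\delta\subseteq Q\times\Sigma\times\Gamma\times Q\times\Gamma^*\times\{-1,0,+1\}$. A transition $(q,a,Z,q',\gamma,d)$ applies in state $q$ with scanned symbol $a$ and top of stack $Z$; it changes the state to $q'$, replaces $Z$ by $\gamma$ (first symbol on top) and moves the head by $d$, provided that the head stays on the tape. If $Z=Z_0$ then $\gamma\in(\Gamma\setminus\{Z_0\})^*Z_0$,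 and otherwise $\gamma\in(\Gamma\setminus\{Z_0\})^*$. A word $w\in(\Sigma\setminus\{\lhd,\rhd\})^*$ is accepted, $w\in L(\mathcal A)$, if on the tape $\lhd w\rhd$ some run leads from state $q_0$, head on $\lhd$, stack $Z_0$, to a state in $F$, head on $\rhd$, stack $Z_0$. A *PDA* is a 2NPDA none of whose transitions has $d=-1$. The *Dyck-2 language* over two kinds of parentheses is generated by $S\to SS\mid (S)\mid [S]\mid\varepsilon$. Consider the following problems. 1. *2NPDA recognition*: for a fixed 2NPDA $\mathcal A$, given a word $w$, is $w\in L(\mathcal A)$? (This problem is said to have truly subcubic algorithms if for every 2NPDA $\mathcal A$ there is a truly subcubic algorithm that decides $L(\mathcal A)$.) 2. *PDA emptiness*: given a PDA $\mathcal P$, is $L(\mathcal P)=\emptyset$? 3. *Dyck-2 reachability*: given a directed graph $G=(V,E)$, a labelling $\lambda$ of its edges $E\subseteq V\times V$ by the four parentheses, and vertices $s,t\in V$, is there a walk from $s$ to $t$ (possibly empty) whose sequence of labels is a Dyck-2 word? **Proposition.** Either all three problems have truly subcubic algorithms, or none of them does. Moreover there are the following linear-time reductions: - for every 2NPDA $\mathcal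 A$, a linear-time algorithm that maps each word $w$ to a PDA $\mathcal P$ such that $L(\mathcal P)\neq\emptyset$ if and only if $w\in L(\mathcal A)$; - a linear-time algorithm that maps each PDA $\mathcal P$ to an instance of Dyck-2 reachability that is a yes-instance if and only if $L(\mathcal P)\neq\emptyset$; - a fixed 2NPDA $\mathcal R$ and a linear-time algorithm that maps each instance of Dyck-2 reachability to a word $w$ such that $w\in L(\mathcal R)$ if and only if the instance is a yes-instance. -/

import Mathlib

/-! ## Word RAM: programs, cost semantics -/

/-- Unit-cost operations on machine words (truth values are `1` and `0`; subtraction is truncated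
at `0`; division by `0` gives `0`). -/
inductive RamOp
  | add | sub | mul | div | mod | land | lor | xor | shl | shr | lt | eq

def RamOp.eval : RamOp → ℕ → ℕ → ℕ
  | .add, a, b => a + b
  | .sub, a, b => a - b
  | .mul, a, b => a * b
  | .div, a, b => a / b
  | .mod, a, b => a % b
  | .land, a, b => a &&& b
  | .lor, a, b => a ||| b
  | .xor, a, b => a ^^^ b
  | .shl, a, b => a <<< b
  | .shr, a, b => a >>> b
  | .lt, a, b => if a < b then 1 else 0
  | .eq, a, b => if a = b then 1 else 0

/-- Memory of the machine: registers, random-access arrays (a program, being finite, mentions only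
finitely many registers and arrays), and the output written so far. -/
structure RamState where
  reg : ℕ → ℕ
  mem : ℕ → ℕ → ℕ
  out : List ℕ

def RamState.setReg (σ : RamState) (r v : ℕ) : RamState :=
  { σ with reg := Function.update σ.reg r v }

def RamState.setMem (σ : RamState) (A i v : ℕ) : RamState :=
  { σ with mem := Function.update σ.mem A (Function.update (σ.mem A) i v) }

/-- At the start, array `0` holds the input words, register `0` the number of input words, and
everything else is `0`. -/
def RamState.init (input : List ℕ) : RamState where
  reg := Function.update (fun _ => 0) 0 input.length
  mem := Function.update (fun _ _ => 0) 0 (fun i => input.getD i 0)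
  out := []

/-- Deterministic word RAM programs. -/
inductive RamProg
  /-- Do nothing. -/
  | skip
  /-- `r := v`. -/
  | const (r v : ℕ)
  /-- `r := a o b` for registers `a` and `b`. -/
  | op (o : RamOp) (r a b : ℕ)
  /-- `r := A[i]`, where the address is the content of register `i`. -/
  | load (r A i : ℕ)
  /-- `A[i] := a`, where the address is the content of register `i`. -/
  | store (A i a : ℕ)
  /-- Append the content of register `a` to the output. -/
  | write (a : ℕ)
  | seq (p q : RamProg)
  /-- If register `r` is nonzero then `p` else `q`. -/
  | ite (r : ℕ) (p q : RamProg)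
  /-- While register `r` is nonzero do `p`. -/
  | loop (r : ℕ) (p : RamProg)

/-- `RamExec W p σ t σ'`: started in `σ`, the program `p` halts in `σ'` after exactly `t` steps, and
every word it computes or reads on the way is less than `W` (a computation that would produce a
larger word has no execution). Each instruction and each test costs one step. -/
inductive RamExec (W : ℕ) : RamProg → RamState → ℕ → RamState → Prop
  | skip (σ) : RamExec W .skip σ 1 σ
  | const (r v σ) : v < W → RamExec W (.const r v) σ 1 (σ.setReg r v)
  | op (o r a b σ) : RamOp.eval o (σ.reg a) (σ.reg b) < W →
      RamExec W (.op o r a b) σ 1 (σ.setReg r (RamOp.eval o (σ.reg a) (σ.reg b)))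
  | load (r A i σ) : σ.mem A (σ.reg i) < W →
      RamExec W (.load r A i) σ 1 (σ.setReg r (σ.mem A (σ.reg i)))
  | store (A i a σ) : RamExec W (.store A i a) σ 1 (σ.setMem A (σ.reg i) (σ.reg a))
  | write (a σ) : RamExec W (.write a) σ 1 { σ with out := σ.out ++ [σ.reg a] }
  | seq {p q σ₁ σ₂ σ₃ t₁ t₂} : RamExec W p σ₁ t₁ σ₂ → RamExec W q σ₂ t₂ σ₃ →
      RamExec W (.seq p q) σ₁ (t₁ + t₂) σ₃
  | ite_true {r p q σ σ' t} : σ.reg r ≠ 0 → RamExec W p σ t σ' →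
      RamExec W (.ite r p q) σ (t + 1) σ'
  | ite_false {r p q σ σ' t} : σ.reg r = 0 → RamExec W q σ t σ' →
      RamExec W (.ite r p q) σ (t + 1) σ'
  | loop_true {r p σ₁ σ₂ σ₃ t₁ t₂} : σ₁.reg r ≠ 0 → RamExec W p σ₁ t₁ σ₂ →
      RamExec W (.loop r p) σ₂ t₂ σ₃ → RamExec W (.loop r p) σ₁ (t₁ + t₂ + 1) σ₃
  | loop_false {r p σ} : σ.reg r = 0 → RamExec W (.loop r p) σ 1 σ

/-- On the given input, `p` halts after `t` steps with the given output, all words being less than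
`W`. -/
def RamProg.Computes (p : RamProg) (W : ℕ) (input output : List ℕ) (t : ℕ) : Prop :=
  ∃ σ, RamExec W p (RamState.init input) t σ ∧ σ.out = output

/-- Bit length of a sequence of numbers, each written in binary with the same number of bits, namely
as many as the largest of them needs (and at least one). -/
def bitLength (l : List ℕ) : ℕ := l.length * Nat.size (l.foldr max 1)

/-! ## Decision problems, truly subcubic algorithms, linear-time reductions -/

/-- A decision problem: instances, their encoding as input, and the set of yes-instances. -/
structure DecisionProblem where
  Instance : Type
  encode : Instance → List ℕ
  yes : Instance → Prop

def DecisionProblem.compl (P : DecisionProblem) : DecisionProblem where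
  Instance := P.Instance
  encode := P.encode
  yes x := ¬ P.yes x

/-- Bit length of an instance. -/
def DecisionProblem.size (P : DecisionProblem) (x : P.Instance) : ℕ := bitLength (P.encode x)

open Classical in
/-- Some word RAM algorithm decides `P` (output `1` for yes, `0` for no) in time `O(n ^ (3 - ε))` for
some `ε > 0`, where `n` is the bit length of the input and words have `O(log n)` bits (words are less
than `(n + 2) ^ c` for a constant `c`). -/
def DecisionProblem.TrulySubcubic (P : DecisionProblem) : Prop :=
  ∃ (p : RamProg) (c : ℕ) (C ε : ℝ), 0 < ε ∧ ∀ x : P.Instance, ∃ t : ℕ,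
    p.Computes ((P.size x + 2) ^ c) (P.encode x) [if P.yes x then 1 else 0] t ∧
    (t : ℝ) ≤ C * ((P.size x : ℝ) + 1) ^ (3 - ε)

/-- The map `f` from instances of `P` to instances of `Q` is computable on a word RAM with words of
`O(log n)` bits in time `O(n)`, where `n` is the bit length of the input. -/
def LinearTimeComputable (P Q : DecisionProblem) (f : P.Instance → Q.Instance) : Prop :=
  ∃ (p : RamProg) (c C : ℕ), ∀ x : P.Instance, ∃ t : ℕ,
    p.Computes ((P.size x + 2) ^ c) (P.encode x) (Q.encode (f x)) t ∧ t ≤ C * (P.size x + 1)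

/-- Linear-time many-one reduction from `P` to `Q`. -/
def LinearTimeReduces (P Q : DecisionProblem) : Prop :=
  ∃ f : P.Instance → Q.Instance,
    LinearTimeComputable P Q f ∧ ∀ x, P.yes x ↔ Q.yes (f x)

/-! ## Two-way nondeterministic pushdown automata -/

/-- Tape symbols over the input alphabet `Fin k`: the two endmarkers and the letters. -/
inductive TapeSymbol (k : ℕ)
  | leftEnd
  | rightEnd
  | letter (a : Fin k)

def TapeSymbol.code {k : ℕ} : TapeSymbol k → ℕ
  | leftEnd => 0
  | rightEnd => 1
  | letter a => a.val + 2

inductive HeadMove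
  | left | stay | right

def HeadMove.toInt : HeadMove → ℤ
  | left => -1
  | stay => 0
  | right => 1

def HeadMove.code : HeadMove → ℕ
  | left => 0
  | stay => 1
  | right => 2

/-- A transition `(q, a, Z, q', γ, d)`; the first symbol of `γ` becomes the top of the stack. -/
structure PDATransition (s k g : ℕ) where
  src : Fin s
  read : TapeSymbol k
  top : Fin g
  dst : Fin s
  push : List (Fin g)
  move : HeadMove

/-- A two-way nondeterministic pushdown automaton with states `Fin numStates`, input letters
`Fin numLetters` (endmarkers not included) and stack symbols `Fin numStack`. The end-of-stack symbol
`bottom` is never removed, replaced by another symbol, or pushed: a transition reading it on the top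
of the stack puts it back below whatever it pushes, and it is pushed in no other way. -/
structure TwoNPDA where
  numStates : ℕ
  numLetters : ℕ
  numStack : ℕ
  start : Fin numStates
  bottom : Fin numStack
  final : Finset (Fin numStates)
  trans : List (PDATransition numStates numLetters numStack)
  bottom_kept : ∀ τ ∈ trans, τ.top = bottom → ∃ γ, bottom ∉ γ ∧ τ.push = γ ++ [bottom]
  bottom_not_pushed : ∀ τ ∈ trans, τ.top ≠ bottom → bottom ∉ τ.push

namespace TwoNPDA

variable (M : TwoNPDA)

/-- Control state, head position (`0` is the left endmarker), and stack (top first). -/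
structure Config where
  state : Fin M.numStates
  pos : ℕ
  stack : List (Fin M.numStack)

/-- The input word between its endmarkers. -/
def tape (w : List (Fin M.numLetters)) : List (TapeSymbol M.numLetters) :=
  TapeSymbol.leftEnd :: (w.map TapeSymbol.letter ++ [TapeSymbol.rightEnd])

/-- One move on input `w`; the head stays on the tape. -/
def Step (w : List (Fin M.numLetters)) (c c' : M.Config) : Prop :=
  ∃ τ ∈ M.trans, ∃ γ : List (Fin M.numStack),
    c.state = τ.src ∧ (M.tape w)[c.pos]? = some τ.read ∧ c.stack = τ.top :: γ ∧
    c'.state = τ.dst ∧ c'.stack = τ.push ++ γ ∧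
    (c'.pos : ℤ) = (c.pos : ℤ) + τ.move.toInt ∧ c'.pos < (M.tape w).length

/-- Some run leads from the initial configuration to a final state with the head on the right
endmarker and only the end-of-stack symbol on the stack. -/
def Accepts (w : List (Fin M.numLetters)) : Prop :=
  ∃ q ∈ M.final, Relation.ReflTransGen (M.Step w)
    ⟨M.start, 0, [M.bottom]⟩ ⟨q, w.length + 1, [M.bottom]⟩

def language : Language (Fin M.numLetters) := {w | M.Accepts w}

/-- The automaton as input: the sizes of its components, the initial state and the end-of-stack
symbol, the states (each marked `1` if it is final and `0` otherwise), the tape symbols, the stack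
symbols, and the transitions. -/
def encode : List ℕ :=
  [M.numStates, M.numLetters, M.numStack, M.start.val, M.bottom.val] ++
  List.ofFn (fun q : Fin M.numStates => if q ∈ M.final then 1 else 0) ++
  List.range (M.numLetters + 2) ++
  List.range M.numStack ++
  M.trans.flatMap (fun τ =>
    [τ.src.val, τ.read.code, τ.top.val, τ.dst.val, τ.move.code, τ.push.length] ++
      τ.push.map Fin.val)

end TwoNPDA

/-- A (one-way) pushdown automaton: a two-way one whose head never moves to the left. -/
structure PDA extends TwoNPDA where
  one_way : ∀ τ ∈ trans, τ.move ≠ HeadMove.left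

/-- The recognition problem of a fixed two-way automaton: does it accept the given word? -/
def recognitionProblem (M : TwoNPDA) : DecisionProblem where
  Instance := List (Fin M.numLetters)
  encode w := w.map Fin.val
  yes w := w ∈ M.language

/-- The emptiness problem: is the language of the given pushdown automaton empty (the language `0`)? -/
def pdaEmptiness : DecisionProblem where
  Instance := PDA
  encode A := A.toTwoNPDA.encode
  yes A := A.language = 0

/-! ## Dyck-2 reachability -/

/-- Two kinds of parentheses. -/
inductive Paren
  | roundOpen | roundClose | squareOpen | squareClose

def Paren.code : Paren → ℕ
  | roundOpen => 0
  | roundClose => 1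
  | squareOpen => 2
  | squareClose => 3

/-- The Dyck-2 language, by the grammar `S → S S | ( S ) | [ S ] | ε`. -/
inductive Dyck2 : List Paren → Prop
  | nil : Dyck2 []
  | append {u v} : Dyck2 u → Dyck2 v → Dyck2 (u ++ v)
  | round {u} : Dyck2 u → Dyck2 (Paren.roundOpen :: (u ++ [Paren.roundClose]))
  | square {u} : Dyck2 u → Dyck2 (Paren.squareOpen :: (u ++ [Paren.squareClose]))

structure LabelledEdge (n : ℕ) where
  src : Fin n
  label : Paren
  tgt : Fin n

/-- A directed graph on `Fin numVertices` with edges labelled by parentheses (at most one edge from a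
vertex to a vertex, with one label), a source and a target vertex. -/
structure Dyck2Instance where
  numVertices : ℕ
  source : Fin numVertices
  target : Fin numVertices
  edges : List (LabelledEdge numVertices)
  edges_nodup : (edges.map fun e => (e.src, e.tgt)).Nodup

namespace Dyck2Instance

variable (G : Dyck2Instance)

/-- The sequence of edges is a walk from the first to the second vertex; the empty sequence is a walk
from each vertex to itself. -/
def IsWalk : Fin G.numVertices → List (LabelledEdge G.numVertices) → Fin G.numVertices → Prop
  | u, [], v => u = v
  | u, e :: π, v => e ∈ G.edges ∧ e.src = u ∧ IsWalk e.tgt π v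

/-- The graph as input: the number of vertices, the source and the target, the vertices, and the
edges with their labels. -/
def encode : List ℕ :=
  [G.numVertices, G.source.val, G.target.val] ++ List.range G.numVertices ++
  G.edges.flatMap (fun e => [e.src.val, e.label.code, e.tgt.val])

end Dyck2Instance

/-- Is there a walk from the source to the target labelled by a Dyck-2 word? -/
def dyck2Reachability : DecisionProblem where
  Instance := Dyck2Instance
  encode := Dyck2Instance.encode
  yes G := ∃ π, G.IsWalk G.source π G.target ∧ Dyck2 (π.map LabelledEdge.label)

/-! The problems form a cycle of linear-time reductions: recognition to non-emptiness, non-emptiness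
to Dyck-2 reachability, and Dyck-2 reachability back to recognition by one fixed automaton. Truly
subcubic algorithms travel backwards along such reductions
(`DecisionProblem.TrulySubcubic.of_reduction`): in linear time only O(n) words of O(log n) bits can
be written, so the new instance has bit length O(n log n), and the logarithm is absorbed by halving
ε. A deterministic algorithm can negate its answer, so emptiness and non-emptiness are
interchangeable here.

Recognition to non-emptiness (`TwoNPDA.simPDA_language_ne_zero`): with the automaton fixed and the
word given, the head position is put into the control state. The resulting automaton has O(|w|)
states and transitions, never moves its head while simulating, and ignores its own (empty) input.

Non-emptiness to Dyck-2 reachability (`PDA.yes_dyckInstance_iff`): stack symbols are written in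
binary, and two kinds of parentheses act on the stack as pushes and pops of bits. A transition
becomes a path that pops the old top and pushes its replacement. The input word is guessed along the
way; since the head never moves left, it suffices to remember the scanned symbol, which is kept as
an additional block on top of the stack (`PDA.reach_rules_iff`). Each path ends in a matched pair of
parentheses without effect, so that it has an inner vertex and no two edges become parallel
(`PathGraph.graph_nodup`, `PathGraph.reach_iff`).

Dyck-2 reachability to recognition (`Recognizer.reach_iff_dyck`): the edges are listed on the tape
as records consisting of source, label and target, with vertices in binary. The automaton follows a
walk, keeping the open parentheses on its stack. To take an edge it pushes the bits of the current
vertex, moves to any record, and compares the source there with the stack while moving left.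

The reductions are linear in the bit length because the binary expansions are paid for by the input:
the number of bits of a vertex or of a symbol is, up to a constant, at most the number of bits of an
input entry (`PDA.width_mul_length_le`). Running times are verified on explicit programs, in a small
logic of triples with time bounds (`RamProg.Runs`). -/

/-! ## Running programs inside a larger memory -/

/-- The program `p` with its registers renamed by `φ` and its arrays by `ψ`; instead of being written
out, its output is stored in the array `O`, its length in the register `c` (with scratch register
`u`). -/
def RamProg.redirect (φ ψ : ℕ → ℕ) (O c u : ℕ) : RamProg → RamProg
  | .skip => .skip
  | .const r v => .const (φ r) v
  | .op o r a b => .op o (φ r) (φ a) (φ b)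
  | .load r A i => .load (φ r) (ψ A) (φ i)
  | .store A i a => .store (ψ A) (φ i) (φ a)
  | .write a => .seq (.store O c (φ a)) (.seq (.const u 1) (.op .add c c u))
  | .seq p q => .seq (p.redirect φ ψ O c u) (q.redirect φ ψ O c u)
  | .ite r p q => .ite (φ r) (p.redirect φ ψ O c u) (q.redirect φ ψ O c u)
  | .loop r p => .loop (φ r) (p.redirect φ ψ O c u)

/-- The state `τ` contains the state `σ`, in the sense of `RamProg.redirect`. -/
structure RamState.Embeds (φ ψ : ℕ → ℕ) (O c : ℕ) (σ τ : RamState) : Prop where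
  reg : ∀ r, τ.reg (φ r) = σ.reg r
  mem : ∀ A, τ.mem (ψ A) = σ.mem A
  len : τ.reg c = σ.out.length
  arr : τ.mem O = fun i => σ.out.getD i 0

/-- Nothing outside of the part of the memory used by `RamProg.redirect` differs. -/
structure RamState.FrameEq (φ ψ : ℕ → ℕ) (O c u : ℕ) (τ τ' : RamState) : Prop where
  reg : ∀ r, r ∉ Set.range φ → r ≠ c → r ≠ u → τ'.reg r = τ.reg r
  mem : ∀ A, A ∉ Set.range ψ → A ≠ O → τ'.mem A = τ.mem A
  out : τ'.out = τ.out

theorem RamState.FrameEq.refl (φ ψ : ℕ → ℕ) (O c u : ℕ) (τ : RamState) :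
    RamState.FrameEq φ ψ O c u τ τ := ⟨fun _ _ _ _ => rfl, fun _ _ _ => rfl, rfl⟩

theorem RamState.FrameEq.trans {φ ψ : ℕ → ℕ} {O c u : ℕ} {τ₁ τ₂ τ₃ : RamState}
    (h : RamState.FrameEq φ ψ O c u τ₁ τ₂) (h' : RamState.FrameEq φ ψ O c u τ₂ τ₃) :
    RamState.FrameEq φ ψ O c u τ₁ τ₃ :=
  ⟨fun r h₁ h₂ h₃ => (h'.reg r h₁ h₂ h₃).trans (h.reg r h₁ h₂ h₃),
    fun A h₁ h₂ => (h'.mem A h₁ h₂).trans (h.mem A h₁ h₂), h'.out.trans h.out⟩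

theorem RamState.Embeds.setReg {φ ψ : ℕ → ℕ} {O c u : ℕ} (hφ : φ.Injective)
    (hc : c ∉ Set.range φ) {σ τ : RamState} (h : RamState.Embeds φ ψ O c σ τ) (r v : ℕ) :
    RamState.Embeds φ ψ O c (σ.setReg r v) (τ.setReg (φ r) v) ∧
      RamState.FrameEq φ ψ O c u τ (τ.setReg (φ r) v) := by
  refine ⟨⟨fun s => ?_, h.mem, ?_, h.arr⟩, ⟨fun s hs _ _ => ?_, fun _ _ _ => rfl, rfl⟩⟩
  · by_cases hs : s = r
    · subst hs; simp [RamState.setReg]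
    · simp [RamState.setReg, hs, hφ.eq_iff, h.reg]
  · have : c ≠ φ r := fun e => hc ⟨r, e.symm⟩
    simp [RamState.setReg, this, h.len]
  · have : s ≠ φ r := fun e => hs ⟨r, e.symm⟩
    simp [RamState.setReg, this]

/-- A step writes at most one word. This bounds both the size of a reduced instance and the counter
that stands in for the output in a redirected program. -/
theorem RamExec.length_out_le {W : ℕ} {p : RamProg} {σ σ' : RamState} {t : ℕ}
    (h : RamExec W p σ t σ') : σ'.out.length ≤ σ.out.length + t := by
  induction h with
  | skip | const | op | load | store => simp [RamState.setReg, RamState.setMem]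
  | write => simp
  | seq _ _ h₁ h₂ => omega
  | ite_true _ _ h => omega
  | ite_false _ _ h => omega
  | loop_true _ _ _ h₁ h₂ => omega
  | loop_false => omega

/-- Only `write` becomes longer, from one instruction to three, hence the factor `3`. The length of
the output is now a word of the machine, so it must stay below `W'` throughout; this is what the
bound on `σ.out.length + t` provides. -/
theorem RamExec.redirect {φ ψ : ℕ → ℕ} {O c u W W' : ℕ} (hφ : φ.Injective) (hψ : ψ.Injective)
    (hO : O ∉ Set.range ψ) (hc : c ∉ Set.range φ) (hu : u ∉ Set.range φ) (huc : u ≠ c)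
    (hW : W ≤ W') (hW' : 1 < W') {p : RamProg} {σ σ' : RamState} {t : ℕ}
    (h : RamExec W p σ t σ') :
    σ.out.length + t < W' → ∀ τ, RamState.Embeds φ ψ O c σ τ →
      ∃ t' τ', RamExec W' (p.redirect φ ψ O c u) τ t' τ' ∧ t' ≤ 3 * t ∧
        RamState.Embeds φ ψ O c σ' τ' ∧ RamState.FrameEq φ ψ O c u τ τ' := by
  induction h with
  | skip σ =>
    intro _ τ h
    exact ⟨1, τ, .skip τ, by omega, h, .refl ..⟩
  | const r v σ hv =>
    intro _ τ h
    exact ⟨1, _, .const _ _ _ (by omega), by omega, h.setReg hφ hc r v⟩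
  | op o r a b σ hv =>
    intro _ τ h
    have := h.setReg (u := u) hφ hc r (o.eval (σ.reg a) (σ.reg b))
    refine ⟨1, _, .op _ _ _ _ _ (by simpa only [h.reg] using hv.trans_le hW), by omega, ?_⟩
    simpa only [h.reg] using this
  | load r A i σ hv =>
    intro _ τ h
    have := h.setReg (u := u) hφ hc r (σ.mem A (σ.reg i))
    refine ⟨1, _, .load _ _ _ _ (by simpa only [h.reg, h.mem] using hv.trans_le hW), by omega, ?_⟩
    simpa only [h.reg, h.mem] using this
  | store A i a σ =>
    intro _ τ h
    refine ⟨1, _, .store _ _ _ _, by omega, ⟨h.reg, fun B => ?_, h.len, ?_⟩,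
      ⟨fun _ _ _ _ => rfl, fun B hB _ => ?_, rfl⟩⟩
    · by_cases hB : B = A
      · subst hB; simp [RamState.setMem, h.mem, h.reg]
      · simp [RamState.setMem, hB, hψ.eq_iff, h.mem]
    · have : O ≠ ψ A := fun e => hO ⟨A, e.symm⟩
      simp [RamState.setMem, this, h.arr]
    · have : B ≠ ψ A := fun e => hB ⟨A, e.symm⟩
      simp [RamState.setMem, this]
  | write a σ =>
    intro hl τ h
    have hψO : ∀ A, ψ A ≠ O := fun A e => hO ⟨A, e⟩
    have hφc : ∀ r, φ r ≠ c := fun r e => hc ⟨r, e⟩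
    have hφu : ∀ r, φ r ≠ u := fun r e => hu ⟨r, e⟩
    refine ⟨1 + (1 + 1), _, .seq (.store ..) (.seq (.const _ _ _ hW') (.op _ _ _ _ _ ?_)),
      by omega, ⟨fun r => ?_, fun A => ?_, ?_, ?_⟩, ⟨fun r hr hrc hru => ?_, fun A hA hAO => ?_, rfl⟩⟩
    · simp [RamOp.eval, RamState.setReg, RamState.setMem, huc.symm, h.len]; omega
    · simp [RamState.setReg, RamState.setMem, hφc, hφu, h.reg]
    · simp [RamState.setReg, RamState.setMem, hψO, h.mem]
    · simp [RamOp.eval, RamState.setReg, RamState.setMem, huc.symm, h.len]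
    · funext i
      simp only [RamState.setReg, RamState.setMem, Function.update_self, h.arr, h.len, h.reg,
        Function.update_apply]
      -- Beyond the end of the output the array still holds zeros, in agreement with the default
      -- value of `getD`.
      rcases lt_trichotomy i σ.out.length with hi | hi | hi
      · simp [hi.ne, List.getElem?_append_left hi]
      · simp [hi]
      · have h1 : σ.out.length ≤ i := by omega
        have h2 : i - σ.out.length ≠ 0 := by omega
        simp [hi.ne', List.getElem?_append_right h1, List.getElem?_eq_none h1, h2]
    · simp [RamState.setReg, RamState.setMem, hrc, hru]
    · simp [RamState.setReg, RamState.setMem, hAO]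
  | seq h₁ h₂ ih₁ ih₂ =>
    intro hl τ h
    have := h₁.length_out_le
    obtain ⟨t₁, τ₁, e₁, b₁, s₁, f₁⟩ := ih₁ (by omega) τ h
    obtain ⟨t₂, τ₂, e₂, b₂, s₂, f₂⟩ := ih₂ (by omega) τ₁ s₁
    exact ⟨_, _, .seq e₁ e₂, by omega, s₂, f₁.trans f₂⟩
  | ite_true hr _ ih =>
    intro hl τ h
    obtain ⟨t₁, τ₁, e₁, b₁, s₁, f₁⟩ := ih (by omega) τ h
    exact ⟨_, _, .ite_true (by rwa [h.reg]) e₁, by omega, s₁, f₁⟩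
  | ite_false hr _ ih =>
    intro hl τ h
    obtain ⟨t₁, τ₁, e₁, b₁, s₁, f₁⟩ := ih (by omega) τ h
    exact ⟨_, _, .ite_false (by rwa [h.reg]) e₁, by omega, s₁, f₁⟩
  | loop_true hr h₁ h₂ ih₁ ih₂ =>
    intro hl τ h
    have := h₁.length_out_le
    obtain ⟨t₁, τ₁, e₁, b₁, s₁, f₁⟩ := ih₁ (by omega) τ h
    obtain ⟨t₂, τ₂, e₂, b₂, s₂, f₂⟩ := ih₂ (by omega) τ₁ s₁
    exact ⟨_, _, .loop_true (by rwa [h.reg]) e₁ e₂, by omega, s₂, f₁.trans f₂⟩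
  | loop_false hr =>
    intro hl τ h
    exact ⟨1, τ, .loop_false (by rwa [h.reg]), by omega, h, .refl ..⟩

/-- All words in the registers and in the output stay below a bound on the words computed. -/
theorem RamExec.lt_of_le {W B : ℕ} (hW : W ≤ B) {p : RamProg} {σ σ' : RamState} {t : ℕ}
    (h : RamExec W p σ t σ') : (∀ r, σ.reg r < B) ∧ (∀ x ∈ σ.out, x < B) →
      (∀ r, σ'.reg r < B) ∧ (∀ x ∈ σ'.out, x < B) := by
  have key : ∀ (σ : RamState) (r v : ℕ), v < W → (∀ r, σ.reg r < B) ∧ (∀ x ∈ σ.out, x < B) →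
      (∀ s, (σ.setReg r v).reg s < B) ∧ (∀ x ∈ (σ.setReg r v).out, x < B) := by
    intro σ r v hv h
    refine ⟨fun s => ?_, h.2⟩
    by_cases hs : s = r
    · subst hs; simp [RamState.setReg]; omega
    · simp [RamState.setReg, hs, h.1]
  induction h with
  | skip | store | loop_false => exact fun h => h
  | const r v σ hv => exact key _ _ _ hv
  | op _ _ _ _ _ hv => exact key _ _ _ hv
  | load _ _ _ _ hv => exact key _ _ _ hv
  | write a σ =>
    intro h
    refine ⟨h.1, fun x hx => ?_⟩
    rcases List.mem_append.1 hx with hx | hx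
    · exact h.2 x hx
    · rw [List.mem_singleton.1 hx]; exact h.1 a
  | seq _ _ h₁ h₂ => exact fun h => h₂ (h₁ h)
  | ite_true _ _ h => exact h
  | ite_false _ _ h => exact h
  | loop_true _ _ _ h₁ h₂ => exact fun h => h₂ (h₁ h)

theorem List.foldr_max_lt {l : List ℕ} {B : ℕ} (hB : 1 < B) (h : ∀ x ∈ l, x < B) :
    l.foldr max 1 < B := by
  induction l with
  | nil => simpa
  | cons a l ih =>
    simp only [List.foldr_cons]
    exact max_lt (h a (by simp)) (ih fun x hx => h x (by simp [hx]))

theorem List.le_foldr_max {l : List ℕ} {x : ℕ} (h : x ∈ l) : x ≤ l.foldr max 1 := by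
  induction l with
  | nil => simp at h
  | cons a l ih =>
    simp only [List.foldr_cons]
    rcases List.mem_cons.1 h with rfl | h
    · exact le_max_left _ _
    · exact (ih h).trans (le_max_right _ _)

theorem List.one_le_foldr_max (l : List ℕ) : 1 ≤ l.foldr max 1 := by
  induction l with
  | nil => simp
  | cons a l ih => exact ih.trans (le_max_right _ _)

theorem length_le_bitLength (l : List ℕ) : l.length ≤ bitLength l := by
  refine Nat.le_mul_of_pos_right _ (Nat.size_pos.2 (l.one_le_foldr_max))

/-- Polynomially bounded entries have O(log n) bits each; this is the logarithmic factor by which a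
linear-time reduction may enlarge its instance. The exponent `c + 1` is positive, so the bound on
the entries exceeds `1` even for `c = 0`. -/
theorem bitLength_le {l : List ℕ} {n k c : ℕ} (hk : l.length ≤ k)
    (h : ∀ x ∈ l, x < (n + 2) ^ (c + 1)) : bitLength l ≤ k * ((c + 1) * Nat.size (n + 2)) := by
  refine Nat.mul_le_mul hk (Nat.size_le.2 ?_)
  have h1 : (n + 2) ^ (c + 1) ≤ 2 ^ ((c + 1) * Nat.size (n + 2)) := by
    rw [mul_comm, pow_mul]
    exact Nat.pow_le_pow_left (Nat.lt_size_self _).le _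
  refine lt_of_lt_of_le (List.foldr_max_lt ?_ h) h1
  exact Nat.one_lt_pow (by omega) (by omega)

theorem RamProg.Computes.length_le {p : RamProg} {W t : ℕ} {i o : List ℕ}
    (h : p.Computes W i o t) : o.length ≤ t := by
  obtain ⟨σ, h, rfl⟩ := h
  simpa [RamState.init] using h.length_out_le

/-- What is written comes from a register, and a register holds a computed word, a zero, or
initially the length of the input, which is the reason for `hi`. -/
theorem RamProg.Computes.lt {p : RamProg} {W B t : ℕ} {i o : List ℕ}
    (h : p.Computes W i o t) (hW : W ≤ B) (hi : i.length < B) : ∀ x ∈ o, x < B := by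
  obtain ⟨σ, h, rfl⟩ := h
  refine (h.lt_of_le hW ⟨fun r => ?_, by simp [RamState.init]⟩).2
  by_cases hr : r = 0
  · subst hr; simpa [RamState.init]
  · simp [RamState.init, hr]; omega

-- A logarithm is dominated by every positive power, by `log x ≤ x ^ δ / δ`.
open Real in
theorem size_le_rpow {δ : ℝ} (hδ : 0 < δ) :
    ∃ K : ℝ, 0 ≤ K ∧ ∀ n : ℕ, (Nat.size (n + 2) : ℝ) ≤ K * ((n : ℝ) + 1) ^ δ := by
  refine ⟨1 + (2 : ℝ) ^ δ / δ / log 2, by have := log_pos (one_lt_two (α := ℝ)); positivity,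
    fun n => ?_⟩
  have hl : 0 < log 2 := log_pos one_lt_two
  obtain ⟨k, hk⟩ : ∃ k, Nat.size (n + 2) = k + 1 :=
    Nat.exists_eq_succ_of_ne_zero (Nat.size_pos.2 (by omega)).ne'
  have h1 : 2 ^ k ≤ n + 2 := Nat.lt_size.1 (by omega)
  have h2 : (2 : ℝ) ^ k ≤ 2 * ((n : ℝ) + 1) := by
    have : ((2 ^ k : ℕ) : ℝ) ≤ ((n + 2 : ℕ) : ℝ) := by exact_mod_cast h1
    push_cast at this
    have : (0 : ℝ) ≤ n := by positivity
    linarith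
  have h3 : k * log 2 ≤ (2 * ((n : ℝ) + 1)) ^ δ / δ := by
    rw [← log_pow]
    exact (log_le_log (by positivity) h2).trans (log_le_rpow_div (by positivity) hδ)
  rw [mul_rpow (by norm_num) (by positivity)] at h3
  have h4 : (k : ℝ) ≤ (2 : ℝ) ^ δ / δ / log 2 * ((n : ℝ) + 1) ^ δ := by
    rw [← le_div_iff₀ hl] at h3
    refine h3.trans (le_of_eq ?_)
    ring
  have h5 : 1 ≤ ((n : ℝ) + 1) ^ δ := one_le_rpow (by simp) hδ.le
  rw [hk]; push_cast
  linarith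

/-- Since `K < 2 ^ K` and the base is at least `2`, a constant factor can be moved into the
exponent. Word bounds have the form `(n + 2) ^ c` without a factor, so this is how constants enter
them. -/
theorem mul_pow_le_pow_add (K n e : ℕ) : K * (n + 2) ^ e ≤ (n + 2) ^ (e + K) := by
  rw [pow_add, mul_comm]
  refine Nat.mul_le_mul_left _ (Nat.lt_two_pow_self.le.trans ?_)
  exact Nat.pow_le_pow_left (by omega) _

/-! ## Truly subcubic algorithms through linear-time reductions -/

/-- Read the answer of a redirected decision procedure, and complement it if `neg`. -/
def RamProg.answer (neg : Bool) : RamProg :=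
  .seq (.const 2 0) (.seq (.load 2 2 2)
    (.seq (if neg then .seq (.const 6 0) (.op .eq 2 2 6) else .skip) (.write 2)))

theorem RamExec.answer (neg : Bool) {W b : ℕ} (hW : 1 < W) (hb : b < 2) {σ : RamState}
    (hσ : σ.mem 2 0 = b) (ho : σ.out = []) :
    ∃ t σ', RamExec W (RamProg.answer neg) σ t σ' ∧ t ≤ 5 ∧
      σ'.out = [if neg then 1 - b else b] := by
  cases neg
  · refine ⟨1 + (1 + (1 + 1)), _, .seq (.const _ _ _ (by omega)) (.seq (.load _ _ _ _ ?_)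
      (.seq (.skip _) (.write _ _))), by omega, ?_⟩ <;>
    simp [RamState.setReg, hσ, ho]; omega
  · refine ⟨1 + (1 + ((1 + 1) + 1)), _, .seq (.const _ _ _ (by omega)) (.seq (.load _ _ _ _ ?_)
      (.seq (.seq (.const _ _ _ (by omega)) (.op _ _ _ _ _ ?_)) (.write _ _))), by omega, ?_⟩ <;>
    simp [RamState.setReg, RamOp.eval, hσ, ho] <;> first | omega | (split <;> omega)

/-- Run `pq` on the output of `pf` and write its answer, complemented if `neg`. -/
def RamProg.comp (pf pq : RamProg) (neg : Bool) : RamProg :=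
  .seq (pf.redirect (4 * ·) (4 * ·) 1 1 2)
    (.seq (pq.redirect (4 * · + 1) (4 * · + 1) 2 3 2) (.answer neg))

/-- Residues modulo `4` keep the memories apart: `0` for `pf`, `1` for `pq`. The output of `pf` goes
to array `1` and its length to register `1`, which are exactly where `pq`, renamed by `4 * · + 1`,
expects its input. Array `2` receives the answer, and the auxiliary registers have residues `2` and
`3`. -/
theorem RamProg.Computes.comp {pf pq : RamProg} {Wf Wq W tf tq b : ℕ} {i m : List ℕ}
    (hf : pf.Computes Wf i m tf) (hq : pq.Computes Wq m [b] tq) (hb : b < 2) (neg : Bool)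
    (hWf : Wf ≤ W) (hWq : Wq ≤ W) (hW : 1 < W) (htf : tf < W) (htq : tq < W) :
    ∃ t, (pf.comp pq neg).Computes W i [if neg then 1 - b else b] t ∧ t ≤ 3 * tf + 3 * tq + 5 := by
  obtain ⟨σ₁, e₁, rfl⟩ := hf
  obtain ⟨σ₂, e₂, h₂⟩ := hq
  have e₁' := e₁.redirect (φ := (4 * ·)) (ψ := (4 * ·)) (O := 1) (c := 1) (u := 2)
    (fun _ _ h => by simpa using h) (fun _ _ h => by simpa using h) (by simp) (by simp)
    (by simp; omega) (by omega) hWf hW (by simpa [RamState.init] using htf) (RamState.init i)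
    ⟨fun r => by by_cases h : r = 0 <;> simp [RamState.init, h],
      fun r => by by_cases h : r = 0 <;> simp [RamState.init, h], by simp [RamState.init],
      by simp [RamState.init]⟩
  obtain ⟨t₁, τ₁, x₁, b₁, s₁, f₁⟩ := e₁'
  have e₂' := e₂.redirect (φ := (4 * · + 1)) (ψ := (4 * · + 1)) (O := 2) (c := 3) (u := 2)
    (fun _ _ h => by simpa using h) (fun _ _ h => by simpa using h) (by simp) (by simp; omega)
    (by simp) (by omega) hWq hW (by simpa [RamState.init] using htq) τ₁
    ⟨fun r => ?_, fun A => ?_, ?_, ?_⟩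
  · obtain ⟨t₂, τ₂, x₂, b₂, s₂, f₂⟩ := e₂'
    obtain ⟨t₃, τ₃, x₃, b₃, o₃⟩ := RamExec.answer (σ := τ₂) neg hW hb (by simp [s₂.arr, h₂])
      (by rw [f₂.out, f₁.out]; rfl)
    exact ⟨_, ⟨τ₃, .seq x₁ (.seq x₂ x₃), o₃⟩, by omega⟩
  · by_cases h : r = 0
    · subst h; simpa [RamState.init] using s₁.len
    · rw [f₁.reg _ (by simp; omega) (by omega) (by omega)]
      simp [RamState.init, h]
  · by_cases h : A = 0
    · subst h; simpa [RamState.init] using s₁.arr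
    · rw [f₁.mem _ (by simp; omega) (by omega)]
      simp [RamState.init, h]
  · rw [f₁.reg _ (by simp; omega) (by omega) (by omega)]
    simp [RamState.init]
  · rw [f₁.mem _ (by simp; omega) (by omega)]
    simp [RamState.init]

-- The size estimate with `δ = ε / 6` gives the exponent `(1 + ε / 6) * (3 - ε) = 3 - ε / 2 - ε ^ 2
-- / 6`. The assumption `ε ≤ 1` keeps `3 - ε` positive, so that the power is monotone.
open Real in
theorem rpow_growth {ε : ℝ} (hε : 0 < ε) (hε1 : ε ≤ 1) (A : ℝ) (hA : 0 ≤ A) :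
    ∃ K : ℝ, 0 ≤ K ∧ ∀ n s : ℕ, (s : ℝ) ≤ A * (n + 1) * Nat.size (n + 2) →
      ((s : ℝ) + 1) ^ (3 - ε) ≤ K * ((n : ℝ) + 1) ^ (3 - ε / 2) := by
  obtain ⟨B, hB, h⟩ := size_le_rpow (δ := ε / 6) (by positivity)
  refine ⟨(A * B + 1) ^ (3 - ε), by positivity, fun n s hs => ?_⟩
  have hn : (1 : ℝ) ≤ (n : ℝ) + 1 := by simp
  have h1 : (s : ℝ) + 1 ≤ (A * B + 1) * ((n : ℝ) + 1) ^ (1 + ε / 6) := by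
    have h2 : (1 : ℝ) ≤ ((n : ℝ) + 1) ^ (1 + ε / 6) := one_le_rpow hn (by positivity)
    have h3 : (s : ℝ) ≤ A * (n + 1) * (B * ((n : ℝ) + 1) ^ (ε / 6)) :=
      hs.trans (mul_le_mul_of_nonneg_left (h n) (by positivity))
    have h4 : A * (n + 1) * (B * ((n : ℝ) + 1) ^ (ε / 6)) = A * B * ((n : ℝ) + 1) ^ (1 + ε / 6) := by
      rw [rpow_add (by positivity), rpow_one]; ring
    rw [h4] at h3
    linarith
  calc ((s : ℝ) + 1) ^ (3 - ε) ≤ ((A * B + 1) * ((n : ℝ) + 1) ^ (1 + ε / 6)) ^ (3 - ε) :=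
        rpow_le_rpow (by positivity) h1 (by linarith)
    _ = (A * B + 1) ^ (3 - ε) * ((n : ℝ) + 1) ^ ((1 + ε / 6) * (3 - ε)) := by
        rw [mul_rpow (by positivity) (by positivity), ← rpow_mul (by positivity)]
    _ ≤ _ := by
        refine mul_le_mul_of_nonneg_left (rpow_le_rpow_of_exponent_le hn ?_) (by positivity)
        nlinarith

/-- Composing the programs takes linear time plus the time for an instance of bit length O(n log n),
so half of the saving `ε` survives. Most of the work is to see that one exponent `c'` bounds the
words of both programs and also the two running times, which bound the lengths of the redirected
outputs. -/
theorem DecisionProblem.TrulySubcubic.of_reduction {P Q : DecisionProblem}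
    {f : P.Instance → Q.Instance} (hf : LinearTimeComputable P Q f) (hQ : Q.TrulySubcubic)
    (neg : Bool) (h : ∀ x, P.yes x ↔ if neg then ¬ Q.yes (f x) else Q.yes (f x)) :
    P.TrulySubcubic := by
  obtain ⟨pf, c, C, hf⟩ := hf
  obtain ⟨pq, d, D, ε, hε, hq⟩ := hQ
  -- A smaller saving is a weaker claim; the cap at `1` is needed for the growth estimate.
  set ε' := min ε 1 with hε'
  have hε0 : 0 < ε' := lt_min hε one_pos
  obtain ⟨K, hK, hgrow⟩ := rpow_growth hε0 (min_le_right _ _) (C * (c + 1)) (by positivity)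
  set D' : ℕ := ⌈D⌉₊
  have hDD : D ≤ D' := Nat.le_ceil D
  set E := C * (c + 1) + 4
  -- With `s + 2 ≤ (n + 2) ^ (2 + E)`, the summand `(2 + E) * (d + 3)` covers both `(s + 2) ^ d` and
  -- `(s + 1) ^ 3`; `C` and `D'` absorb the constant factors of the two running times.
  set c' := c + C + 3 + (2 + E) * (d + 3) + D'
  refine ⟨pf.comp pq neg, c', 3 * C + 3 * (D' * K) + 5, ε' / 2, by positivity, fun x => ?_⟩
  obtain ⟨tf, hcf, htf⟩ := hf x
  obtain ⟨tq, hcq, htq⟩ := hq (f x)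
  set n := P.size x
  set s := Q.size (f x)
  have hlen : (Q.encode (f x)).length ≤ C * (n + 1) := hcf.length_le.trans htf
  have hn2 : n + 2 ≤ (n + 2) ^ (c + 1) := Nat.le_self_pow (by omega) _
  have hs : s ≤ C * (n + 1) * ((c + 1) * Nat.size (n + 2)) := by
    refine bitLength_le hlen (hcf.lt (Nat.pow_le_pow_right (by omega) (by omega)) ?_)
    have : (P.encode x).length ≤ n := length_le_bitLength _
    omega
  have hs2 : s + 2 ≤ (n + 2) ^ (2 + E) := by
    refine le_trans ?_ (mul_pow_le_pow_add E n 2)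
    have h1 : Nat.size (n + 2) ≤ n + 2 := Nat.size_le.2 Nat.lt_two_pow_self
    have h2 : C * (n + 1) * ((c + 1) * Nat.size (n + 2)) ≤ C * (n + 2) * ((c + 1) * (n + 2)) := by
      gcongr; omega
    have h3 : 1 ≤ (n + 2) ^ 2 := Nat.one_le_pow _ _ (by omega)
    have h4 : E * (n + 2) ^ 2 = C * (n + 2) * ((c + 1) * (n + 2)) + 4 * (n + 2) ^ 2 := by ring
    omega
  have hspos : (1 : ℝ) ≤ (s : ℝ) + 1 := by simp
  have htq' : (tq : ℝ) ≤ D' * ((s : ℝ) + 1) ^ (3 - ε') := by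
    refine htq.trans (mul_le_mul hDD ?_ (by positivity) (by positivity))
    exact Real.rpow_le_rpow_of_exponent_le hspos (by linarith [min_le_left ε 1])
  -- A crude bound with an integer exponent, needed only for the word size.
  have htq3 : tq ≤ D' * (s + 1) ^ 3 := by
    have : (tq : ℝ) ≤ D' * ((s : ℝ) + 1) ^ 3 := by
      refine htq'.trans (mul_le_mul_of_nonneg_left ?_ (by positivity))
      rw [← Real.rpow_natCast]
      exact Real.rpow_le_rpow_of_exponent_le hspos (by push_cast; linarith)
    exact_mod_cast this
  have hone : 1 < n + 2 := by omega
  have hq1 : (s + 2) ^ (d + 3) ≤ (n + 2) ^ ((2 + E) * (d + 3)) := by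
    rw [pow_mul]; exact Nat.pow_le_pow_left hs2 _
  have hWq : (s + 2) ^ d ≤ (n + 2) ^ c' :=
    (Nat.pow_le_pow_right (by omega) (by omega)).trans
      (hq1.trans (Nat.pow_le_pow_right (by omega) (by omega)))
  have htfW : tf < (n + 2) ^ c' := by
    have h1 : C * (n + 2) ^ 1 ≤ (n + 2) ^ (1 + C) := mul_pow_le_pow_add ..
    rw [pow_one] at h1
    have h2 : C * (n + 1) ≤ C * (n + 2) := Nat.mul_le_mul_left _ (by omega)
    have h3 : (n + 2) ^ (1 + C) < (n + 2) ^ c' := Nat.pow_lt_pow_right hone (by omega)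
    omega
  have htqW : tq < (n + 2) ^ c' := by
    have h1 : (s + 1) ^ 3 ≤ (n + 2) ^ ((2 + E) * (d + 3)) :=
      ((Nat.pow_le_pow_left (by omega) 3).trans
        (Nat.pow_le_pow_right (by omega) (by omega))).trans hq1
    have h2 := mul_pow_le_pow_add D' n ((2 + E) * (d + 3))
    have h3 : (n + 2) ^ ((2 + E) * (d + 3) + D') < (n + 2) ^ c' :=
      Nat.pow_lt_pow_right hone (by omega)
    have h4 := Nat.mul_le_mul_left D' h1
    omega
  obtain ⟨t, hct, ht⟩ := hcf.comp hcq (by split <;> omega) neg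
    (Nat.pow_le_pow_right (by omega) (by omega)) hWq (Nat.one_lt_pow (by omega) (by omega))
    htfW htqW
  refine ⟨t, ?_, ?_⟩
  · convert hct using 2
    have := h x
    by_cases hy : Q.yes (f x) <;> cases neg <;> simp_all
  · have h1 : (t : ℝ) ≤ 3 * tf + 3 * tq + 5 := by exact_mod_cast ht
    have h2 : (tf : ℝ) ≤ C * ((n : ℝ) + 1) := by exact_mod_cast htf
    have hn : (1 : ℝ) ≤ (n : ℝ) + 1 := by simp
    have hε1 : ε' ≤ 1 := min_le_right _ _
    have h3 : (n : ℝ) + 1 ≤ ((n : ℝ) + 1) ^ (3 - ε' / 2) := by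
      conv_lhs => rw [← Real.rpow_one ((n : ℝ) + 1)]
      exact Real.rpow_le_rpow_of_exponent_le hn (by linarith)
    have h4 : ((s : ℝ) + 1) ^ (3 - ε') ≤ K * ((n : ℝ) + 1) ^ (3 - ε' / 2) := by
      refine hgrow n s ?_
      have : (s : ℝ) ≤ C * ((n : ℝ) + 1) * ((c + 1) * Nat.size (n + 2)) := by exact_mod_cast hs
      linarith
    have h5 : (tq : ℝ) ≤ D' * (K * ((n : ℝ) + 1) ^ (3 - ε' / 2)) :=
      htq'.trans (mul_le_mul_of_nonneg_left h4 (by positivity))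
    have h6 : (C : ℝ) * ((n : ℝ) + 1) ≤ C * ((n : ℝ) + 1) ^ (3 - ε' / 2) :=
      mul_le_mul_of_nonneg_left h3 (by positivity)
    have h7 : (1 : ℝ) ≤ ((n : ℝ) + 1) ^ (3 - ε' / 2) := hn.trans h3
    nlinarith

/-! ## A program logic with running times -/

@[simp] theorem RamState.setReg_reg (σ : RamState) (r v s : ℕ) :
    (σ.setReg r v).reg s = if s = r then v else σ.reg s := by
  simp [RamState.setReg, Function.update_apply]

@[simp] theorem RamState.setReg_mem (σ : RamState) (r v : ℕ) : (σ.setReg r v).mem = σ.mem := rfl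

@[simp] theorem RamState.setReg_out (σ : RamState) (r v : ℕ) : (σ.setReg r v).out = σ.out := rfl

def RamState.emit (σ : RamState) (v : ℕ) : RamState := { σ with out := σ.out ++ [v] }

@[simp] theorem RamState.emit_reg (σ : RamState) (v : ℕ) : (σ.emit v).reg = σ.reg := rfl

@[simp] theorem RamState.emit_mem (σ : RamState) (v : ℕ) : (σ.emit v).mem = σ.mem := rfl

@[simp] theorem RamState.emit_out (σ : RamState) (v : ℕ) : (σ.emit v).out = σ.out ++ [v] := rfl

/-- Started in `σ`, the program halts within `T` steps in a state satisfying `Q`, all words being less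
than `W`. -/
def RamProg.Runs (W : ℕ) (p : RamProg) (σ : RamState) (T : ℕ) (Q : RamState → Prop) : Prop :=
  ∃ t σ', RamExec W p σ t σ' ∧ t ≤ T ∧ Q σ'

/-- Execution of several programs one after the other. -/
def RamProg.block (ps : List RamProg) : RamProg := ps.foldr .seq .skip

namespace RamProg.Runs

open RamProg

variable {W T : ℕ} {σ : RamState} {Q : RamState → Prop}

theorem mono {p : RamProg} {T' : ℕ} {Q' : RamState → Prop} (h : Runs W p σ T Q) (hT : T ≤ T')
    (hQ : ∀ σ', Q σ' → Q' σ') : Runs W p σ T' Q' := by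
  obtain ⟨t, σ', h₁, h₂, h₃⟩ := h
  exact ⟨t, σ', h₁, h₂.trans hT, hQ _ h₃⟩

theorem block_nil_iff : Runs W (block []) σ T Q ↔ 1 ≤ T ∧ Q σ := by
  constructor
  · rintro ⟨t, σ', h, ht, hQ⟩
    cases h
    exact ⟨ht, hQ⟩
  · rintro ⟨h, hQ⟩
    exact ⟨1, σ, .skip σ, h, hQ⟩

theorem seq_iff {p q : RamProg} : Runs W (.seq p q) σ T Q ↔
    ∃ t σ', RamExec W p σ t σ' ∧ t ≤ T ∧ Runs W q σ' (T - t) Q := by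
  constructor
  · rintro ⟨t, σ', h, ht, hQ⟩
    cases h with
    | seq h₁ h₂ => exact ⟨_, _, h₁, by omega, _, _, h₂, by omega, hQ⟩
  · rintro ⟨t, σ', h, ht, t', σ'', h', ht', hQ⟩
    exact ⟨_, _, .seq h h', by omega, hQ⟩

theorem block_cons_iff {p : RamProg} {ps : List RamProg} : Runs W (block (p :: ps)) σ T Q ↔
    ∃ t σ', RamExec W p σ t σ' ∧ t ≤ T ∧ Runs W (block ps) σ' (T - t) Q := seq_iff

theorem block_cons {p : RamProg} {ps : List RamProg} {T₁ : ℕ} {Q₁ : RamState → Prop}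
    (h₁ : Runs W p σ T₁ Q₁) (hT : T₁ ≤ T) (h₂ : ∀ σ', Q₁ σ' → Runs W (block ps) σ' (T - T₁) Q) :
    Runs W (block (p :: ps)) σ T Q := by
  obtain ⟨t, σ', h, ht, hQ⟩ := h₁
  exact block_cons_iff.2 ⟨t, σ', h, ht.trans hT, (h₂ _ hQ).mono (by omega) fun _ h => h⟩

/-- As equivalences, this and the following lemmas let straight-line code be executed symbolically
by rewriting, leaving the word bounds and time budgets as arithmetic goals. -/
theorem const_iff {r v : ℕ} {ps : List RamProg} : Runs W (block (.const r v :: ps)) σ T Q ↔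
    v < W ∧ 1 ≤ T ∧ Runs W (block ps) (σ.setReg r v) (T - 1) Q := by
  rw [block_cons_iff]
  constructor
  · rintro ⟨t, σ', h, ht, hQ⟩
    cases h with
    | const _ _ _ h => exact ⟨h, ht, hQ⟩
  · rintro ⟨h, ht, hQ⟩
    exact ⟨1, _, .const _ _ _ h, ht, hQ⟩

theorem op_iff {o : RamOp} {r a b : ℕ} {ps : List RamProg} :
    Runs W (block (.op o r a b :: ps)) σ T Q ↔ o.eval (σ.reg a) (σ.reg b) < W ∧ 1 ≤ T ∧
      Runs W (block ps) (σ.setReg r (o.eval (σ.reg a) (σ.reg b))) (T - 1) Q := by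
  rw [block_cons_iff]
  constructor
  · rintro ⟨t, σ', h, ht, hQ⟩
    cases h with
    | op _ _ _ _ _ h => exact ⟨h, ht, hQ⟩
  · rintro ⟨h, ht, hQ⟩
    exact ⟨1, _, .op _ _ _ _ _ h, ht, hQ⟩

theorem load_iff {r A i : ℕ} {ps : List RamProg} : Runs W (block (.load r A i :: ps)) σ T Q ↔
    σ.mem A (σ.reg i) < W ∧ 1 ≤ T ∧
      Runs W (block ps) (σ.setReg r (σ.mem A (σ.reg i))) (T - 1) Q := by
  rw [block_cons_iff]
  constructor
  · rintro ⟨t, σ', h, ht, hQ⟩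
    cases h with
    | load _ _ _ _ h => exact ⟨h, ht, hQ⟩
  · rintro ⟨h, ht, hQ⟩
    exact ⟨1, _, .load _ _ _ _ h, ht, hQ⟩

theorem write_iff {a : ℕ} {ps : List RamProg} : Runs W (block (.write a :: ps)) σ T Q ↔
    1 ≤ T ∧ Runs W (block ps) (σ.emit (σ.reg a)) (T - 1) Q := by
  rw [block_cons_iff]
  constructor
  · rintro ⟨t, σ', h, ht, hQ⟩
    cases h
    exact ⟨ht, hQ⟩
  · rintro ⟨ht, hQ⟩
    exact ⟨1, _, .write _ _, ht, hQ⟩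

theorem ite {r : ℕ} {p q : RamProg} (h : if σ.reg r ≠ 0 then Runs W p σ T Q else Runs W q σ T Q) :
    Runs W (.ite r p q) σ (T + 1) Q := by
  split_ifs at h with hr
  · obtain ⟨t, σ', h, ht, hQ⟩ := h
    exact ⟨_, _, .ite_true hr h, by omega, hQ⟩
  · obtain ⟨t, σ', h, ht, hQ⟩ := h
    exact ⟨_, _, .ite_false (by omega) h, by omega, hQ⟩

/-- The invariant is indexed by the list of items still to be processed, so the cost of a pass may
depend on its item. The total cost is then a sum over the items, which is needed when transitions
have words of different lengths. Each test of the loop adds one step. -/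
theorem loop_list {α : Type*} {r : ℕ} {p : RamProg} {I : List α → RamState → Prop} {F : α → ℕ}
    (h₀ : ∀ σ, I [] σ → σ.reg r = 0)
    (h₁ : ∀ a l σ, I (a :: l) σ → σ.reg r ≠ 0 ∧ Runs W p σ (F a) (I l)) (l : List α) :
    ∀ σ, I l σ → Runs W (.loop r p) σ ((l.map fun a => F a + 1).sum + 1) (I []) := by
  induction l with
  | nil => exact fun σ h => ⟨1, σ, .loop_false (h₀ _ h), by simp, h⟩
  | cons a l ih =>
    intro σ h
    obtain ⟨hr, t, σ', h, ht, hQ⟩ := h₁ _ _ _ h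
    obtain ⟨t', σ'', h', ht', hQ'⟩ := ih σ' hQ
    refine ⟨_, _, .loop_true hr h h', ?_, hQ'⟩
    simp only [List.map_cons, List.sum_cons]
    omega

theorem loop_nat {r : ℕ} {p : RamProg} {I : ℕ → RamState → Prop} {F : ℕ}
    (h₀ : ∀ σ, I 0 σ → σ.reg r = 0)
    (h₁ : ∀ n σ, I (n + 1) σ → σ.reg r ≠ 0 ∧ Runs W p σ F (I n)) (n : ℕ) :
    ∀ σ, I n σ → Runs W (.loop r p) σ (n * (F + 1) + 1) (I 0) := by
  intro σ h
  have := loop_list (W := W) (r := r) (p := p) (α := Unit) (I := fun l => I l.length)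
    (F := fun _ => F) (fun σ => h₀ σ) (fun _ l σ => h₁ l.length σ) (List.replicate n ()) σ
    (by simpa using h)
  simpa using this

theorem computes {p : RamProg} {i o : List ℕ}
    (h : Runs W p (RamState.init i) T fun σ => σ.out = o) : ∃ t, p.Computes W i o t ∧ t ≤ T := by
  obtain ⟨t, σ, h₁, h₂, h₃⟩ := h
  exact ⟨t, ⟨σ, h₁, h₃⟩, h₂⟩

end RamProg.Runs

theorem RamState.init_reg (l : List ℕ) (r : ℕ) :
    (RamState.init l).reg r = if r = 0 then l.length else 0 := by
  simp [RamState.init, Function.update_apply]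

theorem RamState.init_mem_zero (l : List ℕ) : (RamState.init l).mem 0 = fun i => l.getD i 0 := by
  simp [RamState.init]

theorem RamState.init_out (l : List ℕ) : (RamState.init l).out = [] := rfl

/-! ## From recognition to emptiness -/

theorem TapeSymbol.code_injective {k : ℕ} : (TapeSymbol.code (k := k)).Injective := by
  rintro (_ | _ | a) (_ | _ | b) h <;> simp [TapeSymbol.code, Fin.val_inj] at h ⊢
  exact h

theorem HeadMove.toInt_eq_code (d : HeadMove) : d.toInt = d.code - 1 := by
  cases d <;> rfl

namespace TwoNPDA

variable (M : TwoNPDA)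

/-- The control state of the simulating automaton that stands for the state `q` with the head in cell
`p - 1`. -/
def simState (m p : ℕ) (q : Fin M.numStates) : Fin ((m + 4) * M.numStates) :=
  finProdFinEquiv (Fin.ofNat (m + 4) p, q)

theorem simState_val {m p : ℕ} (hp : p < m + 4) (q : Fin M.numStates) :
    (M.simState m p q).val = p * M.numStates + q := by
  simp [simState, Nat.mod_eq_of_lt hp, mul_comm, add_comm]

theorem simState_inj {m p p' : ℕ} (hp : p < m + 4) (hp' : p' < m + 4) {q q' : Fin M.numStates}
    (h : M.simState m p q = M.simState m p' q') : p = p' ∧ q = q' := by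
  have := finProdFinEquiv.injective h
  simp only [Prod.mk.injEq, Fin.ext_iff, Fin.val_ofNat, Nat.mod_eq_of_lt hp,
    Nat.mod_eq_of_lt hp'] at this
  exact ⟨this.1, Fin.ext this.2⟩

/-- A transition taken in cell `p`, as a transition of the simulating automaton. -/
def simTransition (m p : ℕ) (τ : PDATransition M.numStates M.numLetters M.numStack) :
    PDATransition ((m + 4) * M.numStates) 0 M.numStack where
  src := M.simState m (p + 1) τ.src
  read := .leftEnd
  top := τ.top
  -- The code of a move is its displacement plus one, and positions are shifted by one as well, so
  -- no subtraction occurs. A move off the tape leads to position `0` or `m + 3`, which no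
  -- transition leaves.
  dst := M.simState m (p + τ.move.code) τ.dst
  push := τ.push
  move := .stay

/-- The accepting move of the simulating automaton. -/
def simAccept (m : ℕ) (q : Fin M.numStates) :
    PDATransition ((m + 4) * M.numStates) 0 M.numStack where
  src := M.simState m (m + 2) q
  read := .leftEnd
  top := M.bottom
  dst := M.simState m (m + 2) q
  push := [M.bottom]
  move := .right

def simTransitions (w : List (Fin M.numLetters)) :
    List (PDATransition ((w.length + 4) * M.numStates) 0 M.numStack) :=
  (List.range (w.length + 2)).flatMap (fun p =>
    (M.trans.filter fun τ => τ.read.code = ((M.tape w).getD p .leftEnd).code).map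
      (M.simTransition w.length p)) ++
  ((List.finRange M.numStates).filter (· ∈ M.final)).map (M.simAccept w.length)

theorem mem_simTransitions {w : List (Fin M.numLetters)}
    {ρ : PDATransition ((w.length + 4) * M.numStates) 0 M.numStack} :
    ρ ∈ M.simTransitions w ↔
      (∃ p, ∃ τ ∈ M.trans, (M.tape w)[p]? = some τ.read ∧ ρ = M.simTransition w.length p τ) ∨
      ∃ q ∈ M.final, ρ = M.simAccept w.length q := by
  have hl : (M.tape w).length = w.length + 2 := by simp [tape]
  simp only [simTransitions, List.mem_append, List.mem_flatMap, List.mem_range, List.mem_map,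
    List.mem_filter, decide_eq_true_eq, List.mem_finRange, true_and]
  refine or_congr ⟨?_, ?_⟩ ⟨?_, ?_⟩
  · rintro ⟨p, hp, τ, ⟨hτ, hc⟩, rfl⟩
    refine ⟨p, τ, hτ, ?_, rfl⟩
    rw [TapeSymbol.code_injective hc]
    rw [← hl] at hp
    simp [List.getElem?_eq_getElem hp]
  · rintro ⟨p, τ, hτ, hr, rfl⟩
    have hp := (List.getElem?_eq_some_iff.1 hr).1
    refine ⟨p, by omega, τ, ⟨hτ, ?_⟩, rfl⟩
    simp [hr]
  · rintro ⟨q, hq, rfl⟩; exact ⟨q, hq, rfl⟩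
  · rintro ⟨q, hq, rfl⟩; exact ⟨q, hq, rfl⟩

/-- A one-way automaton that simulates `M` on the word `w` without moving its head, which it moves to
the right endmarker in the end. -/
def simPDA (w : List (Fin M.numLetters)) : PDA where
  numStates := (w.length + 4) * M.numStates
  numLetters := 0
  numStack := M.numStack
  start := M.simState w.length 1 M.start
  bottom := M.bottom
  -- The right endmarker is reached only by the accepting move, which starts from final states of
  -- `M`, so nothing more needs to be marked.
  final := Finset.univ
  trans := M.simTransitions w
  bottom_kept := by
    intro ρ hρ ht
    rcases M.mem_simTransitions.1 hρ with ⟨p, τ, hτ, -, rfl⟩ | ⟨q, -, rfl⟩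
    · exact M.bottom_kept τ hτ ht
    · exact ⟨[], by simp, rfl⟩
  bottom_not_pushed := by
    intro ρ hρ ht
    rcases M.mem_simTransitions.1 hρ with ⟨p, τ, hτ, -, rfl⟩ | ⟨q, -, rfl⟩
    · exact M.bottom_not_pushed τ hτ ht
    · exact absurd rfl ht
  one_way := by
    intro ρ hρ
    rcases M.mem_simTransitions.1 hρ with ⟨p, τ, -, -, rfl⟩ | ⟨q, -, rfl⟩ <;>
      simp [simTransition, simAccept]

variable {M} in
theorem tape_length (w : List (Fin M.numLetters)) : (M.tape w).length = w.length + 2 := by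
  simp [tape]

theorem simPDA_reaches {w : List (Fin M.numLetters)} {c : M.Config}
    (h : Relation.ReflTransGen (M.Step w) ⟨M.start, 0, [M.bottom]⟩ c) :
    Relation.ReflTransGen ((M.simPDA w).Step []) ⟨(M.simPDA w).start, 0, [M.bottom]⟩
      ⟨M.simState w.length (c.pos + 1) c.state, 0, c.stack⟩ := by
  induction h with
  | refl => exact .refl
  | @tail c c' _ h ih =>
    refine ih.tail ?_
    obtain ⟨τ, hτ, γ, h₁, h₂, h₃, h₄, h₅, h₆, h₇⟩ := h
    refine ⟨_, M.mem_simTransitions.2 (.inl ⟨c.pos, τ, hτ, h₂, rfl⟩), γ, ?_, ?_, ?_, ?_, ?_, ?_, ?_⟩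
    · rw [h₁]; rfl
    · rfl
    · exact h₃
    · have : c'.pos + 1 = c.pos + τ.move.code := by
        rw [HeadMove.toInt_eq_code] at h₆; omega
      simp only [simTransition, this, h₄]; rfl
    · exact h₅
    · rfl
    · exact Nat.succ_pos _

/-- What the configurations of the simulating automaton stand for. -/
def SimInvariant (w : List (Fin M.numLetters)) (c : (M.simPDA w).Config) : Prop :=
  (c.pos = 0 ∧ ∃ p q, p < w.length + 4 ∧ c.state = M.simState w.length p q ∧
    -- For a simulated head off the tape (`p = 0` or `p = w.length + 3`) the condition is vacuous.
    ∀ p', p = p' + 1 → p' < w.length + 2 →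
      Relation.ReflTransGen (M.Step w) ⟨M.start, 0, [M.bottom]⟩ ⟨q, p', c.stack⟩) ∨
  (c.pos = 1 ∧ ∃ q ∈ M.final,
    Relation.ReflTransGen (M.Step w) ⟨M.start, 0, [M.bottom]⟩ ⟨q, w.length + 1, c.stack⟩)

theorem simInvariant_of_reaches {w : List (Fin M.numLetters)} {c : (M.simPDA w).Config}
    (h : Relation.ReflTransGen ((M.simPDA w).Step [])
      ⟨(M.simPDA w).start, 0, [M.bottom]⟩ c) : M.SimInvariant w c := by
  induction h with
  | refl =>
    refine .inl ⟨rfl, 1, M.start, by omega, rfl, ?_⟩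
    intro p' hp _
    obtain rfl : p' = 0 := by omega
    exact .refl
  | @tail c c' _ h ih =>
    obtain ⟨ρ, hρ, γ, h₁, h₂, h₃, h₄, h₅, h₆, h₇⟩ := h
    have hread : ρ.read = .leftEnd := by
      rcases M.mem_simTransitions.1 hρ with ⟨p, τ, -, -, rfl⟩ | ⟨q, -, rfl⟩ <;> rfl
    rcases ih with ⟨hpos, p, q, hp, hst, hreach⟩ | ⟨hpos, -⟩
    · rcases M.mem_simTransitions.1 hρ with ⟨i, τ, hτ, hi, rfl⟩ | ⟨q', hq', rfl⟩
      · have hi' := (List.getElem?_eq_some_iff.1 hi).1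
        rw [tape_length] at hi'
        obtain ⟨rfl, rfl⟩ := M.simState_inj hp (by omega) (hst.symm.trans h₁)
        have hcode : τ.move.code ≤ 2 := by cases τ.move <;> simp [HeadMove.code]
        refine .inl ⟨?_, i + τ.move.code, τ.dst, by omega, h₄, fun p' hp' hlt => ?_⟩
        · simp only [simTransition, HeadMove.toInt] at h₆; omega
        · refine (hreach i rfl hi').tail ⟨τ, hτ, γ, rfl, hi, h₃, rfl, h₅, ?_, ?_⟩
          · simp only [HeadMove.toInt_eq_code]; omega
          · rw [tape_length]; exact hlt
      · obtain ⟨rfl, rfl⟩ := M.simState_inj hp (by omega) (hst.symm.trans h₁)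
        refine .inr ⟨?_, q, hq', ?_⟩
        · simp only [simAccept, HeadMove.toInt] at h₆; omega
        · have h₅' : c'.stack = c.stack := h₅.trans h₃.symm
          rw [h₅']
          exact hreach _ rfl (by omega)
    -- After the accepting move the head is on the right endmarker, while every transition reads the
    -- left one.
    · rw [hpos, hread] at h₂
      simp [tape] at h₂

theorem simPDA_language_ne_zero (w : List (Fin M.numLetters)) :
    ¬ (M.simPDA w).language = 0 ↔ w ∈ M.language := by
  constructor
  · intro h
    obtain ⟨v, hv⟩ : ∃ v, v ∈ (M.simPDA w).language := by
      by_contra! h'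
      exact h (Set.eq_empty_of_forall_notMem h')
    obtain ⟨q, -, hq⟩ := hv
    obtain rfl : v = [] := by
      cases v with
      | nil => rfl
      | cons a _ => exact a.elim0
    rcases M.simInvariant_of_reaches hq with ⟨h, -⟩ | ⟨-, q, hq, h⟩
    · simp at h
    · exact ⟨q, hq, h⟩
  · rintro ⟨q, hq, h⟩ h0
    have : [] ∈ (M.simPDA w).language := by
      refine ⟨M.simState w.length (w.length + 2) q, Finset.mem_univ _, ?_⟩
      refine (M.simPDA_reaches h).tail
        ⟨_, M.mem_simTransitions.2 (.inr ⟨q, hq, rfl⟩), [], rfl, rfl, rfl, rfl, rfl, rfl, ?_⟩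
      simp [tape]
    rw [h0] at this
    exact this

end TwoNPDA

/-! ### Writing the simulating automaton in linear time -/

namespace RamProg

/-- Write, for each pair `(r, v)`, the sum of the content of register `r` and `v` (with scratch register
`9`). -/
def emitAll (l : List (ℕ × ℕ)) : RamProg :=
  block (l.flatMap fun x => [.const 9 x.2, .op .add 9 x.1 9, .write 9])

theorem Runs.emitAll {W : ℕ} {l : List (ℕ × ℕ)} {σ : RamState} (h9 : ∀ x ∈ l, x.1 ≠ 9)
    (hW : ∀ x ∈ l, σ.reg x.1 + x.2 < W) :
    Runs W (emitAll l) σ (3 * l.length + 1) fun σ' =>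
      σ'.out = σ.out ++ l.map (fun x => σ.reg x.1 + x.2) ∧
      (∀ r, r ≠ 9 → σ'.reg r = σ.reg r) ∧ σ'.mem = σ.mem := by
  induction l generalizing σ with
  | nil => simp [RamProg.emitAll, Runs.block_nil_iff]
  | cons x l ih =>
    have h9x := h9 x (by simp)
    have hWx := hW x (by simp)
    simp only [RamProg.emitAll, List.flatMap_cons, List.cons_append, List.nil_append,
      Runs.const_iff, Runs.op_iff, Runs.write_iff, RamOp.eval, RamState.setReg_reg, h9x, if_false,
      if_true, List.length_cons]
    refine ⟨by omega, by omega, by omega, by omega, by omega, ?_⟩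
    refine (ih (fun y hy => h9 y (by simp [hy])) fun y hy => ?_).mono (by omega) fun σ' h => ?_
    · simpa [h9 y (by simp [hy])] using hW y (by simp [hy])
    · refine ⟨?_, fun r hr => by simp [h.2.1 r hr, hr], h.2.2⟩
      rw [h.1]
      simp only [RamState.emit_out, RamState.setReg_out, RamState.emit_reg, RamState.setReg_reg,
        List.append_assoc, List.map_cons, List.singleton_append]
      congr 2
      refine List.map_congr_left fun y hy => ?_
      simp [h9 y (by simp [hy])]

end RamProg

namespace TwoNPDA

variable (M : TwoNPDA)

open RamProg

/-- The entries of `simTransition`, relative to register `4` (which holds `0`) and register `5` (which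
holds `p` times the number of states). -/
def simEntries (τ : PDATransition M.numStates M.numLetters M.numStack) : List (ℕ × ℕ) :=
  [(5, M.numStates + τ.src), (4, 0), (4, τ.top), (5, τ.move.code * M.numStates + τ.dst), (4, 1),
    (4, τ.push.length)] ++ τ.push.map fun Z => (4, Z.val)

/-- A bound on all constants in `M`. -/
def weight : ℕ :=
  4 * M.numStates + M.numLetters + M.numStack + (M.trans.map fun τ => τ.push.length + 1).sum + 5

theorem weight_eq : M.weight = 4 * M.numStates + M.numLetters + M.numStack +
    (M.trans.map fun τ => τ.push.length + 1).sum + 5 := rfl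

theorem length_push_le {τ : PDATransition M.numStates M.numLetters M.numStack}
    (hτ : τ ∈ M.trans) : τ.push.length + 1 ≤ (M.trans.map fun τ => τ.push.length + 1).sum :=
  List.le_sum_of_mem (List.mem_map.2 ⟨τ, hτ, rfl⟩)

/-- Write the transitions in a cell whose symbol has the code in register `6`. -/
def simCell : RamProg :=
  block (M.trans.flatMap fun τ =>
    [.const 9 τ.read.code, .op .eq 9 9 6, .ite 9 (emitAll (M.simEntries τ)) .skip])

def encodeTransition {s k g : ℕ} (τ : PDATransition s k g) : List ℕ :=
  [τ.src.val, τ.read.code, τ.top.val, τ.dst.val, τ.move.code, τ.push.length] ++ τ.push.map Fin.val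

/-- The transitions of the fixed automaton are unrolled into the program, one test for each, so a
cell costs constant time. All state numbers arise from `p * M.numStates`, kept in register `5`, by
adding constants of `M`. -/
theorem runs_simCell {W m p a : ℕ} {σ : RamState} (h4 : σ.reg 4 = 0)
    (h5 : σ.reg 5 = p * M.numStates) (h6 : σ.reg 6 = a) (hp : p < m + 2)
    (hW : p * M.numStates + M.weight < W) :
    Runs W M.simCell σ (22 * M.weight + 1) fun σ' =>
      σ'.out = σ.out ++ ((M.trans.filter fun τ => τ.read.code = a).map
        (M.simTransition m p)).flatMap encodeTransition ∧
      (∀ r, r ≠ 9 → σ'.reg r = σ.reg r) ∧ σ'.mem = σ.mem := by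
  -- The inclusion in `M.trans` lets every constant be bounded by the weight during the induction on
  -- the list.
  have key : ∀ l : List (PDATransition M.numStates M.numLetters M.numStack), l ⊆ M.trans →
      ∀ σ : RamState, σ.reg 4 = 0 → σ.reg 5 = p * M.numStates → σ.reg 6 = a →
      Runs W (block (l.flatMap fun τ =>
        [.const 9 τ.read.code, .op .eq 9 9 6, .ite 9 (emitAll (M.simEntries τ)) .skip])) σ
        ((l.map fun τ => 3 * τ.push.length + 22).sum + 1) fun σ' =>
      σ'.out = σ.out ++ ((l.filter fun τ => τ.read.code = a).map
        (M.simTransition m p)).flatMap encodeTransition ∧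
      (∀ r, r ≠ 9 → σ'.reg r = σ.reg r) ∧ σ'.mem = σ.mem := by
    intro l
    induction l with
    | nil => intro _ σ _ _ _; simp [Runs.block_nil_iff]
    | cons τ l ih =>
      intro hl σ h4 h5 h6
      have hτ := M.length_push_le (hl (List.mem_cons_self ..))
      have hr : τ.read.code < M.numLetters + 2 := by
        cases τ.read <;> simp [TapeSymbol.code]
      have hwt := M.weight_eq
      simp only [List.flatMap_cons, List.cons_append, List.nil_append, Runs.const_iff, Runs.op_iff,
        RamOp.eval, RamState.setReg_reg, if_true, List.map_cons, List.sum_cons]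
      refine ⟨by omega, by omega, by split <;> split <;> omega, by omega, ?_⟩
      have hmove : τ.move.code ≤ 2 := by cases τ.move <;> simp [HeadMove.code]
      refine Runs.block_cons (T₁ := 3 * τ.push.length + 20) (Q₁ := fun σ' =>
        σ'.out = σ.out ++ (if τ.read.code = a then encodeTransition (M.simTransition m p τ) else []) ∧
        (∀ r, r ≠ 9 → σ'.reg r = σ.reg r) ∧ σ'.mem = σ.mem) ?_ (by omega) ?_
      · refine Runs.ite ?_
        simp only [RamState.setReg_reg, if_true]
        by_cases ha : τ.read.code = a
        · simp only [ha, h6]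
          norm_num
          refine (Runs.emitAll ?_ ?_).mono ?_ fun σ' h => ⟨?_, fun r hr => ?_, ?_⟩
          · intro x hx
            simp only [simEntries, List.cons_append, List.nil_append, List.mem_cons,
              List.mem_map] at hx
            rcases hx with rfl | rfl | rfl | rfl | rfl | rfl | ⟨Z, -, rfl⟩ <;> simp
          · intro x hx
            have := τ.src.isLt
            have := τ.dst.isLt
            have := τ.top.isLt
            have : τ.move.code * M.numStates ≤ 2 * M.numStates := Nat.mul_le_mul_right _ hmove
            simp only [simEntries, List.cons_append, List.nil_append, List.mem_cons,
              List.mem_map] at hx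
            rcases hx with rfl | rfl | rfl | rfl | rfl | rfl | ⟨Z, -, rfl⟩ <;>
              simp [h4, h5] <;> omega
          · simp [simEntries]; omega
          · rw [h.1]
            simp only [RamState.setReg_out, List.append_cancel_left_eq]
            simp only [simEntries, encodeTransition, simTransition,
              M.simState_val (show p + 1 < m + 4 by omega),
              M.simState_val (show p + τ.move.code < m + 4 by omega)]
            simp [h4, h5, TapeSymbol.code]
            refine ⟨by ring, by ring, rfl⟩
          · simp [h.2.1 r hr, hr]
          · simp [h.2.2]
        · have ha' : τ.read.code ≠ σ.reg 6 := by rwa [h6]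
          simp [ha, ha']
          exact ⟨1, _, .skip _, by omega, by simp, fun r hr => by simp [hr], by simp⟩
      · intro σ' h
        refine (ih (fun _ hx => hl (List.mem_cons_of_mem _ hx)) σ' ?_ ?_ ?_).mono (by omega)
          fun σ'' h' => ⟨?_, fun r hr => ?_, ?_⟩
        · rw [h.2.1 _ (by omega), h4]
        · rw [h.2.1 _ (by omega), h5]
        · rw [h.2.1 _ (by omega), h6]
        · rw [h'.1, h.1]
          by_cases ha : τ.read.code = a <;> simp [ha]
        · rw [h'.2.1 r hr, h.2.1 r hr]
        · rw [h'.2.2, h.2.2]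
  refine (key M.trans (List.Subset.refl _) σ h4 h5 h6).mono ?_ fun _ h => h
  have h1 : (M.trans.map fun τ => 3 * τ.push.length + 22).sum ≤
      22 * (M.trans.map fun τ => τ.push.length + 1).sum := by
    rw [← List.sum_map_mul_left]
    exact List.sum_le_sum fun τ _ => by omega
  have h2 := M.weight_eq
  omega

/-- The entries of `simAccept`, relative to registers `4` and `5`. -/
def acceptEntries (q : Fin M.numStates) : List (ℕ × ℕ) :=
  [(5, M.numStates + q), (4, 0), (4, M.bottom), (5, M.numStates + q), (4, 2), (4, 1), (4, M.bottom)]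

/-- The program that writes the automaton `simPDA`. -/
def simProgram : RamProg :=
  -- Register `0` holds the input length, `1` the number one, `2` the number of states, counted down
  -- while the marks of the states are written, `3` the number of states of `M`, `4` zero, `5` the
  -- offset of the current cell, `6` the code of its symbol, `7` the input address and `10` the loop
  -- condition.
  block [.const 1 1, .const 3 M.numStates, .const 4 4, .op .add 2 0 4, .op .mul 2 2 3, .const 4 0,
    emitAll [(2, 0), (4, 0), (4, M.numStack), (4, M.numStates + M.start), (4, M.bottom)],
    .loop 2 (block [.write 1, .op .sub 2 2 1]),
    emitAll (([0, 1] ++ List.range M.numStack).map fun v => (4, v)),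
    .const 5 0, .const 6 0, M.simCell,
    .const 7 0, .op .lt 10 7 0,
    .loop 10 (block [.op .add 5 5 3, .load 6 0 7, .const 9 2, .op .add 6 6 9, M.simCell,
      .op .add 7 7 1, .op .lt 10 7 0]),
    .op .add 5 5 3, .const 6 1, M.simCell,
    emitAll (((List.finRange M.numStates).filter (· ∈ M.final)).flatMap M.acceptEntries)]

/-- The entries for the transitions of `simPDA` in cell `p`. -/
def cellOutput (w : List (Fin M.numLetters)) (p : ℕ) : List ℕ :=
  ((M.trans.filter fun τ => τ.read.code = ((M.tape w).getD p .leftEnd).code).map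
    (M.simTransition w.length p)).flatMap encodeTransition

theorem encode_simPDA (w : List (Fin M.numLetters)) : (M.simPDA w).encode =
    [(w.length + 4) * M.numStates, 0, M.numStack, M.numStates + M.start, M.bottom.val] ++
    List.replicate ((w.length + 4) * M.numStates) 1 ++ ([0, 1] ++ List.range M.numStack) ++
    (List.range (w.length + 2)).flatMap (M.cellOutput w) ++
    (((List.finRange M.numStates).filter (· ∈ M.final)).map
      (M.simAccept w.length)).flatMap encodeTransition := by
  have h1 : ((M.simPDA w).start).val = M.numStates + M.start := by
    simp only [simPDA, M.simState_val (show 1 < w.length + 4 by omega)]; ring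
  have h2 : (M.simPDA w).trans.flatMap (fun τ =>
      [τ.src.val, τ.read.code, τ.top.val, τ.dst.val, τ.move.code, τ.push.length] ++
        τ.push.map Fin.val) = (List.range (w.length + 2)).flatMap (M.cellOutput w) ++
    (((List.finRange M.numStates).filter (· ∈ M.final)).map
      (M.simAccept w.length)).flatMap encodeTransition := by
    change (M.simTransitions w).flatMap encodeTransition = _
    rw [simTransitions, List.flatMap_append, List.flatMap_assoc]
    rfl
  have h3 : (fun q : Fin (M.simPDA w).numStates => if q ∈ (M.simPDA w).final then 1 else 0) =
      fun _ => 1 := funext fun q => if_pos (Finset.mem_univ q)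
  rw [encode, h1, h2, h3, List.ofFn_const]
  simp only [simPDA, List.append_assoc]
  rfl

/-- The contents of the registers that the simulation does not change, and of the input array. -/
structure SimRegs (w : List (Fin M.numLetters)) (σ : RamState) : Prop where
  reg0 : σ.reg 0 = w.length
  reg1 : σ.reg 1 = 1
  reg3 : σ.reg 3 = M.numStates
  reg4 : σ.reg 4 = 0
  mem : σ.mem 0 = fun i => (w.map Fin.val).getD i 0

variable {M} in
theorem SimRegs.of_frame {w : List (Fin M.numLetters)} {σ σ' : RamState} (h : M.SimRegs w σ)
    (hr : ∀ r, r ≠ 9 → σ'.reg r = σ.reg r) (hm : σ'.mem = σ.mem) : M.SimRegs w σ' :=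
  ⟨by rw [hr _ (by omega), h.reg0], by rw [hr _ (by omega), h.reg1], by rw [hr _ (by omega), h.reg3],
    by rw [hr _ (by omega), h.reg4], by rw [hm, h.mem]⟩

variable {M} in
theorem SimRegs.setReg {w : List (Fin M.numLetters)} {σ : RamState} (h : M.SimRegs w σ) {r : ℕ}
    (hr : 4 < r) (v : ℕ) : M.SimRegs w (σ.setReg r v) := by
  refine ⟨?_, ?_, ?_, ?_, h.mem⟩ <;> rw [RamState.setReg_reg, if_neg (by omega)]
  exacts [h.reg0, h.reg1, h.reg3, h.reg4]

theorem runs_simProgram_header (w : List (Fin M.numLetters)) {W T : ℕ} {ps : List RamProg}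
    {Q : RamState → Prop} (hW : (w.length + 4) * M.numStates + M.weight < W)
    (hT : 4 * ((w.length + 4) * M.numStates) + 100 + 3 * M.numStack ≤ T)
    (h : ∀ σ : RamState, M.SimRegs w σ → σ.out =
      [(w.length + 4) * M.numStates, 0, M.numStack, M.numStates + M.start, M.bottom.val] ++
      List.replicate ((w.length + 4) * M.numStates) 1 ++ ([0, 1] ++ List.range M.numStack) →
      Runs W (block ps) σ (T - (4 * ((w.length + 4) * M.numStates) + 100 + 3 * M.numStack)) Q) :
    Runs W (block (.const 1 1 :: .const 3 M.numStates :: .const 4 4 :: .op .add 2 0 4 ::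
      .op .mul 2 2 3 :: .const 4 0 ::
      emitAll [(2, 0), (4, 0), (4, M.numStack), (4, M.numStates + M.start), (4, M.bottom)] ::
      .loop 2 (block [.write 1, .op .sub 2 2 1]) ::
      emitAll (([0, 1] ++ List.range M.numStack).map fun v => (4, v)) :: ps))
      (RamState.init (w.map Fin.val)) T Q := by
  set m := w.length with hm
  have hwt := M.weight_eq
  have hs1 : 0 < M.numStates := M.start.pos
  have hb := M.bottom.isLt
  have hst := M.start.isLt
  have hS : m + 4 ≤ (m + 4) * M.numStates := Nat.le_mul_of_pos_right _ hs1
  simp only [Runs.const_iff, Runs.op_iff, RamOp.eval, RamState.setReg_reg,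
    RamState.init_reg, List.length_map, ← hm]
  norm_num only [if_true, if_false]
  refine ⟨by omega, by omega, by omega, by omega, by omega, by omega, by omega, by omega, by omega,
    by omega, by omega, by omega, ?_⟩
  set S := (m + 4) * M.numStates
  refine Runs.block_cons (Runs.emitAll (by simp) ?_) (by simp; omega) fun σ₁ h₁ => ?_
  · simp [RamState.init_reg]; omega
  simp [RamState.init_reg, RamState.init_out] at h₁
  obtain ⟨o₁, r₁, m₁⟩ := h₁
  have R₁ : M.SimRegs w σ₁ := by
    refine ⟨?_, ?_, ?_, ?_, ?_⟩ <;> simp [r₁, m₁, RamState.init_mem_zero]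
  refine Runs.block_cons (Runs.loop_nat (F := 3) (I := fun n σ => n ≤ S ∧ M.SimRegs w σ ∧
    σ.reg 2 = n ∧ σ.out ++ List.replicate n 1 = σ₁.out ++ List.replicate S 1)
    (fun σ h => h.2.2.1) ?_ S σ₁ ?_) ?_ fun σ₂ h₂ => ?_
  · rintro n σ ⟨hn, R, h2, ho⟩
    refine ⟨by omega, ?_⟩
    simp only [Runs.write_iff, Runs.op_iff, Runs.block_nil_iff, RamOp.eval]
    simp [R.reg1, h2]
    refine ⟨by omega, by omega, ⟨?_, ?_, ?_, ?_, ?_⟩, ?_⟩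
    · simp [R.reg0]
    · simp [R.reg1]
    · simp [R.reg3]
    · simp [R.reg4]
    · simp [R.mem]
    · rw [← ho, List.replicate_succ]
  · exact ⟨le_rfl, R₁, by simp [r₁], rfl⟩
  · simp; omega
  obtain ⟨-, R₂, -, o₂⟩ := h₂
  refine Runs.block_cons (Runs.emitAll (by simp) ?_) (by simp; omega) fun σ₃ h₃ => ?_
  · simp [R₂.reg4]
    refine ⟨by omega, by omega, fun b hb => by omega⟩
  refine (h σ₃ (R₂.of_frame h₃.2.1 h₃.2.2) ?_).mono (by simp; omega) fun _ h => h
  rw [h₃.1, List.map_map]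
  simp only [List.replicate_zero, List.append_nil] at o₂
  rw [o₂, o₁]
  simp [R₂.reg4, Function.comp_def]

/-- Cell `0` carries the left endmarker and is written before the loop. The pass with input address
`i` treats cell `i + 1`, whose symbol has the code `w[i] + 2` because the codes `0` and `1` belong
to the endmarkers. -/
theorem runs_simProgram_loop (w : List (Fin M.numLetters)) {W : ℕ} {σ : RamState}
    (hW : (w.length + 4) * M.numStates + M.weight < W) (R : M.SimRegs w σ) (h5 : σ.reg 5 = 0)
    (h7 : σ.reg 7 = 0) (h10 : σ.reg 10 = if 0 < w.length then 1 else 0)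
    {o : List ℕ} (ho : σ.out = o ++ M.cellOutput w 0) :
    Runs W (.loop 10 (block [.op .add 5 5 3, .load 6 0 7, .const 9 2, .op .add 6 6 9, M.simCell,
      .op .add 7 7 1, .op .lt 10 7 0])) σ (w.length * (22 * M.weight + 10) + 1) fun σ' =>
      M.SimRegs w σ' ∧ σ'.reg 5 = w.length * M.numStates ∧
      σ'.out = o ++ (List.range (w.length + 1)).flatMap (M.cellOutput w) := by
  have hwt := M.weight_eq
  have hs1 : 0 < M.numStates := M.start.pos
  refine (Runs.loop_nat (F := 22 * M.weight + 9) (I := fun n σ => ∃ i, i + n = w.length ∧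
    M.SimRegs w σ ∧ σ.reg 5 = i * M.numStates ∧ σ.reg 7 = i ∧
    σ.reg 10 = (if i < w.length then 1 else 0) ∧
    σ.out = o ++ (List.range (i + 1)).flatMap (M.cellOutput w)) ?_ ?_ w.length σ ?_).mono le_rfl ?_
  · rintro σ ⟨i, hi, -, -, -, h, -⟩
    rw [h, if_neg (by omega)]
  · rintro n σ ⟨i, hi, R, h5, h7, h10, ho⟩
    have hlt : i < w.length := by omega
    refine ⟨by rw [h10, if_pos hlt]; omega, ?_⟩
    have his : (i + 1) * M.numStates ≤ (w.length + 4) * M.numStates :=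
      Nat.mul_le_mul_right _ (by omega)
    have hi1 : i + 1 ≤ (i + 1) * M.numStates := Nat.le_mul_of_pos_right _ hs1
    have his' : (i + 1) * M.numStates = i * M.numStates + M.numStates := by ring
    have hwi := (w[i]).isLt
    simp only [Runs.const_iff, Runs.op_iff, Runs.load_iff, RamOp.eval, RamState.setReg_reg,
      RamState.setReg_mem, R.mem, h5, h7, R.reg3]
    norm_num only [if_true, if_false]
    simp only [List.getD_eq_getElem?_getD, List.getElem?_map, List.getElem?_eq_getElem hlt,
      Option.map_some, Option.getD_some]
    refine ⟨by omega, by omega, by omega, by omega, by omega, by omega, by omega, by omega, ?_⟩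
    refine Runs.block_cons (M.runs_simCell (m := w.length) (p := i + 1) (a := w[i] + 2) ?_ ?_ ?_
      (by omega) (by omega)) (by omega) fun σ' h' => ?_
    · simp [R.reg4]
    · simp; omega
    · simp
    have R' : M.SimRegs w σ' := (((((R.setReg (by omega) _).setReg (by omega) _).setReg
      (by omega) _).setReg (by omega) _).of_frame h'.2.1 h'.2.2)
    have h7' : σ'.reg 7 = i := by rw [h'.2.1 _ (by omega)]; simp [h7]
    have h5' : σ'.reg 5 = (i + 1) * M.numStates := by rw [h'.2.1 _ (by omega)]; simp; omega
    simp only [Runs.op_iff, RamOp.eval, RamState.setReg_reg, Runs.block_nil_iff, h7', R'.reg1]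
    norm_num only [if_true, if_false]
    rw [R'.reg0]
    refine ⟨by omega, by omega, by split <;> omega, by omega, by omega, i + 1, by omega,
      (R'.setReg (by omega) _).setReg (by omega) _, ?_, ?_, ?_, ?_⟩
    · simp [h5']
    · simp
    · simp
    · have hg : (M.tape w).getD (i + 1) .leftEnd = .letter w[i] := by
        simp [tape, List.getElem?_append_left, hlt]
      rw [List.range_succ, List.flatMap_append, ← List.append_assoc, ← ho]
      simp only [RamState.setReg_out, h'.1, List.flatMap_singleton, cellOutput, hg]
      rfl
  · exact ⟨0, by omega, R, by simp [h5], h7, h10, by simpa using ho⟩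
  · rintro σ ⟨i, hi, R, h5, -, -, ho⟩
    obtain rfl : i = w.length := by omega
    exact ⟨R, h5, ho⟩

theorem runs_simProgram (w : List (Fin M.numLetters)) {W : ℕ}
    (hW : (w.length + 4) * M.numStates + M.weight < W) :
    Runs W M.simProgram (RamState.init (w.map Fin.val))
      (300 * (w.length * M.weight + w.length + M.weight + 1)) fun σ =>
      σ.out = (M.simPDA w).encode := by
  have hwt := M.weight_eq
  have hs1 : 0 < M.numStates := M.start.pos
  have hms : w.length * M.numStates ≤ w.length * M.weight := Nat.mul_le_mul_left _ (by omega)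
  have hS : (w.length + 4) * M.numStates = w.length * M.numStates + 4 * M.numStates := by ring
  have hml : w.length ≤ w.length * M.numStates := Nat.le_mul_of_pos_right _ hs1
  have hmw : w.length * (22 * M.weight + 10) = 22 * (w.length * M.weight) + 10 * w.length := by ring
  rw [encode_simPDA]
  refine M.runs_simProgram_header w hW (by omega) fun σ₁ R₁ o₁ => ?_
  simp only [Runs.const_iff]
  refine ⟨by omega, by omega, by omega, by omega, ?_⟩
  refine Runs.block_cons (M.runs_simCell (m := w.length) (p := 0) (a := 0) ?_ ?_ ?_
    (by omega) (by omega)) (by omega) fun σ₂ h₂ => ?_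
  · simp [R₁.reg4]
  · simp
  · simp
  have R₂ : M.SimRegs w σ₂ := ((R₁.setReg (by omega) _).setReg (by omega) _).of_frame h₂.2.1 h₂.2.2
  have h5 : σ₂.reg 5 = 0 := by rw [h₂.2.1 _ (by omega)]; simp
  simp only [Runs.const_iff, Runs.op_iff, RamOp.eval, RamState.setReg_reg]
  norm_num only [if_true, if_false]
  rw [R₂.reg0]
  refine ⟨by omega, by omega, by split <;> omega, by omega, ?_⟩
  refine Runs.block_cons (M.runs_simProgram_loop w (o := σ₁.out) hW
    ((R₂.setReg (by omega) _).setReg (by omega) _) ?_ ?_ ?_ ?_) ?_ fun σ₃ h₃ => ?_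
  · simp [h5]
  · simp
  · simp
  · simp only [RamState.setReg_out, h₂.1]
    rfl
  · omega
  obtain ⟨R₃, h5, o₃⟩ := h₃
  simp only [Runs.const_iff, Runs.op_iff, RamOp.eval, h5, R₃.reg3]
  refine ⟨by omega, by omega, by omega, by omega, ?_⟩
  refine Runs.block_cons (M.runs_simCell (m := w.length) (p := w.length + 1) (a := 1) ?_ ?_ ?_
    (by omega) ?_) (by omega) fun σ₄ h₄ => ?_
  · simp [R₃.reg4]
  · simp; ring
  · simp
  · have : (w.length + 1) * M.numStates = w.length * M.numStates + M.numStates := by ring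
    omega
  have R₄ : M.SimRegs w σ₄ := ((R₃.setReg (by omega) _).setReg (by omega) _).of_frame h₄.2.1 h₄.2.2
  have h5 : σ₄.reg 5 = w.length * M.numStates + M.numStates := by
    rw [h₄.2.1 _ (by omega)]; simp
  set F := (List.finRange M.numStates).filter (· ∈ M.final) with hF
  have hFl : (F.flatMap M.acceptEntries).length ≤ 7 * M.numStates := by
    have h1 : F.length ≤ M.numStates := by
      simpa using List.length_filter_le (· ∈ M.final) (List.finRange M.numStates)
    have h2 : (F.flatMap M.acceptEntries).length = 7 * F.length := by
      simp [List.length_flatMap, acceptEntries, mul_comm]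
    omega
  refine Runs.block_cons (Runs.emitAll ?_ ?_) (by omega) fun σ₅ h₅ => ?_
  · intro x hx
    obtain ⟨q, -, hq⟩ := List.mem_flatMap.1 hx
    simp only [acceptEntries, List.mem_cons, List.not_mem_nil, or_false] at hq
    rcases hq with rfl | rfl | rfl | rfl | rfl | rfl | rfl <;> simp
  · intro x hx
    obtain ⟨q, -, hq⟩ := List.mem_flatMap.1 hx
    have := q.isLt
    have := M.bottom.isLt
    simp only [acceptEntries, List.mem_cons, List.not_mem_nil, or_false] at hq
    rcases hq with rfl | rfl | rfl | rfl | rfl | rfl | rfl <;> simp [R₄.reg4, h5] <;> omega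
  rw [Runs.block_nil_iff]
  refine ⟨by omega, ?_⟩
  have hg : (M.tape w).getD (w.length + 1) .leftEnd = .rightEnd := by simp [tape]
  have hc : M.cellOutput w (w.length + 1) = ((M.trans.filter fun τ => τ.read.code = 1).map
      (M.simTransition w.length (w.length + 1))).flatMap encodeTransition := by
    rw [cellOutput, hg]; rfl
  have ha : (F.flatMap M.acceptEntries).map (fun x => σ₄.reg x.1 + x.2) =
      (F.map (M.simAccept w.length)).flatMap encodeTransition := by
    rw [List.map_flatMap, List.flatMap_map]
    refine List.flatMap_congr fun q _ => ?_
    simp only [acceptEntries, encodeTransition, simAccept,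
      M.simState_val (show w.length + 2 < w.length + 4 by omega)]
    simp [R₄.reg4, h5, TapeSymbol.code, HeadMove.code]
    ring
  rw [h₅.1, h₄.1, ha, ← hc]
  simp only [RamState.setReg_out, o₃, o₁]
  rw [List.range_succ (n := w.length + 1), List.flatMap_append, List.flatMap_singleton]
  simp only [List.append_assoc]

end TwoNPDA

/-- Since `M` is fixed, its weight is a constant, and constantly many steps for each letter suffice.
The largest word is linear in `n`, so the constant exponent `4 * M.weight + 2` covers it. -/
theorem linearTimeReduces_recognition_emptiness (M : TwoNPDA) :
    LinearTimeReduces (recognitionProblem M) pdaEmptiness.compl := by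
  refine ⟨M.simPDA, ⟨M.simProgram, 4 * M.weight + 2, 300 * (M.weight + 1),
    fun (w : List (Fin M.numLetters)) => ?_⟩,
    fun w => (M.simPDA_language_ne_zero w).symm⟩
  set n := (recognitionProblem M).size w
  have hn : w.length ≤ n := by
    have h : (w.map Fin.val).length ≤ n := length_le_bitLength (w.map Fin.val)
    simpa using h
  have hwt := M.weight_eq
  have hW : (w.length + 4) * M.numStates + M.weight < (n + 2) ^ (4 * M.weight + 2) := by
    have h1 := mul_pow_le_pow_add (4 * M.weight) n 1
    have h2 : (n + 2) ^ (1 + 4 * M.weight) < (n + 2) ^ (4 * M.weight + 2) :=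
      Nat.pow_lt_pow_right (by omega) (by omega)
    have h3 : (w.length + 4) * M.numStates ≤ (n + 4) * M.weight :=
      Nat.mul_le_mul (by omega) (by omega)
    have h4 : (n + 4) * M.weight + M.weight ≤ 4 * M.weight * (n + 2) ^ 1 := by
      rw [pow_one]; nlinarith
    omega
  obtain ⟨t, h, ht⟩ := (M.runs_simProgram w hW).computes
  refine ⟨t, h, ht.trans ?_⟩
  have : w.length * M.weight ≤ n * M.weight := Nat.mul_le_mul_right _ hn
  calc 300 * (w.length * M.weight + w.length + M.weight + 1)
      ≤ 300 * (n * M.weight + n + M.weight + 1) := by omega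
    _ = _ := by ring

/-! ## Dyck words and stacks -/

namespace Paren

def opening : Bool → Paren
  | false => roundOpen
  | true => squareOpen

def closing : Bool → Paren
  | false => roundClose
  | true => squareClose

/-- The effect of a parenthesis on the stack of the parentheses that are still open. -/
def act : Paren → List Bool → Option (List Bool)
  | roundOpen, s => some (false :: s)
  | squareOpen, s => some (true :: s)
  | roundClose, false :: s => some s
  | squareClose, true :: s => some s
  | _, _ => none

theorem act_opening (b : Bool) (s : List Bool) : (opening b).act s = some (b :: s) := by
  cases b <;> rfl

theorem act_closing (b : Bool) (s : List Bool) : (closing b).act (b :: s) = some s := by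
  cases b <;> rfl

theorem eq_opening_or_closing (p : Paren) : (∃ b, p = opening b) ∨ ∃ b, p = closing b := by
  cases p
  exacts [.inl ⟨false, rfl⟩, .inr ⟨false, rfl⟩, .inl ⟨true, rfl⟩, .inr ⟨true, rfl⟩]

theorem act_closing_eq_some {b : Bool} {s s' : List Bool} (h : (closing b).act s = some s') :
    s = b :: s' := by
  rcases s with _ | ⟨_ | _, s⟩ <;> cases b <;> simp_all [closing, act]

end Paren

/-- The effect of a sequence of parentheses on a stack. -/
def parenRun : List Paren → List Bool → Option (List Bool)
  | [], s => some s
  | p :: w, s => (p.act s).bind (parenRun w)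

@[simp] theorem parenRun_nil (s : List Bool) : parenRun [] s = some s := rfl

theorem parenRun_cons (p : Paren) (w : List Paren) (s : List Bool) :
    parenRun (p :: w) s = (p.act s).bind (parenRun w) := rfl

theorem parenRun_append (u v : List Paren) (s : List Bool) :
    parenRun (u ++ v) s = (parenRun u s).bind (parenRun v) := by
  induction u generalizing s with
  | nil => rfl
  | cons p u ih =>
    simp only [List.cons_append, parenRun_cons, Option.bind_assoc]
    congr 1; funext s; exact ih s

theorem parenRun_opening (l s : List Bool) :
    parenRun (l.map Paren.opening) s = some (l.reverse ++ s) := by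
  induction l generalizing s with
  | nil => rfl
  | cons b l ih => simp [parenRun_cons, Paren.act_opening, ih]

/-- A word of closing parentheses tests the top of the stack against `l` and removes it; the binary
pops rest on this. -/
theorem parenRun_closing_eq_some {l s s' : List Bool} :
    parenRun (l.map Paren.closing) s = some s' ↔ s = l ++ s' := by
  induction l generalizing s with
  | nil => simp
  | cons b l ih =>
    simp only [List.map_cons, parenRun_cons, Option.bind_eq_some_iff, List.cons_append, ih]
    constructor
    · rintro ⟨s₁, h, rfl⟩; exact Paren.act_closing_eq_some h
    · rintro rfl; exact ⟨_, Paren.act_closing _ _, rfl⟩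

theorem Dyck2.parenRun {w : List Paren} (h : Dyck2 w) (s : List Bool) :
    parenRun w s = some s := by
  induction h generalizing s with
  | nil => rfl
  | append _ _ h₁ h₂ => simp [parenRun_append, h₁, h₂]
  | round _ h => simp [parenRun_cons, parenRun_append, Paren.act, h]
  | square _ h => simp [parenRun_cons, parenRun_append, Paren.act, h]

/-- The word closes the parentheses on the stack, with Dyck words in between. -/
def Closes : List Bool → List Paren → Prop
  | [], w => Dyck2 w
  | b :: s, w => ∃ u v, w = u ++ Paren.closing b :: v ∧ Dyck2 u ∧ Closes s v

theorem Closes.dyck_append {s : List Bool} {u w : List Paren} (hu : Dyck2 u) (h : Closes s w) :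
    Closes s (u ++ w) := by
  cases s with
  | nil => exact hu.append h
  | cons b s =>
    obtain ⟨u', v, rfl, h₁, h₂⟩ := h
    exact ⟨u ++ u', v, by simp, hu.append h₁, h₂⟩

/-- An arbitrary initial stack makes the induction on the word work. After an opening parenthesis
the induction hypothesis exhibits the matching closing one; the enclosed factor is a Dyck word and
merges with the Dyck word that follows it. -/
theorem closes_of_parenRun {w : List Paren} {s : List Bool} (h : parenRun w s = some []) :
    Closes s w := by
  induction w generalizing s with
  | nil =>
    obtain rfl : s = [] := by simpa using h
    exact .nil
  | cons p w ih =>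
    rw [parenRun_cons, Option.bind_eq_some_iff] at h
    obtain ⟨s', h₁, h₂⟩ := h
    rcases p.eq_opening_or_closing with ⟨b, rfl⟩ | ⟨b, rfl⟩
    · rw [Paren.act_opening, Option.some_inj] at h₁
      subst h₁
      obtain ⟨u, v, rfl, h₁, h₂⟩ := ih h₂
      have : Dyck2 (Paren.opening b :: (u ++ [Paren.closing b])) := by
        cases b
        exacts [.round h₁, .square h₁]
      simpa using h₂.dyck_append this
    · rw [Paren.act_closing_eq_some h₁]
      exact ⟨[], w, rfl, .nil, ih h₂⟩

theorem dyck2_iff_parenRun {w : List Paren} : Dyck2 w ↔ parenRun w [] = some [] :=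
  ⟨fun h => h.parenRun [], closes_of_parenRun⟩

/-! ## Binary codes -/

/-- The `L` lowest bits of a number, the lowest first. -/
def bitsOf : ℕ → ℕ → List Bool
  | 0, _ => []
  | L + 1, x => decide (x % 2 = 1) :: bitsOf L (x / 2)

@[simp] theorem length_bitsOf (L x : ℕ) : (bitsOf L x).length = L := by
  induction L generalizing x with
  | zero => rfl
  | succ L ih => simp [bitsOf, ih]

theorem bitsOf_inj {L x y : ℕ} (hx : x < 2 ^ L) (hy : y < 2 ^ L) (h : bitsOf L x = bitsOf L y) :
    x = y := by
  induction L generalizing x y with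
  | zero => simp at hx hy; omega
  | succ L ih =>
    simp only [bitsOf, List.cons.injEq, decide_eq_decide] at h
    rw [pow_succ] at hx hy
    have := ih (by omega) (by omega) h.2
    omega

/-- The definition splits off the lowest bit, as suits pops. Pushes produce the highest bit first,
so that the lowest ends on top, and need the splitting at the other end. -/
theorem bitsOf_succ' (L x : ℕ) :
    bitsOf (L + 1) x = bitsOf L (x % 2 ^ L) ++ [decide (x / 2 ^ L % 2 = 1)] := by
  induction L generalizing x with
  | zero => simp [bitsOf]
  | succ L ih =>
    rw [bitsOf, ih, bitsOf]
    have h1 : x % 2 ^ (L + 1) % 2 = x % 2 := Nat.mod_mod_of_dvd _ ⟨2 ^ L, by ring⟩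
    have h2 : x % 2 ^ (L + 1) / 2 = x / 2 % 2 ^ L := by
      rw [pow_succ', Nat.mod_mul_right_div_self]
    have h3 : x / 2 / 2 ^ L = x / 2 ^ (L + 1) := by rw [Nat.div_div_eq_div_mul, pow_succ']
    rw [h1, h2, h3]; rfl

/-! ## A two-way automaton for Dyck-2 reachability -/

namespace Recognizer

def bitLetter (b : Bool) : Fin 7 := if b then 1 else 0

def labelLetter : Paren → Fin 7
  | .roundOpen => 2
  | .roundClose => 3
  | .squareOpen => 4
  | .squareClose => 5

abbrev bitSymbol (b : Bool) : TapeSymbol 7 := .letter (bitLetter b)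

abbrev separator : TapeSymbol 7 := .letter 6

def bitStack (b : Bool) : Fin 5 := if b then 2 else 1

def parenStack (b : Bool) : Fin 5 := if b then 4 else 3

/-- The symbols that end the record of a source vertex: labels and the right endmarker. -/
inductive IsMarker : TapeSymbol 7 → Prop
  | rightEnd : IsMarker .rightEnd
  | label (p : Paren) : IsMarker (.letter (labelLetter p))

/-- The transitions. In state `0` the bits of the current vertex are pushed while moving right, in
state `1` the head moves to a marker, in state `2` the bits before the marker are compared with those
on the stack, and in state `3` the head returns to the marker. -/
inductive Trans : PDATransition 4 7 5 → Prop
  | start : Trans ⟨0, .leftEnd, 0, 0, [0], .right⟩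
  | push (b Z) : Trans ⟨0, bitSymbol b, Z, 0, [bitStack b, Z], .right⟩
  | pushed (Z) : Trans ⟨0, separator, Z, 1, [Z], .stay⟩
  | seekLeft (a Z) : Trans ⟨1, a, Z, 1, [Z], .left⟩
  | seekRight (a Z) : Trans ⟨1, a, Z, 1, [Z], .right⟩
  | found (a Z) : IsMarker a → Trans ⟨1, a, Z, 2, [Z], .left⟩
  | compare (b) : Trans ⟨2, bitSymbol b, bitStack b, 2, [], .left⟩
  -- The bits on the tape are exhausted at the separator; that no bit is left on top of the stack
  -- shows the two numbers to be equal.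
  | compared (Z) : (∀ b, Z ≠ bitStack b) → Trans ⟨2, separator, Z, 3, [Z], .right⟩
  | back (b Z) : Trans ⟨3, bitSymbol b, Z, 3, [Z], .right⟩
  | opening (b Z) : Trans ⟨3, .letter (labelLetter (.opening b)), Z, 0, [parenStack b, Z], .right⟩
  | closing (b) : Trans ⟨3, .letter (labelLetter (.closing b)), parenStack b, 0, [], .right⟩

def symbols : List (TapeSymbol 7) := .leftEnd :: .rightEnd :: (List.finRange 7).map .letter

theorem mem_symbols (a : TapeSymbol 7) : a ∈ symbols := by
  cases a <;> simp [symbols]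

def markers : List (TapeSymbol 7) :=
  .rightEnd :: [Paren.roundOpen, .roundClose, .squareOpen, .squareClose].map
    fun p => .letter (labelLetter p)

theorem mem_markers {a : TapeSymbol 7} : a ∈ markers ↔ IsMarker a := by
  constructor
  · intro h
    simp only [markers, List.map_cons, List.map_nil, List.mem_cons, List.not_mem_nil, or_false] at h
    rcases h with rfl | rfl | rfl | rfl | rfl
    exacts [.rightEnd, .label _, .label _, .label _, .label _]
  · rintro (_ | p)
    · simp [markers]
    · cases p <;> simp [markers]

/-- The automaton needs a list, whereas the proofs argue by cases on `Trans`; the two are identified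
in `mem_transitions`. -/
def transitions : List (PDATransition 4 7 5) :=
  [⟨0, .leftEnd, 0, 0, [0], .right⟩] ++
  (List.finRange 5).flatMap (fun Z =>
    [⟨0, separator, Z, 1, [Z], .stay⟩] ++
    symbols.flatMap (fun a => [⟨1, a, Z, 1, [Z], .left⟩, ⟨1, a, Z, 1, [Z], .right⟩]) ++
    markers.map (fun a => ⟨1, a, Z, 2, [Z], .left⟩) ++
    [false, true].flatMap (fun b => [⟨0, bitSymbol b, Z, 0, [bitStack b, Z], .right⟩,
      ⟨3, bitSymbol b, Z, 3, [Z], .right⟩,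
      ⟨3, .letter (labelLetter (.opening b)), Z, 0, [parenStack b, Z], .right⟩])) ++
  -- The bottom and the two parentheses are the stack symbols that are not bits.
  [0, 3, 4].map (fun Z => ⟨2, separator, Z, 3, [Z], .right⟩) ++
  [false, true].flatMap (fun b => [⟨2, bitSymbol b, bitStack b, 2, [], .left⟩,
    ⟨3, .letter (labelLetter (.closing b)), parenStack b, 0, [], .right⟩])

theorem mem_transitions {τ : PDATransition 4 7 5} : τ ∈ transitions ↔ Trans τ := by
  constructor
  · intro h
    simp only [transitions, List.mem_append, List.mem_flatMap, List.mem_map, List.mem_cons,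
      List.not_mem_nil, or_false, List.mem_finRange, true_and] at h
    rcases h with ((rfl | ⟨Z, ((rfl | ⟨a, -, rfl | rfl⟩) | ⟨a, ha, rfl⟩) |
      ⟨b, -, rfl | rfl | rfl⟩⟩) | ⟨Z, hZ, rfl⟩) | ⟨b, -, rfl | rfl⟩
    · exact .start
    · exact .pushed _
    · exact .seekLeft _ _
    · exact .seekRight _ _
    · exact .found _ _ (mem_markers.1 ha)
    · exact .push _ _
    · exact .back _ _
    · exact .opening _ _
    · refine .compared _ fun b => ?_
      rcases hZ with rfl | rfl | rfl <;> cases b <;> decide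
    · exact .compare _
    · exact .closing _
  · intro h
    simp only [transitions, List.mem_append, List.mem_flatMap, List.mem_map, List.mem_cons,
      List.not_mem_nil, or_false, List.mem_finRange, true_and]
    cases h with
    | start => exact .inl (.inl (.inl rfl))
    | push b Z => exact .inl (.inl (.inr ⟨Z, .inr ⟨b, by cases b <;> simp, .inl rfl⟩⟩))
    | pushed Z => exact .inl (.inl (.inr ⟨Z, .inl (.inl (.inl rfl))⟩))
    | seekLeft a Z => exact .inl (.inl (.inr ⟨Z, .inl (.inl (.inr ⟨a, mem_symbols a, .inl rfl⟩))⟩))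
    | seekRight a Z => exact .inl (.inl (.inr ⟨Z, .inl (.inl (.inr ⟨a, mem_symbols a, .inr rfl⟩))⟩))
    | found a Z h => exact .inl (.inl (.inr ⟨Z, .inl (.inr ⟨a, mem_markers.2 h, rfl⟩)⟩))
    | compare b => exact .inr ⟨b, by cases b <;> simp, .inl rfl⟩
    | compared Z h =>
      refine .inl (.inr ⟨Z, ?_, rfl⟩)
      have h1 := h false
      have h2 := h true
      revert h1 h2
      fin_cases Z <;> decide
    | back b Z => exact .inl (.inl (.inr ⟨Z, .inr ⟨b, by cases b <;> simp, .inr (.inl rfl)⟩⟩))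
    | opening b Z => exact .inl (.inl (.inr ⟨Z, .inr ⟨b, by cases b <;> simp, .inr (.inr rfl)⟩⟩))
    | closing b => exact .inr ⟨b, by cases b <;> simp, .inr rfl⟩

def automaton : TwoNPDA where
  numStates := 4
  numLetters := 7
  numStack := 5
  start := 0
  bottom := 0
  -- In state `3` on the right endmarker the current vertex has just been found equal to the target,
  -- whose bits precede that endmarker.
  final := {3}
  trans := transitions
  bottom_kept := by
    intro τ hτ
    rcases mem_transitions.1 hτ <;> intro h <;> (try simp only at h) <;> try subst h
    · exact ⟨[], by simp, rfl⟩
    · rename_i b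
      exact ⟨[bitStack b], by cases b <;> decide, rfl⟩
    · exact ⟨[], by simp, rfl⟩
    · exact ⟨[], by simp, rfl⟩
    · exact ⟨[], by simp, rfl⟩
    · exact ⟨[], by simp, rfl⟩
    · rename_i b; cases b <;> exact absurd h (by decide)
    · exact ⟨[], by simp, rfl⟩
    · exact ⟨[], by simp, rfl⟩
    · rename_i b
      exact ⟨[parenStack b], by cases b <;> decide, rfl⟩
    · rename_i b; cases b <;> exact absurd h (by decide)
  bottom_not_pushed := by
    intro τ hτ
    rcases mem_transitions.1 hτ <;> intro h <;> simp at h ⊢ <;> try exact Ne.symm h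
    · rename_i b Z
      exact ⟨by cases b <;> decide, Ne.symm h⟩
    · rename_i b Z
      exact ⟨by cases b <;> decide, Ne.symm h⟩

/-- Configurations of the automaton. -/
structure Conf where
  state : Fin 4
  pos : ℕ
  stack : List (Fin 5)

abbrev conf (q : Fin 4) (p : ℕ) (s : List (Fin 5)) : Conf := ⟨q, p, s⟩

/-- One move, on a tape with the given contents. -/
def Move (t : List (TapeSymbol 7)) (c c' : Conf) : Prop :=
  ∃ τ, Trans τ ∧ ∃ γ : List (Fin 5), c.state = τ.src ∧ t[c.pos]? = some τ.read ∧
    c.stack = τ.top :: γ ∧ c'.state = τ.dst ∧ c'.stack = τ.push ++ γ ∧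
    (c'.pos : ℤ) = (c.pos : ℤ) + τ.move.toInt ∧ c'.pos < t.length

theorem step_iff_move {w : List (Fin 7)} {c c' : automaton.Config} :
    automaton.Step w c c' ↔ Move (automaton.tape w) ⟨c.state, c.pos, c.stack⟩
      ⟨c'.state, c'.pos, c'.stack⟩ := by
  refine exists_congr fun τ => and_congr_left fun _ => mem_transitions

theorem accepts_iff {w : List (Fin 7)} : automaton.Accepts w ↔
    Relation.ReflTransGen (Move (automaton.tape w)) (conf 0 0 [0])
      (conf 3 ((automaton.tape w).length - 1) [0]) := by
  have hl : (automaton.tape w).length - 1 = w.length + 1 :=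
    congrArg (· - 1) (TwoNPDA.tape_length (M := automaton) w)
  rw [hl]
  constructor
  · rintro ⟨q, hq, h⟩
    obtain rfl : q = (3 : Fin 4) := Finset.mem_singleton.1 hq
    exact h.lift (fun c : automaton.Config => (⟨c.state, c.pos, c.stack⟩ : Conf))
      fun _ _ => step_iff_move.1
  · intro h
    exact ⟨(3 : Fin 4), Finset.mem_singleton_self (3 : Fin 4),
      h.lift (fun c : Conf => (⟨c.state, c.pos, c.stack⟩ : automaton.Config)) fun _ _ => step_iff_move.2⟩

end Recognizer

/-! ### Every Dyck walk is followed by a run of the automaton -/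

namespace Recognizer

open Relation

theorem move_of {t a r : List (TapeSymbol 7)} {x : TapeSymbol 7} {q q' : Fin 4} {Z : Fin 5}
    {push γ : List (Fin 5)} {d : HeadMove} {p' : ℕ} (ht : t = a ++ x :: r)
    (hτ : Trans ⟨q, x, Z, q', push, d⟩) (hp : (p' : ℤ) = (a.length : ℤ) + d.toInt)
    (hlt : p' < t.length) : Move t (conf q a.length (Z :: γ)) (conf q' p' (push ++ γ)) :=
  ⟨_, hτ, γ, rfl, by simp [ht], rfl, rfl, rfl, hp, hlt⟩

theorem reach_push {t a r : List (TapeSymbol 7)} {x : TapeSymbol 7} {l : List Bool}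
    {s : List (Fin 5)} (ht : t = a ++ l.map bitSymbol ++ x :: r) (hs : s ≠ []) :
    ReflTransGen (Move t) (conf 0 a.length s)
      (conf 0 (a.length + l.length) (l.reverse.map bitStack ++ s)) := by
  induction l generalizing a s with
  | nil => exact .refl
  | cons b l ih =>
    obtain ⟨Z, γ, rfl⟩ := List.exists_cons_of_ne_nil hs
    refine .head (move_of (p' := a.length + 1) (by simpa using ht) (.push b Z)
      (by simp [HeadMove.toInt]) (by simp [ht])) ?_
    have := ih (a := a ++ [bitSymbol b]) (s := [bitStack b, Z] ++ γ) (by simpa using ht) (by simp)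
    simpa [add_assoc, add_comm] using this

theorem reach_back {t a r : List (TapeSymbol 7)} {x : TapeSymbol 7} {l : List Bool}
    {s : List (Fin 5)} (ht : t = a ++ l.map bitSymbol ++ x :: r) (hs : s ≠ []) :
    ReflTransGen (Move t) (conf 3 a.length s) (conf 3 (a.length + l.length) s) := by
  obtain ⟨Z, γ, rfl⟩ := List.exists_cons_of_ne_nil hs
  induction l generalizing a with
  | nil => exact .refl
  | cons b l ih =>
    refine .head (move_of (p' := a.length + 1) (by simpa using ht) (.back b Z)
      (by simp [HeadMove.toInt]) (by simp [ht])) ?_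
    have := ih (a := a ++ [bitSymbol b]) (by simpa using ht)
    simpa [add_assoc, add_comm] using this

/-- The bit pushed last is on top and is met first by a head moving left, so the induction takes
bits off the end of the list. -/
theorem reach_compare {t a r : List (TapeSymbol 7)} {y : TapeSymbol 7} {l : List Bool}
    {s : List (Fin 5)} (ht : t = a ++ y :: (l.map bitSymbol ++ r)) :
    ReflTransGen (Move t) (conf 2 (a.length + l.length) (l.reverse.map bitStack ++ s))
      (conf 2 a.length s) := by
  induction l using List.reverseRecOn generalizing r with
  | nil => exact .refl
  | append_singleton l b ih =>
    have h := ih (r := bitSymbol b :: r) (by simpa using ht)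
    have ht' : t = (a ++ y :: l.map bitSymbol) ++ bitSymbol b :: r := by simpa using ht
    have := move_of (p' := a.length + l.length) (γ := l.reverse.map bitStack ++ s) ht' (.compare b)
      (by simp [HeadMove.toInt]; ring) (by simp [ht])
    refine .head ?_ h
    simpa using this

theorem reach_seek {t : List (TapeSymbol 7)} {s : List (Fin 5)} (hs : s ≠ []) {p p' : ℕ}
    (hp : p < t.length) (hp' : p' < t.length) :
    ReflTransGen (Move t) (conf 1 p s) (conf 1 p' s) := by
  obtain ⟨Z, γ, rfl⟩ := List.exists_cons_of_ne_nil hs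
  have hm : ∀ i, i + 1 < t.length → Move t (conf 1 i (Z :: γ)) (conf 1 (i + 1) (Z :: γ)) ∧
      Move t (conf 1 (i + 1) (Z :: γ)) (conf 1 i (Z :: γ)) := fun i hi =>
    ⟨⟨_, .seekRight t[i] Z, γ, rfl, by simp, rfl, rfl, rfl, by simp [HeadMove.toInt], hi⟩,
      ⟨_, .seekLeft t[i + 1] Z, γ, rfl, by simp, rfl, rfl, rfl,
        by simp [HeadMove.toInt], by simp; omega⟩⟩
  have h : ∀ i, i < t.length → ReflTransGen (Move t) (conf 1 0 (Z :: γ)) (conf 1 i (Z :: γ)) ∧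
      ReflTransGen (Move t) (conf 1 i (Z :: γ)) (conf 1 0 (Z :: γ)) := by
    intro i hi
    induction i with
    | zero => exact ⟨.refl, .refl⟩
    | succ i ih =>
      obtain ⟨h₁, h₂⟩ := ih (by omega)
      exact ⟨h₁.tail (hm i hi).1, .head (hm i hi).2 h₂⟩
  exact (h p hp).2.trans (h p' hp').1

/-- With the head at the start of the bits of a vertex, the automaton can go to each marker that ends
a record of this vertex as a source. -/
theorem reach_marker {t a r a' r' : List (TapeSymbol 7)} {m : TapeSymbol 7} {l : List Bool}
    {Z : Fin 5} {γ : List (Fin 5)} (ht : t = a ++ l.map bitSymbol ++ separator :: r)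
    (ht' : t = a' ++ separator :: (l.map bitSymbol ++ m :: r')) (hm : IsMarker m)
    (hZ : ∀ b, Z ≠ bitStack b) :
    ReflTransGen (Move t) (conf 0 a.length (Z :: γ))
      (conf 3 (a'.length + 1 + l.length) (Z :: γ)) := by
  have hlen : t.length = a'.length + 1 + l.length + 1 + r'.length := by simp [ht']; ring
  have hlen' : t.length = a.length + l.length + 1 + r.length := by simp [ht]; ring
  have htm : t = (a' ++ separator :: l.map bitSymbol) ++ m :: r' := by simpa using ht'
  have htb : t = (a' ++ [separator]) ++ l.map bitSymbol ++ m :: r' := by simpa using ht'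
  -- The top may be a bit or, for an empty list of bits, `Z` itself; the moves that seek a marker
  -- keep it in either case.
  obtain ⟨Y, δ, hs⟩ : ∃ Y δ, l.reverse.map bitStack ++ Z :: γ = Y :: δ :=
    List.exists_cons_of_ne_nil (by simp)
  refine (reach_push ht (by simp)).trans ?_
  rw [hs]
  have h₁ := move_of (p' := a.length + l.length) (γ := δ) ht (.pushed Y)
    (by simp [HeadMove.toInt]) (by omega)
  have h₂ := move_of (p' := a'.length + l.length) (γ := δ) htm (.found m Y hm)
    (by simp [HeadMove.toInt]; ring) (by omega)
  have h₃ := move_of (p' := a'.length + 1) (γ := γ) ht' (.compared Z hZ)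
    (by simp [HeadMove.toInt]) (by omega)
  have h₄ := reach_back htb (List.cons_ne_nil Z γ)
  have h₅ := reach_compare (s := Z :: γ) ht'
  rw [hs] at h₅
  refine .head (by simpa using h₁) ?_
  refine (reach_seek (by simp) (p' := a'.length + (l.length + 1)) (by omega) (by omega)).trans ?_
  refine .head (by simpa using h₂) (h₅.trans (.head h₃ ?_))
  simpa using h₄

/-- The stack of open parentheses, as a stack of the automaton. -/
def stackOf (s : List Bool) : List (Fin 5) := s.map parenStack ++ [0]

theorem stackOf_eq_cons (s : List Bool) : ∃ Z γ, stackOf s = Z :: γ ∧ ∀ b, Z ≠ bitStack b := by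
  rcases s with _ | ⟨c, s⟩
  · exact ⟨0, [], rfl, by decide⟩
  · exact ⟨parenStack c, stackOf s, rfl, by revert c; decide⟩

theorem bitStack_injective : bitStack.Injective := by decide

theorem parenStack_injective : parenStack.Injective := by decide

section Instance

variable (G : Dyck2Instance) (bits : Fin G.numVertices → List Bool)

def recordOf (e : LabelledEdge G.numVertices) : List (TapeSymbol 7) :=
  separator :: ((bits e.src).map bitSymbol ++
    .letter (labelLetter e.label) :: (bits e.tgt).map bitSymbol)

/-- The tape contents from the first separator on, for a part of the edges. -/
def tapeEnd (es : List (LabelledEdge G.numVertices)) : List (TapeSymbol 7) :=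
  es.flatMap (recordOf G bits) ++ separator :: ((bits G.target).map bitSymbol ++ [.rightEnd])

def tapeOf : List (TapeSymbol 7) :=
  .leftEnd :: ((bits G.source).map bitSymbol ++ tapeEnd G bits G.edges)

theorem tapeEnd_eq_cons (es : List (LabelledEdge G.numVertices)) :
    ∃ r, tapeEnd G bits es = separator :: r := by
  cases es with
  | nil => exact ⟨_, rfl⟩
  | cons e es => exact ⟨_, rfl⟩

theorem tapeEnd_cons (e : LabelledEdge G.numVertices) (es : List (LabelledEdge G.numVertices)) :
    tapeEnd G bits (e :: es) = separator :: ((bits e.src).map bitSymbol ++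
      .letter (labelLetter e.label) :: ((bits e.tgt).map bitSymbol ++ tapeEnd G bits es)) := by
  simp [tapeEnd, recordOf]

theorem tapeOf_edge {e : LabelledEdge G.numVertices} (he : e ∈ G.edges) :
    ∃ a r, tapeOf G bits = a ++ separator :: ((bits e.src).map bitSymbol ++
      .letter (labelLetter e.label) :: ((bits e.tgt).map bitSymbol ++ separator :: r)) := by
  obtain ⟨es, es', hes⟩ := List.append_of_mem he
  obtain ⟨r, hr⟩ := tapeEnd_eq_cons G bits es'
  refine ⟨.leftEnd :: ((bits G.source).map bitSymbol ++ es.flatMap (recordOf G bits)), r, ?_⟩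
  have : tapeEnd G bits G.edges = es.flatMap (recordOf G bits) ++ tapeEnd G bits (e :: es') := by
    simp [tapeEnd, hes]
  rw [tapeOf, this, tapeEnd_cons, hr]
  simp

theorem tapeOf_target : ∃ a, tapeOf G bits =
    a ++ separator :: ((bits G.target).map bitSymbol ++ [.rightEnd]) :=
  ⟨.leftEnd :: ((bits G.source).map bitSymbol ++ G.edges.flatMap (recordOf G bits)), by
    simp [tapeOf, tapeEnd]⟩

/-- Induction on the walk, the head standing at some copy of the bits of the current vertex that is
followed by a separator. Which copy does not matter: it is the source at the left end, or the target
in the record of the edge just taken. -/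
theorem reach_of_walk {π : List (LabelledEdge G.numVertices)} {u : Fin G.numVertices}
    {s s' : List Bool} {a r : List (TapeSymbol 7)} (hπ : G.IsWalk u π G.target)
    (hs : parenRun (π.map LabelledEdge.label) s = some s')
    (ht : tapeOf G bits = a ++ (bits u).map bitSymbol ++ separator :: r) :
    ReflTransGen (Move (tapeOf G bits)) (conf 0 a.length (stackOf s))
      (conf 3 ((tapeOf G bits).length - 1) (stackOf s')) := by
  induction π generalizing u s a r with
  | nil =>
    obtain rfl : u = G.target := hπ
    obtain rfl : s = s' := by simpa using hs
    obtain ⟨a', ht'⟩ := tapeOf_target G bits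
    obtain ⟨Z, γ, hZ, hb⟩ := stackOf_eq_cons s
    rw [hZ]
    have hl : (tapeOf G bits).length - 1 = a'.length + 1 + (bits G.target).length := by
      simp [ht']; ring
    rw [hl]
    exact reach_marker ht ht' .rightEnd hb
  | cons e π ih =>
    obtain ⟨he, rfl, hπ⟩ := hπ
    rw [List.map_cons, parenRun_cons, Option.bind_eq_some_iff] at hs
    obtain ⟨s₁, h₁, hs⟩ := hs
    obtain ⟨a', r', ht'⟩ := tapeOf_edge G bits he
    obtain ⟨Z, γ, hZ, hb⟩ := stackOf_eq_cons s
    have hm := reach_marker (γ := γ) ht ht' (.label e.label) hb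
    rw [hZ]
    refine hm.trans ?_
    have ht₁ : tapeOf G bits = (a' ++ separator :: (bits e.src).map bitSymbol) ++
      .letter (labelLetter e.label) :: ((bits e.tgt).map bitSymbol ++ separator :: r') := by
      simpa using ht'
    have ht₂ : tapeOf G bits = (a' ++ separator :: ((bits e.src).map bitSymbol ++
      [.letter (labelLetter e.label)])) ++ (bits e.tgt).map bitSymbol ++ separator :: r' := by
      simpa using ht'
    refine .head ?_ (ih hπ hs ht₂)
    have hlt : a'.length + 1 + (bits e.src).length + 1 < (tapeOf G bits).length := by
      simp [ht']; omega
    rcases e.label.eq_opening_or_closing with ⟨b, hlab⟩ | ⟨b, hlab⟩ <;> rw [hlab] at h₁ ht₁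
    · rw [Paren.act_opening, Option.some_inj] at h₁
      have := move_of (γ := γ) ht₁ (.opening b Z) (p' := a'.length + 1 + (bits e.src).length + 1)
        (by simp [HeadMove.toInt]; ring) hlt
      convert this using 1
      · simp; ring_nf
      · subst h₁
        have : stackOf (b :: s) = parenStack b :: stackOf s := rfl
        rw [this, hZ]
        simp; ring_nf
    · have h₂ := Paren.act_closing_eq_some h₁
      subst h₂
      have h₃ : stackOf (b :: s₁) = parenStack b :: stackOf s₁ := rfl
      rw [h₃] at hZ
      obtain ⟨rfl, rfl⟩ := List.cons.inj hZ
      have := move_of (γ := stackOf s₁) ht₁ (.closing b)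
        (p' := a'.length + 1 + (bits e.src).length + 1) (by simp [HeadMove.toInt]; ring) hlt
      convert this using 1
      · simp; ring_nf
      · simp; ring_nf

end Instance

end Recognizer

/-! ### Every accepting run follows a Dyck walk -/

namespace Recognizer

open Relation

/-- The displayed `c` on the left is the first one in the list, so the one on the right is either
this one or a later one. -/
theorem append_cons_eq_append_cons {α : Type*} {c : α} {x y l z : List α} (hx : c ∉ x)
    (h : x ++ c :: y = l ++ c :: z) :
    (l = x ∧ y = z) ∨ ∃ l', l = x ++ c :: l' ∧ y = l' ++ c :: z := by
  induction x generalizing l with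
  | nil =>
    cases l with
    | nil => exact .inl ⟨rfl, by simpa using h⟩
    | cons b l =>
      simp only [List.nil_append, List.cons_append, List.cons.injEq] at h
      obtain ⟨rfl, h⟩ := h
      exact .inr ⟨l, rfl, h⟩
  | cons b x ih =>
    cases l with
    | nil =>
      obtain ⟨rfl, -⟩ := List.cons.inj h
      simp at hx
    | cons b' l =>
      simp only [List.cons_append, List.cons.injEq] at h
      obtain ⟨rfl, h⟩ := h
      rcases ih (fun h => hx (List.mem_cons_of_mem _ h)) h with ⟨rfl, h'⟩ | ⟨l', rfl, h'⟩
      · exact .inl ⟨rfl, h'⟩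
      · exact .inr ⟨l', rfl, h'⟩

theorem bitSymbol_injective : bitSymbol.Injective := by
  intro a b h
  cases a <;> cases b <;> simp_all [bitLetter]

theorem label_injective {p q : Paren}
    (h : (TapeSymbol.letter (labelLetter p)) = .letter (labelLetter q)) : p = q := by
  cases p <;> cases q <;> simp_all [labelLetter]

theorem separator_ne_bit (b : Bool) : separator ≠ bitSymbol b := by
  cases b <;> simp [separator, bitSymbol, bitLetter]

theorem separator_notMem_bits (l : List Bool) : separator ∉ l.map bitSymbol := by
  simp only [List.mem_map, not_exists, not_and]
  exact fun b _ h => separator_ne_bit b h.symm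

theorem separator_ne_label (p : Paren) : separator ≠ .letter (labelLetter p) := by
  cases p <;> simp [separator, labelLetter]

theorem bit_ne_label (b : Bool) (p : Paren) : bitSymbol b ≠ .letter (labelLetter p) := by
  cases b <;> cases p <;> simp [bitLetter, labelLetter]

theorem IsMarker.ne_bit {m : TapeSymbol 7} (h : IsMarker m) (b : Bool) : m ≠ bitSymbol b := by
  cases h with
  | rightEnd => simp
  | label p => exact (bit_ne_label b p).symm

section Instance

variable {G : Dyck2Instance} {bits : Fin G.numVertices → List Bool}

/-- Unique readability of the tape: separators occur only at the beginning of records, and since all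
vertices have equally many bits, the `L` symbols after a separator are the source of its record. The
separator-free prefix `x` is what remains of the preceding record in the induction. -/
theorem tapeEnd_split {L : ℕ} (hlen : ∀ v, (bits v).length = L) (hinj : bits.Injective)
    {v : Fin G.numVertices} {m : TapeSymbol 7} {r : List (TapeSymbol 7)}
    (es : List (LabelledEdge G.numVertices)) : ∀ {x l : List (TapeSymbol 7)}, separator ∉ x →
    x ++ tapeEnd G bits es = l ++ separator :: ((bits v).map bitSymbol ++ m :: r) →
    (m = .rightEnd ∧ v = G.target) ∨ ∃ e ∈ es, e.src = v ∧ m = .letter (labelLetter e.label) ∧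
      ∃ r', r = (bits e.tgt).map bitSymbol ++ separator :: r' := by
  have hsplit : ∀ {u : Fin G.numVertices} {m' : TapeSymbol 7} {r' : List (TapeSymbol 7)},
      (bits u).map bitSymbol ++ m' :: r' = (bits v).map bitSymbol ++ m :: r →
        u = v ∧ m' = m ∧ r' = r := by
    intro u m' r' h
    obtain ⟨h₁, h₂⟩ := List.append_inj h (by simp [hlen])
    obtain ⟨rfl, rfl⟩ := List.cons.inj h₂
    exact ⟨hinj (List.map_injective_iff.2 bitSymbol_injective h₁), rfl, rfl⟩
  induction es with
  | nil =>
    intro x l hx h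
    rcases append_cons_eq_append_cons hx h with ⟨-, h⟩ | ⟨l', -, h⟩
    · obtain ⟨rfl, rfl, -⟩ := hsplit h
      exact .inl ⟨rfl, rfl⟩
    · have : separator ∈ (bits G.target).map bitSymbol ++ [.rightEnd] := by rw [h]; simp
      rcases List.mem_append.1 this with h | h
      · exact absurd h (separator_notMem_bits _)
      · simp at h
  | cons e es ih =>
    intro x l hx h
    rw [tapeEnd_cons] at h
    rcases append_cons_eq_append_cons hx h with ⟨-, h⟩ | ⟨l', -, h⟩
    · obtain ⟨rfl, rfl, rfl⟩ := hsplit h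
      obtain ⟨r', hr'⟩ := tapeEnd_eq_cons G bits es
      exact .inr ⟨e, by simp, rfl, rfl, r', by rw [hr']⟩
    · have hx' : separator ∉ (bits e.src).map bitSymbol ++ .letter (labelLetter e.label) ::
          (bits e.tgt).map bitSymbol := by
        intro hmem
        rcases List.mem_append.1 hmem with h | h
        · exact separator_notMem_bits _ h
        · rcases List.mem_cons.1 h with h | h
          · exact separator_ne_label _ h
          · exact separator_notMem_bits _ h
      rcases ih hx' (l := l') (by simpa using h) with h | ⟨e', he', h⟩
      · exact .inl h
      · exact .inr ⟨e', by simp [he'], h⟩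

theorem tapeOf_split {L : ℕ} (hlen : ∀ v, (bits v).length = L) (hinj : bits.Injective)
    {v : Fin G.numVertices} {m : TapeSymbol 7} {l r : List (TapeSymbol 7)}
    (h : tapeOf G bits = l ++ separator :: ((bits v).map bitSymbol ++ m :: r)) :
    (m = .rightEnd ∧ v = G.target) ∨ ∃ e ∈ G.edges, e.src = v ∧
      m = .letter (labelLetter e.label) ∧
      ∃ r', r = (bits e.tgt).map bitSymbol ++ separator :: r' := by
  refine tapeEnd_split hlen hinj G.edges (x := .leftEnd :: (bits G.source).map bitSymbol)
    (l := l) ?_ (by simpa [tapeOf] using h)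
  intro hmem
  rcases List.mem_cons.1 hmem with h | h
  · simp at h
  · exact separator_notMem_bits _ h

theorem isWalk_append {G : Dyck2Instance} {u v w : Fin G.numVertices}
    {π π' : List (LabelledEdge G.numVertices)} (h : G.IsWalk u π v) (h' : G.IsWalk v π' w) :
    G.IsWalk u (π ++ π') w := by
  induction π generalizing u with
  | nil => obtain rfl : u = v := h; exact h'
  | cons e π ih => exact ⟨h.1, h.2.1, ih h.2.2⟩

/-- Some walk from the source to `v` leaves the parentheses `s` open. -/
def Reached (G : Dyck2Instance) (v : Fin G.numVertices) (s : List Bool) : Prop :=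
  ∃ π, G.IsWalk G.source π v ∧ parenRun (π.map LabelledEdge.label) [] = some s

theorem Reached.edge {e : LabelledEdge G.numVertices} {s s' : List Bool}
    (h : Reached G e.src s) (he : e ∈ G.edges) (hs : e.label.act s = some s') :
    Reached G e.tgt s' := by
  obtain ⟨π, hπ, hr⟩ := h
  refine ⟨π ++ [e], isWalk_append hπ ⟨he, rfl, rfl⟩, ?_⟩
  rw [List.map_append, parenRun_append, hr]
  simp [parenRun_cons, hs]

/-- What the reachable configurations look like. -/
inductive Invariant (G : Dyck2Instance) (bits : Fin G.numVertices → List Bool) : Conf → Prop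
  | start : Invariant G bits (conf 0 0 [0])
  -- The bits `done` are already on the stack, the bits `rest` lie ahead of the head.
  | push {v s} (done rest : List Bool) (l r : List (TapeSymbol 7)) : Reached G v s →
      bits v = done ++ rest → tapeOf G bits = l ++ rest.map bitSymbol ++ separator :: r →
      Invariant G bits (conf 0 l.length (done.reverse.map bitStack ++ stackOf s))
  | seek {v s} (p : ℕ) : Reached G v s →
      Invariant G bits (conf 1 p ((bits v).reverse.map bitStack ++ stackOf s))
  -- The bits `done` have been matched with the tape, the bits `rest` are still on the stack; the
  -- head is on the last symbol of `l`.
  | compare {v s} (done rest : List Bool) (p : ℕ) (m : TapeSymbol 7) (l r : List (TapeSymbol 7)) :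
      Reached G v s → bits v = rest ++ done → IsMarker m →
      tapeOf G bits = l ++ (done.map bitSymbol ++ m :: r) → p + 1 = l.length →
      Invariant G bits (conf 2 p (rest.reverse.map bitStack ++ stackOf s))
  | back {v s} (done rest : List Bool) (m : TapeSymbol 7) (l r : List (TapeSymbol 7)) :
      Reached G v s → bits v = done ++ rest → IsMarker m →
      tapeOf G bits = l ++ separator :: ((done ++ rest).map bitSymbol ++ m :: r) →
      Invariant G bits (conf 3 (l.length + 1 + done.length) (stackOf s))

/-- Bits and parentheses have different stack symbols, so a bit on top belongs to the vertex being
compared and not to the parentheses below it. -/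
theorem stackOf_top {b : Bool} {γ : List (Fin 5)} {l s : List Bool}
    (h : l.reverse.map bitStack ++ stackOf s = bitStack b :: γ) :
    ∃ l', l = l' ++ [b] ∧ γ = l'.reverse.map bitStack ++ stackOf s := by
  rcases List.eq_nil_or_concat l with rfl | ⟨l', c, rfl⟩
  · obtain ⟨Z, δ, hZ, hb⟩ := stackOf_eq_cons s
    rw [hZ] at h
    exact absurd (List.cons.inj h).1 (hb b)
  · simp only [List.concat_eq_append, List.reverse_append, List.reverse_singleton,
      List.map_cons, List.cons_append] at h
    obtain ⟨h₁, h₂⟩ := List.cons.inj h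
    exact ⟨l', by rw [bitStack_injective h₁, List.concat_eq_append], h₂.symm⟩

theorem stackOf_top_ne {Z : Fin 5} {γ : List (Fin 5)} {l s : List Bool} (hZ : ∀ b, Z ≠ bitStack b)
    (h : l.reverse.map bitStack ++ stackOf s = Z :: γ) : l = [] := by
  rcases List.eq_nil_or_concat l with rfl | ⟨l', c, rfl⟩
  · rfl
  · simp only [List.concat_eq_append, List.reverse_append, List.reverse_singleton,
      List.map_cons, List.cons_append] at h
    exact absurd (List.cons.inj h).1.symm (hZ c)

theorem stackOf_paren {b : Bool} {γ : List (Fin 5)} {s : List Bool}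
    (h : stackOf s = parenStack b :: γ) : ∃ s', s = b :: s' ∧ γ = stackOf s' := by
  rcases s with _ | ⟨c, s⟩
  · have := (List.cons.inj (show (0 : Fin 5) :: [] = _ from h)).1
    exact absurd this (by cases b <;> decide)
  · obtain ⟨h₁, h₂⟩ := List.cons.inj (show parenStack c :: stackOf s = _ from h)
    exact ⟨s, by rw [parenStack_injective h₁], h₂.symm⟩

/-- The essential case is a label read in state `3`: it ends a record whose source equals the
current vertex, and unique readability turns it into an edge that prolongs the walk. A false guess
of a record blocks during the comparison. -/
theorem Invariant.move {L : ℕ} (hlen : ∀ v, (bits v).length = L) (hinj : bits.Injective)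
    {c c' : Conf} (hc : Invariant G bits c) (h : Move (tapeOf G bits) c c') :
    Invariant G bits c' := by
  obtain ⟨τ, hτ, γ, h₁, h₂, h₃, h₄, h₅, h₆, h₇⟩ := h
  obtain ⟨q', p', s'⟩ := c'
  simp only at h₄ h₅ h₆ h₇
  subst h₄ h₅
  -- Common to opening and closing labels: the head can be on a label only after all bits of the
  -- source, and after it stand the bits of the target of an edge.
  have hmark : ∀ {v s} (done rest : List Bool) (m : TapeSymbol 7) (l r : List (TapeSymbol 7)),
      bits v = done ++ rest → IsMarker m →
      tapeOf G bits = l ++ separator :: ((done ++ rest).map bitSymbol ++ m :: r) → ∀ p,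
      (tapeOf G bits)[l.length + 1 + done.length]? = some (.letter (labelLetter p)) →
      rest = [] ∧ (Reached G v s → ∀ s', p.act s = some s' →
        ∃ e ∈ G.edges, ∃ l' r', Reached G e.tgt s' ∧ l'.length = l.length + 1 + done.length + 1 ∧
          tapeOf G bits = l' ++ (bits e.tgt).map bitSymbol ++ separator :: r') := by
    intro v s done rest m l r hv hm ht p hp
    have ht' : tapeOf G bits = (l ++ separator :: done.map bitSymbol) ++
      (rest.map bitSymbol ++ m :: r) := by simpa using ht
    rw [ht', List.getElem?_append_right (by simp; omega)] at hp
    have hz : l.length + 1 + done.length - (l ++ separator :: done.map bitSymbol).length = 0 := by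
      simp; omega
    rw [hz] at hp
    cases rest with
    | cons b rest =>
      simp only [List.map_cons, List.cons_append, List.getElem?_cons_zero, Option.some_inj] at hp
      exact absurd hp (bit_ne_label b p)
    | nil =>
      refine ⟨rfl, fun hR s' hs' => ?_⟩
      simp only [List.map_nil, List.nil_append, List.getElem?_cons_zero, Option.some_inj] at hp
      subst hp
      rw [← hv] at ht
      rcases tapeOf_split hlen hinj ht with ⟨h, -⟩ | ⟨e, he, rfl, hl, r', rfl⟩
      · simp at h
      · obtain rfl := label_injective hl
        refine ⟨e, he, l ++ separator :: (done.map bitSymbol ++ [.letter (labelLetter e.label)]), r',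
          hR.edge he hs', by simp; ring, ?_⟩
        rw [ht, hv]; simp
  cases hc with
  | start =>
    simp only [tapeOf, List.getElem?_cons_zero, Option.some_inj] at h₂
    cases hτ <;> simp [HeadMove.toInt] at h₁ h₂ h₃ h₆ ⊢
    obtain ⟨r, hr⟩ := tapeEnd_eq_cons G bits G.edges
    obtain rfl : p' = 1 := by omega
    subst h₃
    refine Invariant.push (v := G.source) (s := []) [] (bits G.source) [.leftEnd] r
      ⟨[], rfl, rfl⟩ rfl ?_
    rw [tapeOf, hr]; rfl
  | push done rest l r hR hv ht =>
    have hs : tapeOf G bits = l ++ (rest.map bitSymbol ++ separator :: r) := by simpa using ht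
    simp only at h₁ h₂ h₃ h₆
    rw [hs, List.getElem?_append_right le_rfl, Nat.sub_self] at h₂
    rcases rest with _ | ⟨b, rest⟩
    · simp only [List.map_nil, List.nil_append, List.getElem?_cons_zero, Option.some_inj] at h₂
      cases hτ <;> simp at h₁ h₂
      · rename_i b Z; exact absurd (congrArg TapeSymbol.letter h₂) (separator_ne_bit b)
      · rw [List.append_nil] at hv
        rw [← hv] at h₃
        simp only [List.singleton_append, ← h₃]
        exact .seek _ hR
    · simp only [List.map_cons, List.cons_append, List.getElem?_cons_zero, Option.some_inj] at h₂
      cases hτ <;> simp at h₁ h₂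
      · rename_i b' Z
        obtain rfl := bitSymbol_injective (congrArg TapeSymbol.letter h₂)
        have := Invariant.push (done ++ [b]) rest (l ++ [bitSymbol b]) r hR (by simpa using hv)
          (by simpa using ht)
        simp only [HeadMove.toInt] at h₆
        convert this using 1
        have hp : p' = l.length + 1 := by omega
        simp [← h₃, hp]
      · exact absurd (congrArg TapeSymbol.letter h₂).symm (separator_ne_bit b)
  | @seek v s p hR =>
    simp only at h₁ h₂ h₃ h₆
    cases hτ <;> simp at h₁
    · simp only [List.singleton_append, ← h₃]
      exact .seek _ hR
    · simp only [List.singleton_append, ← h₃]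
      exact .seek _ hR
    · rename_i a Z hm
      simp only [List.singleton_append, ← h₃]
      obtain ⟨hp, ha⟩ := List.getElem?_eq_some_iff.1 h₂
      simp only [HeadMove.toInt] at h₆ ha
      refine .compare (v := v) [] (bits v) p' a ((tapeOf G bits).take p)
        ((tapeOf G bits).drop (p + 1)) hR (by simp) hm ?_ (by simp; omega)
      rw [← ha]; simp
  | compare done rest p m l r hR hv hm ht hp =>
    simp only at h₁ h₂ h₃ h₆
    obtain ⟨l, x, rfl⟩ : ∃ l' x, l = l' ++ [x] := by
      rcases List.eq_nil_or_concat l with rfl | ⟨l', x, rfl⟩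
      · simp at hp
      · exact ⟨l', x, List.concat_eq_append ..⟩
    obtain rfl : p = l.length := by simpa using hp
    rw [ht, List.append_assoc, List.getElem?_append_right le_rfl, Nat.sub_self] at h₂
    simp only [List.cons_append, List.nil_append, List.getElem?_cons_zero, Option.some_inj] at h₂
    cases hτ <;> simp at h₁ h₂
    · rename_i b
      subst h₂
      simp only at h₃
      obtain ⟨rest', rfl, rfl⟩ := stackOf_top h₃
      simp only [HeadMove.toInt] at h₆
      exact .compare (b :: done) rest' p' m l r hR (by simpa using hv) hm (by simpa using ht)
        (by omega)
    · rename_i Z hZ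
      subst h₂
      simp only at h₃
      obtain rfl := stackOf_top_ne hZ h₃
      simp only [List.singleton_append, ← h₃]
      simp only [HeadMove.toInt] at h₆
      obtain rfl : p' = l.length + 1 := by omega
      exact .back [] done m l r hR (by simpa using hv) hm (by simpa using ht)
  | back done rest m l r hR hv hm ht =>
    simp only at h₁ h₂ h₃ h₆
    cases hτ <;> simp at h₁
    · rename_i b Z
      have ht' : tapeOf G bits = (l ++ separator :: done.map bitSymbol) ++
        (rest.map bitSymbol ++ m :: r) := by simpa using ht
      rw [ht', List.getElem?_append_right (by simp; omega)] at h₂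
      have hz : l.length + 1 + done.length - (l ++ separator :: done.map bitSymbol).length = 0 := by
        simp; omega
      rw [hz] at h₂
      simp only [HeadMove.toInt] at h₆
      simp only [List.singleton_append, ← h₃]
      cases rest with
      | nil =>
        simp only [List.map_nil, List.nil_append, List.getElem?_cons_zero, Option.some_inj] at h₂
        exact absurd h₂ (hm.ne_bit b)
      | cons b' rest =>
        have := Invariant.back (done ++ [b']) rest m l r hR (by simpa using hv) hm
          (by simpa using ht)
        convert this using 1
        have hp : p' = l.length + 1 + (done.length + 1) := by omega
        simp [hp]
    · rename_i b Z
      obtain ⟨rfl, hmk⟩ := hmark done rest m l r hv hm ht _ h₂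
      obtain ⟨e, -, l', r', hR', hl', ht'⟩ := hmk hR _ (Paren.act_opening _ _)
      have := Invariant.push [] (bits e.tgt) l' r' hR' rfl ht'
      simp only [HeadMove.toInt] at h₆
      convert this using 1
      have hp : p' = l'.length := by omega
      simp only [hp, List.reverse_nil, List.map_nil, List.nil_append]
      congr 1
      simp only at h₃
      simp [stackOf] at h₃ ⊢
      exact h₃.symm
    · rename_i b
      simp only at h₃
      obtain ⟨s', rfl, rfl⟩ := stackOf_paren h₃
      obtain ⟨rfl, hmk⟩ := hmark done rest m l r hv hm ht _ h₂
      obtain ⟨e, -, l', r', hR', hl', ht'⟩ := hmk hR _ (Paren.act_closing _ _)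
      have := Invariant.push [] (bits e.tgt) l' r' hR' rfl ht'
      simp only [HeadMove.toInt] at h₆
      convert this using 1
      have hp : p' = l'.length := by omega
      simp [hp]

theorem reach_iff_dyck {L : ℕ} (hlen : ∀ v, (bits v).length = L) (hinj : bits.Injective) :
    ReflTransGen (Move (tapeOf G bits)) (conf 0 0 [0])
      (conf 3 ((tapeOf G bits).length - 1) [0]) ↔
    ∃ π, G.IsWalk G.source π G.target ∧ Dyck2 (π.map LabelledEdge.label) := by
  constructor
  · intro h
    have hI : ∀ c, ReflTransGen (Move (tapeOf G bits)) (conf 0 0 [0]) c → Invariant G bits c := by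
      intro c hc
      induction hc with
      | refl => exact .start
      | tail _ h ih => exact ih.move hlen hinj h
    obtain ⟨c, hc, hfin⟩ : ∃ c, c = conf 3 ((tapeOf G bits).length - 1) [0] ∧ Invariant G bits c :=
      ⟨_, rfl, hI _ h⟩
    cases hfin with
    | start => simp [conf] at hc
    | push => simp [conf] at hc
    | seek => simp [conf] at hc
    | compare => simp [conf] at hc
    | @back v s done rest m l r hR hv hm ht =>
      simp only [conf, Conf.mk.injEq, true_and] at hc
      obtain ⟨hp, hs⟩ := hc
      have hs : s = [] := by
        cases s with
        | nil => rfl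
        | cons b s => simp [stackOf] at hs
      have hl : (tapeOf G bits).length = l.length + 1 + (done.length + rest.length) + 1 + r.length := by
        rw [ht]; simp; ring
      -- The head is on the last cell, so nothing follows the marker; hence the record is not that
      -- of an edge, and the current vertex is the target.
      obtain rfl : r = [] := List.length_eq_zero_iff.1 (by omega)
      subst hs
      rw [← hv] at ht
      rcases tapeOf_split hlen hinj ht with ⟨-, rfl⟩ | ⟨e, -, -, -, r', h⟩
      · obtain ⟨π, hπ, hr⟩ := hR
        exact ⟨π, hπ, dyck2_iff_parenRun.2 hr⟩
      · simp at h
  · rintro ⟨π, hπ, hd⟩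
    obtain ⟨r, hr⟩ := tapeEnd_eq_cons G bits G.edges
    have ht : tapeOf G bits = [.leftEnd] ++ (bits G.source).map bitSymbol ++ separator :: r := by
      rw [tapeOf, hr]; rfl
    refine .head ?_ (reach_of_walk G bits hπ (dyck2_iff_parenRun.1 hd) ht)
    exact ⟨_, .start, [], rfl, by simp [tapeOf], rfl, rfl, rfl, rfl, by simp [ht]⟩

end Instance

end Recognizer

/-! ## From Dyck-2 reachability to recognition -/

theorem Nat.size_eq_size_half {n : ℕ} (hn : n ≠ 0) : Nat.size n = Nat.size (n / 2) + 1 := by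
  refine le_antisymm (Nat.size_le.2 ?_) (Nat.lt_size.2 ?_)
  · have := Nat.lt_size_self (n / 2)
    rw [pow_succ]; omega
  · rcases Nat.eq_zero_or_pos (n / 2) with h | h
    · rw [h]; simp; omega
    · obtain ⟨k, hk⟩ : ∃ k, Nat.size (n / 2) = k + 1 :=
        Nat.exists_eq_succ_of_ne_zero (Nat.size_pos.2 h).ne'
      have : 2 ^ k ≤ n / 2 := Nat.lt_size.1 (by omega)
      rw [hk, pow_succ]; omega

theorem Nat.size_le_self (n : ℕ) : Nat.size n ≤ n := Nat.size_le.2 Nat.lt_two_pow_self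

/-! ### Binary length and binary output -/

namespace RamProg

/-- Compute the binary length of the content of register `5` in register `4`. -/
def sizeLoop : RamProg := .loop 5 (block [.op .div 5 5 2, .op .add 4 4 1])

theorem runs_sizeLoop {W x : ℕ} {σ : RamState} (h1 : σ.reg 1 = 1) (h2 : σ.reg 2 = 2)
    (h4 : σ.reg 4 = 0) (h5 : σ.reg 5 = x) (hW : x + 1 < W) :
    Runs W sizeLoop σ (4 * Nat.size x + 1) fun σ' => σ'.reg 4 = Nat.size x ∧
      (∀ r, r ≠ 4 → r ≠ 5 → σ'.reg r = σ.reg r) ∧ σ'.mem = σ.mem ∧ σ'.out = σ.out := by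
  refine (Runs.loop_nat (F := 3) (I := fun n σ' => (∃ y ≤ x, n = Nat.size y ∧ σ'.reg 5 = y) ∧
    σ'.reg 4 + n = Nat.size x ∧
    (∀ r, r ≠ 4 → r ≠ 5 → σ'.reg r = σ.reg r) ∧ σ'.mem = σ.mem ∧ σ'.out = σ.out) ?_ ?_
    (Nat.size x) σ ?_).mono (by omega) ?_
  · rintro σ' ⟨⟨y, -, hy, h⟩, -⟩
    rw [h, Nat.size_eq_zero.1 hy.symm]
  · rintro n σ' ⟨⟨y, hyx, hy, h⟩, h4', hr, hm, ho⟩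
    have hy0 : y ≠ 0 := by rintro rfl; simp at hy
    have hsz := Nat.size_eq_size_half hy0
    have := Nat.size_le_self x
    have hr1 := hr 1 (by omega) (by omega)
    have hr2 := hr 2 (by omega) (by omega)
    refine ⟨by omega, ?_⟩
    simp only [Runs.op_iff, Runs.block_nil_iff, RamOp.eval, RamState.setReg_reg, h, hr1, hr2, h1, h2]
    norm_num only [if_true, if_false, true_and]
    refine ⟨by omega, by omega, ⟨y / 2, by omega, by omega, rfl⟩, by omega, fun r h4 h5 => by simp [h4, h5, hr], hm, ho⟩
  · exact ⟨⟨x, le_rfl, rfl, h5⟩, by simp [h4], fun _ _ _ => rfl, rfl, rfl⟩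
  · rintro σ' ⟨-, h, hr, hm, ho⟩
    exact ⟨h, hr, hm, ho⟩

/-- Write the bits of register `5`, as many as register `4` says, the lowest first. -/
def emitBits : RamProg :=
  block [.const 6 0, .op .add 6 6 4,
    .loop 6 (block [.op .mod 7 5 2, .write 7, .op .div 5 5 2, .op .sub 6 6 1])]

theorem runs_emitBits {W x L : ℕ} {σ : RamState} (h1 : σ.reg 1 = 1) (h2 : σ.reg 2 = 2)
    (h4 : σ.reg 4 = L) (h5 : σ.reg 5 = x) (hx : x < W) (hL : L + 2 < W) :
    Runs W emitBits σ (6 * L + 4) fun σ' =>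
      σ'.out = σ.out ++ (bitsOf L x).map (fun b => (Recognizer.bitLetter b).val) ∧
      (∀ r, r ≠ 5 → r ≠ 6 → r ≠ 7 → σ'.reg r = σ.reg r) ∧ σ'.mem = σ.mem := by
  simp only [emitBits, Runs.const_iff, Runs.op_iff, RamOp.eval, RamState.setReg_reg, h4]
  norm_num only [if_true, if_false, h4]
  refine ⟨by omega, by omega, by omega, by omega, ?_⟩
  refine Runs.block_cons (Runs.loop_nat (F := 5) (I := fun n σ' => n ≤ L ∧ (∃ y < W, σ'.reg 5 = y ∧
    σ'.out ++ (bitsOf n y).map (fun b => (Recognizer.bitLetter b).val) =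
      σ.out ++ (bitsOf L x).map (fun b => (Recognizer.bitLetter b).val)) ∧ σ'.reg 6 = n ∧
    (∀ r, r ≠ 5 → r ≠ 6 → r ≠ 7 → σ'.reg r = σ.reg r) ∧ σ'.mem = σ.mem) ?_ ?_ L _ ?_)
    (by omega) ?_
  · exact fun σ' h => h.2.2.1
  · rintro n σ' ⟨hn, ⟨y, hy, h5, ho⟩, h6, hr, hm⟩
    have hr1 := hr 1 (by omega) (by omega) (by omega)
    have hr2 := hr 2 (by omega) (by omega) (by omega)
    refine ⟨by omega, ?_⟩
    simp only [Runs.op_iff, Runs.write_iff, Runs.block_nil_iff, RamOp.eval, RamState.setReg_reg,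
      RamState.emit_reg, h5, h6, hr1, hr2, h1, h2]
    norm_num only [if_true, if_false, h6, true_and]
    refine ⟨by omega, by omega, by omega, by omega, ⟨y / 2, by omega, rfl, ?_⟩, by omega, fun r h5 h6 h7 => by simp [h5, h6, h7, hr], hm⟩
    rw [← ho, bitsOf]
    have : (Recognizer.bitLetter (decide (y % 2 = 1))).val = y % 2 := by
      rcases Nat.mod_two_eq_zero_or_one y with h | h <;> rw [h] <;> rfl
    simp [this]
  · exact ⟨le_rfl, ⟨x, hx, by simp [h5], rfl⟩, by simp, fun r h5 h6 h7 => by simp [h6], rfl⟩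
  · rintro σ' ⟨-, ⟨y, -, -, ho⟩, -, hr, hm⟩
    rw [Runs.block_nil_iff]
    exact ⟨by omega, by simpa [bitsOf] using ho, hr, hm⟩

end RamProg

/-! ### Writing the tape for a graph -/

namespace Recognizer

open RamProg

section Word

variable (G : Dyck2Instance)

/-- The number of bits for a vertex. -/
def bitCount : ℕ := Nat.size G.numVertices

def vertexBits (v : Fin G.numVertices) : List Bool := bitsOf (bitCount G) v

theorem vertexBits_injective : (vertexBits G).Injective := by
  intro u v h
  have hV : G.numVertices < 2 ^ bitCount G := Nat.lt_size_self _
  exact Fin.ext (bitsOf_inj (u.isLt.trans hV) (v.isLt.trans hV) h)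

def edgeWord (e : LabelledEdge G.numVertices) : List (Fin 7) :=
  6 :: ((vertexBits G e.src).map bitLetter ++
    labelLetter e.label :: (vertexBits G e.tgt).map bitLetter)

def wordOf : List (Fin 7) :=
  (vertexBits G G.source).map bitLetter ++ (G.edges.flatMap (edgeWord G) ++
    6 :: (vertexBits G G.target).map bitLetter)

theorem tape_wordOf :
    TwoNPDA.tape automaton (wordOf G) = tapeOf G (vertexBits G) := by
  have hrec : (fun e => (edgeWord G e).map TapeSymbol.letter) = recordOf G (vertexBits G) := by
    funext e
    simp [edgeWord, recordOf, Function.comp_def]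
  have : (TapeSymbol.leftEnd (k := 7)) :: ((wordOf G).map (TapeSymbol.letter (k := 7)) ++
      [TapeSymbol.rightEnd (k := 7)]) = tapeOf G (vertexBits G) := by
    simp only [wordOf, tapeOf, tapeEnd, List.map_append, List.map_flatMap, List.map_cons,
      List.map_map, List.append_assoc, List.cons_append, hrec, Function.comp_def]
  exact this

theorem accepts_wordOf : automaton.Accepts (wordOf G) ↔
    ∃ π, G.IsWalk G.source π G.target ∧ Dyck2 (π.map LabelledEdge.label) := by
  rw [accepts_iff, tape_wordOf]
  exact reach_iff_dyck (fun v => length_bitsOf _ _) (vertexBits_injective G)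

end Word

/-- The program that writes `wordOf`. -/
def wordProgram : RamProg :=
  -- Registers `1` and `2` serve as constants and also as the addresses of the source and the
  -- target. Register `3` holds the number of vertices, `4` the number of bits, `5` the number to be
  -- written, `8` the address of the next entry and `11` the separator.
  block [.const 1 1, .const 2 2, .const 11 6, .const 7 0, .load 3 0 7, .load 5 0 7, .const 4 0,
    sizeLoop, .load 5 0 1, emitBits, .const 8 3, .op .add 8 8 3, .op .lt 10 8 0,
    .loop 10 (block [.write 11, .load 5 0 8, emitBits, .op .add 8 8 1, .load 9 0 8, .op .add 9 9 2,
      .write 9, .op .add 8 8 1, .load 5 0 8, emitBits, .op .add 8 8 1, .op .lt 10 8 0]),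
    .write 11, .load 5 0 2, emitBits]

theorem val_labelLetter (p : Paren) : (labelLetter p).val = p.code + 2 := by cases p <;> rfl

def edgeEntries {n : ℕ} (e : LabelledEdge n) : List ℕ := [e.src.val, e.label.code, e.tgt.val]

theorem encode_eq (G : Dyck2Instance) : G.encode =
    G.numVertices :: G.source.val :: G.target.val ::
      (List.range G.numVertices ++ G.edges.flatMap edgeEntries) := rfl

/-- The contents of the registers that do not change after the initialization, and of the input
array. -/
structure WordRegs (G : Dyck2Instance) (σ : RamState) : Prop where
  reg0 : σ.reg 0 = G.encode.length
  reg1 : σ.reg 1 = 1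
  reg2 : σ.reg 2 = 2
  reg4 : σ.reg 4 = bitCount G
  reg11 : σ.reg 11 = 6
  mem : σ.mem 0 = fun i => G.encode.getD i 0

theorem WordRegs.of_frame {G : Dyck2Instance} {σ σ' : RamState} (h : WordRegs G σ)
    (hr : ∀ r, r ≠ 5 → r ≠ 6 → r ≠ 7 → σ'.reg r = σ.reg r) (hm : σ'.mem = σ.mem) :
    WordRegs G σ' := by
  refine ⟨?_, ?_, ?_, ?_, ?_, by rw [hm, h.mem]⟩ <;>
    rw [hr _ (by omega) (by omega) (by omega)]
  exacts [h.reg0, h.reg1, h.reg2, h.reg4, h.reg11]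

theorem WordRegs.setReg {G : Dyck2Instance} {σ : RamState} (h : WordRegs G σ) {r : ℕ}
    (hr : 4 < r) (hr' : r ≠ 11) (v : ℕ) : WordRegs G (σ.setReg r v) := by
  refine ⟨?_, ?_, ?_, ?_, ?_, h.mem⟩ <;> rw [RamState.setReg_reg, if_neg (by omega)]
  exacts [h.reg0, h.reg1, h.reg2, h.reg4, h.reg11]

theorem WordRegs.emit {G : Dyck2Instance} {σ : RamState} (h : WordRegs G σ) (v : ℕ) :
    WordRegs G (σ.emit v) := ⟨h.reg0, h.reg1, h.reg2, h.reg4, h.reg11, h.mem⟩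

/-- The edges still to be treated are encoded by the suffix of the input that begins at the address
in register `8`; a pass consumes three entries. -/
theorem runs_wordLoop (G : Dyck2Instance) {W : ℕ} (hW : G.encode.length + 10 < W) {σ : RamState}
    (R : WordRegs G σ) (h8 : σ.reg 8 = 3 + G.numVertices)
    (h10 : σ.reg 10 = if 3 + G.numVertices < G.encode.length then 1 else 0) :
    RamProg.Runs W (.loop 10 (block [.write 11, .load 5 0 8, emitBits, .op .add 8 8 1, .load 9 0 8,
      .op .add 9 9 2, .write 9, .op .add 8 8 1, .load 5 0 8, emitBits, .op .add 8 8 1,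
      .op .lt 10 8 0])) σ (G.edges.length * (12 * bitCount G + 30) + 1) fun σ' =>
      WordRegs G σ' ∧ σ'.out = σ.out ++ (G.edges.flatMap (edgeWord G)).map Fin.val := by
  have hlen : G.encode.length = 3 + G.numVertices + (G.edges.flatMap edgeEntries).length := by
    rw [encode_eq]; simp; ring
  have hbc : bitCount G ≤ G.numVertices := Nat.size_le_self _
  refine (Runs.loop_list (F := fun _ => 12 * bitCount G + 29) (I := fun l σ' => WordRegs G σ' ∧
    ∃ pre, G.encode = pre ++ l.flatMap edgeEntries ∧ σ'.reg 8 = pre.length ∧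
      σ'.reg 10 = (if pre.length < G.encode.length then 1 else 0) ∧
      σ'.out ++ (l.flatMap (edgeWord G)).map Fin.val =
        σ.out ++ (G.edges.flatMap (edgeWord G)).map Fin.val) ?_ ?_ G.edges σ ?_).mono ?_ ?_
  · rintro σ' ⟨-, pre, hpre, -, h, -⟩
    rw [h, hpre]; simp
  · rintro e l σ' ⟨R, pre, hpre, h8, h10, ho⟩
    have hpre' : G.encode = pre ++ (e.src.val :: e.label.code :: e.tgt.val ::
      l.flatMap edgeEntries) := by simpa [edgeEntries] using hpre
    have hl : pre.length + 3 + (l.flatMap edgeEntries).length = G.encode.length := by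
      rw [hpre']; simp; ring
    have g0 : G.encode[pre.length]?.getD 0 = e.src.val := by rw [hpre']; simp
    have g1 : G.encode[pre.length + 1]?.getD 0 = e.label.code := by rw [hpre']; simp
    have g2 : G.encode[pre.length + 1 + 1]?.getD 0 = e.tgt.val := by
      rw [hpre', List.getElem?_append_right (by omega)]; simp [add_assoc]
    have hcode : e.label.code ≤ 3 := by cases e.label <;> simp [Paren.code]
    have hsrc := e.src.isLt
    have htgt := e.tgt.isLt
    refine ⟨by rw [h10, if_pos (by omega)]; omega, ?_⟩
    simp only [Runs.write_iff, Runs.load_iff, RamState.emit_mem, RamState.emit_reg, h8, R.mem, g0,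
      List.getD_eq_getElem?_getD]
    refine ⟨by omega, by omega, by omega, ?_⟩
    have R₁ := (R.emit (σ'.reg 11)).setReg (r := 5) (by omega) (by omega) e.src.val
    refine Runs.block_cons (runs_emitBits R₁.reg1 R₁.reg2 R₁.reg4 (x := e.src.val) (by simp)
      (by omega) (by omega)) (by omega) fun σ₂ ⟨o₂, r₂, m₂⟩ => ?_
    have R₂ := R₁.of_frame r₂ m₂
    have h8₂ : σ₂.reg 8 = pre.length := by
      rw [r₂ 8 (by omega) (by omega) (by omega)]; simpa using h8
    simp only [Runs.write_iff, Runs.load_iff, Runs.op_iff, RamOp.eval, RamState.setReg_mem,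
      RamState.setReg_reg, RamState.emit_mem, RamState.emit_reg, h8₂, R₂.mem, R₂.reg1,
      List.getD_eq_getElem?_getD]
    norm_num only [if_true, if_false, h8₂, R₂.reg1, R₂.reg2, g1, g2]
    refine ⟨by omega, by omega, by omega, by omega, by omega, by omega, by omega, by omega, by omega,
      by omega, by omega, ?_⟩
    have R₃ := ((((((R₂.setReg (r := 8) (by omega) (by omega) (pre.length + 1)).setReg (r := 9)
      (by omega) (by omega) e.label.code).setReg (r := 9) (by omega) (by omega)
      (e.label.code + 2)).emit (e.label.code + 2)).setReg (r := 8) (by omega) (by omega)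
      (pre.length + 1 + 1)).setReg (r := 5) (by omega) (by omega) e.tgt.val)
    refine Runs.block_cons (runs_emitBits R₃.reg1 R₃.reg2 R₃.reg4 (x := e.tgt.val) (by simp)
      (by omega) (by omega)) (by omega) fun σ₄ ⟨o₄, r₄, m₄⟩ => ?_
    have R₄ := R₃.of_frame r₄ m₄
    have h8₄ : σ₄.reg 8 = pre.length + 1 + 1 := by
      rw [r₄ 8 (by omega) (by omega) (by omega)]; simp
    simp only [Runs.op_iff, RamOp.eval, RamState.setReg_reg, h8₄, R₄.reg1, Runs.block_nil_iff]
    norm_num only [if_true, if_false, h8₄, R₄.reg1, R₄.reg0]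
    refine ⟨by omega, by omega, by split <;> omega, by omega, by omega,
      (R₄.setReg (by omega) (by omega) _).setReg (by omega) (by omega) _,
      pre ++ edgeEntries e, by simpa using hpre, ?_, ?_, ?_⟩
    · simp [edgeEntries]
    · simp [edgeEntries]
    · rw [← ho]
      simp only [RamState.setReg_out, o₄, RamState.emit_out, o₂, R.reg11, List.flatMap_cons, edgeWord,
        List.map_append, List.map_cons, List.map_map, val_labelLetter, List.append_assoc,
        List.cons_append, List.nil_append, vertexBits, Function.comp_def]
      rfl
  · refine ⟨R, [G.numVertices, G.source.val, G.target.val] ++ List.range G.numVertices, rfl, ?_, ?_,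
      rfl⟩
    · rw [h8]; simp; ring
    · rw [h10]; simp; congr 2; ring
  · simp
  · rintro σ' ⟨R, -, -, -, -, ho⟩
    exact ⟨R, by simpa using ho⟩

theorem runs_wordProgram (G : Dyck2Instance) {W : ℕ} (hW : G.encode.length + 10 < W) :
    RamProg.Runs W wordProgram (RamState.init G.encode)
      (100 * ((bitCount G + 1) * G.encode.length)) fun σ => σ.out = (wordOf G).map Fin.val := by
  have hlen : G.encode.length = 3 + G.numVertices + 3 * G.edges.length := by
    rw [encode_eq]; simp [edgeEntries, List.length_flatMap]; ring
  have hbc : bitCount G ≤ G.numVertices := Nat.size_le_self _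
  have g0 : G.encode[0]?.getD 0 = G.numVertices := rfl
  have g1 : G.encode[1]?.getD 0 = G.source.val := rfl
  have g2 : G.encode[2]?.getD 0 = G.target.val := rfl
  have hs := G.source.isLt
  have ht := G.target.isLt
  have hT : (bitCount G + 1) * G.encode.length = 3 * bitCount G + bitCount G * G.numVertices +
      3 * (G.edges.length * bitCount G) + G.encode.length := by
    rw [hlen]; ring
  have hT' : G.edges.length * (12 * bitCount G + 30) =
      12 * (G.edges.length * bitCount G) + 30 * G.edges.length := by ring
  simp only [wordProgram, Runs.const_iff, Runs.load_iff, RamState.setReg_reg, RamState.setReg_mem,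
    RamState.init_mem_zero, List.getD_eq_getElem?_getD]
  norm_num only [if_true, if_false, g0]
  refine ⟨by omega, by omega, by omega, by omega, by omega, by omega, by omega, by omega, by omega,
    by omega, by omega, by omega, by omega, by omega, ?_⟩
  refine Runs.block_cons (runs_sizeLoop (x := G.numVertices) (by simp) (by simp) (by simp) (by simp)
    (by omega)) (show 4 * bitCount G + 1 ≤ _ by omega) fun σ₁ ⟨h4, r₁, m₁, o₁⟩ => ?_
  have h3 : σ₁.reg 3 = G.numVertices := by rw [r₁ 3 (by omega) (by omega)]; simp
  have R₁ : WordRegs G σ₁ := by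
    refine ⟨?_, ?_, ?_, h4, ?_, ?_⟩
    · rw [r₁ _ (by omega) (by omega)]; simp [RamState.init_reg]
    · rw [r₁ _ (by omega) (by omega)]; simp
    · rw [r₁ _ (by omega) (by omega)]; simp
    · rw [r₁ _ (by omega) (by omega)]; simp
    · rw [m₁]; simp [RamState.init_mem_zero]
  change Runs W _ _ (_ - (4 * bitCount G + 1)) _
  simp only [Runs.load_iff, R₁.mem, R₁.reg1, List.getD_eq_getElem?_getD, g1]
  refine ⟨by omega, by omega, ?_⟩
  have R₂ := R₁.setReg (r := 5) (by omega) (by omega) G.source.val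
  refine Runs.block_cons (runs_emitBits R₂.reg1 R₂.reg2 R₂.reg4 (x := G.source.val) (by simp)
    (by omega) (by omega)) (by omega) fun σ₃ ⟨o₃, r₃, m₃⟩ => ?_
  have R₃ := R₂.of_frame r₃ m₃
  have h3 : σ₃.reg 3 = G.numVertices := by
    rw [r₃ 3 (by omega) (by omega) (by omega)]; simpa using h3
  simp only [Runs.const_iff, Runs.op_iff, RamOp.eval, RamState.setReg_reg]
  norm_num only [if_true, if_false, h3, R₃.reg0]
  refine ⟨by omega, by omega, by omega, by omega, by split <;> omega, by omega, ?_⟩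
  refine Runs.block_cons (runs_wordLoop G hW (((R₃.setReg (by omega) (by omega) _).setReg (by omega)
    (by omega) _).setReg (by omega) (by omega) _) (by simp) (by simp)) (by omega)
    fun σ₄ ⟨R₄, o₄⟩ => ?_
  simp only [Runs.write_iff, Runs.load_iff, RamState.emit_mem, RamState.emit_reg, R₄.mem, R₄.reg2,
    List.getD_eq_getElem?_getD, g2]
  refine ⟨by omega, by omega, by omega, ?_⟩
  have R₅ := (R₄.emit (σ₄.reg 11)).setReg (r := 5) (by omega) (by omega) G.target.val
  refine Runs.block_cons (runs_emitBits R₅.reg1 R₅.reg2 R₅.reg4 (x := G.target.val) (by simp)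
    (by omega) (by omega)) (by omega) fun σ₆ ⟨o₆, r₆, m₆⟩ => ?_
  rw [Runs.block_nil_iff]
  refine ⟨by omega, ?_⟩
  simp only [RamState.setReg_out, o₆, RamState.emit_out, o₄, o₃, o₁, R₄.reg11, RamState.init_out,
    wordOf, List.map_append, List.map_cons, List.map_map, List.append_assoc,
    List.cons_append, List.nil_append, vertexBits, Function.comp_def]
  rfl

end Recognizer

/-- The time is linear in the bit length although vertices are expanded into bits: the number of
vertices is itself an input entry, so an expanded vertex is no longer than the bits charged for one
entry. -/
theorem linearTimeReduces_dyck_recognition :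
    LinearTimeReduces dyck2Reachability (recognitionProblem Recognizer.automaton) := by
  refine ⟨Recognizer.wordOf, ⟨Recognizer.wordProgram, 4, 200, fun (G : Dyck2Instance) => ?_⟩,
    fun G => (Recognizer.accepts_wordOf G).symm⟩
  set n := dyck2Reachability.size G with hn
  have hn' : n = G.encode.length * Nat.size (G.encode.foldr max 1) := rfl
  have hl : G.encode.length ≤ n := length_le_bitLength G.encode
  have hb : Recognizer.bitCount G ≤ Nat.size (G.encode.foldr max 1) :=
    Nat.size_le_size (List.le_foldr_max (by rw [Recognizer.encode_eq]; simp))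
  have hW : G.encode.length + 10 < (n + 2) ^ 4 := by
    have h : 2 ^ 3 * (n + 2) ≤ (n + 2) ^ 3 * (n + 2) :=
      Nat.mul_le_mul_right _ (Nat.pow_le_pow_left (by omega) 3)
    have h' : (n + 2) ^ 4 = (n + 2) ^ 3 * (n + 2) := pow_succ _ _
    omega
  obtain ⟨t, h, ht⟩ := (Recognizer.runs_wordProgram G hW).computes
  refine ⟨t, h, ht.trans ?_⟩
  have : (Recognizer.bitCount G + 1) * G.encode.length ≤ n + n := by
    rw [add_mul, one_mul]
    refine add_le_add ?_ hl
    rw [hn', mul_comm]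
    exact Nat.mul_le_mul_left _ hb
  omega

/-! ## Graphs made of paths -/

namespace PathGraph

open Relation

/-- A labelled edge between natural numbers. -/
abbrev Edge := ℕ × Paren × ℕ

/-- One edge taken, with its effect on the stack of open parentheses. -/
def EdgeStep (es : List Edge) (c c' : ℕ × List Bool) : Prop :=
  ∃ l, (c.1, l, c'.1) ∈ es ∧ l.act c.2 = some c'.2

/-- An edge labelled by a word. -/
structure Rule where
  src : ℕ
  word : List Paren
  dst : ℕ

def RuleStep (rs : List Rule) (c c' : ℕ × List Bool) : Prop :=
  ∃ r ∈ rs, r.src = c.1 ∧ r.dst = c'.1 ∧ parenRun r.word c.2 = some c'.2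

/-- The path from `u` through the new vertices `f`, `f + 1`, ... -/
def chain : ℕ → ℕ → List Paren → List Edge
  | _, _, [] => []
  | u, f, l :: w => (u, l, f) :: chain f (f + 1) w

def chainEnd : ℕ → ℕ → List Paren → ℕ
  | u, _, [] => u
  | _, f, _ :: w => chainEnd f (f + 1) w

theorem chain_append (u f : ℕ) (w w' : List Paren) :
    chain u f (w ++ w') = chain u f w ++ chain (chainEnd u f w) (f + w.length) w' := by
  induction w generalizing u f with
  | nil => rfl
  | cons l w ih => simp [chain, chainEnd, ih, add_assoc, add_comm 1]

theorem chainEnd_append (u f : ℕ) (w w' : List Paren) :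
    chainEnd u f (w ++ w') = chainEnd (chainEnd u f w) (f + w.length) w' := by
  induction w generalizing u f with
  | nil => rfl
  | cons l w ih => simp [chainEnd, ih, add_assoc, add_comm 1]

theorem chainEnd_concat (u f : ℕ) (w : List Paren) (l : Paren) :
    chainEnd u f (w ++ [l]) = f + w.length := by
  rw [chainEnd_append]; rfl

theorem map_tgt_chain (u f : ℕ) (w : List Paren) :
    (chain u f w).map (fun e => e.2.2) = List.range' f w.length := by
  induction w generalizing u f with
  | nil => rfl
  | cons l w ih => simp [chain, ih, List.range'_succ]

theorem mem_chain {u f : ℕ} {w : List Paren} {e : Edge} (h : e ∈ chain u f w) :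
    ∃ i, ∃ hi : i < w.length, e = (if i = 0 then u else f + i - 1, w[i], f + i) := by
  induction w generalizing u f with
  | nil => simp [chain] at h
  | cons l w ih =>
    rcases List.mem_cons.1 h with rfl | h
    · exact ⟨0, by simp, rfl⟩
    · obtain ⟨i, hi, rfl⟩ := ih h
      refine ⟨i + 1, by simpa, ?_⟩
      rcases i with _ | i
      · simp
      · simp; omega

/-- The path for a rule. It ends with a pair of parentheses, so that it has at least two edges. -/
def rulePath (f : ℕ) (r : Rule) : List Edge :=
  chain r.src f (r.word ++ [Paren.roundOpen]) ++ [(f + r.word.length, Paren.roundClose, r.dst)]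

/-- The graph with one path for each rule; the new vertices are numbered from `f` on. -/
def graph : ℕ → List Rule → List Edge
  | _, [] => []
  | f, r :: rs => rulePath f r ++ graph (f + r.word.length + 1) rs

def numNew (rs : List Rule) : ℕ := (rs.map fun r => r.word.length + 1).sum

theorem graph_append (f : ℕ) (rs rs' : List Rule) :
    graph f (rs ++ rs') = graph f rs ++ graph (f + numNew rs) rs' := by
  induction rs generalizing f with
  | nil => rfl
  | cons r rs ih => simp [graph, ih, numNew, add_assoc]

theorem numNew_append (rs rs' : List Rule) : numNew (rs ++ rs') = numNew rs + numNew rs' := by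
  simp [numNew]

theorem mem_rulePath {f : ℕ} {r : Rule} {e : Edge} (h : e ∈ rulePath f r) :
    (∃ i, ∃ hi : i < (r.word ++ [Paren.roundOpen]).length,
      e = (if i = 0 then r.src else f + i - 1, (r.word ++ [Paren.roundOpen])[i], f + i)) ∨
    e = (f + r.word.length, Paren.roundClose, r.dst) := by
  rcases List.mem_append.1 h with h | h
  · exact .inl (mem_chain h)
  · exact .inr (List.mem_singleton.1 h)

/-- Vertices below `H` are old, those from `f` on are new, and each edge touches a new one. In the
induction `f` has passed the vertices of earlier paths, which lie in the gap between `H` and `f` and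
are avoided. -/
theorem graph_bounds {H : ℕ} {rs : List Rule} (hr : ∀ r ∈ rs, r.src < H ∧ r.dst < H) {f : ℕ}
    (hf : H ≤ f) {e : Edge} (he : e ∈ graph f rs) :
    (e.1 < H ∨ f ≤ e.1) ∧ (e.2.2 < H ∨ f ≤ e.2.2) ∧ e.1 < f + numNew rs ∧ e.2.2 < f + numNew rs ∧
      (f ≤ e.1 ∨ f ≤ e.2.2) := by
  induction rs generalizing f with
  | nil => simp [graph] at he
  | cons r rs ih =>
    have hs := hr r (by simp)
    simp only [numNew, List.map_cons, List.sum_cons]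
    rcases List.mem_append.1 he with he | he
    · rcases mem_rulePath he with ⟨i, hi, rfl⟩ | rfl
      · simp only [List.length_append, List.length_singleton] at hi
        simp only
        split_ifs with h0 <;> omega
      · simp only; omega
    · have := ih (fun r h => hr r (by simp [h])) (by omega) he
      simp only [numNew] at this
      omega

/-- A new vertex lies on only one path, so edges of different paths differ. On one path the edges
enter distinct new vertices, except for the last edge, which enters an old one. Without the
additional pair of parentheses, rules with short words and common ends could yield parallel edges.
-/
theorem graph_nodup {H : ℕ} {rs : List Rule} (hr : ∀ r ∈ rs, r.src < H ∧ r.dst < H) {f : ℕ}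
    (hf : H ≤ f) : ((graph f rs).map fun e => (e.1, e.2.2)).Nodup := by
  induction rs generalizing f with
  | nil => simp [graph]
  | cons r rs ih =>
    have hs := hr r (by simp)
    have hr' : ∀ r ∈ rs, r.src < H ∧ r.dst < H := fun r h => hr r (by simp [h])
    rw [graph, List.map_append]
    refine List.Nodup.append ?_ (ih hr' (by omega)) ?_
    · rw [rulePath, List.map_append]
      refine List.Nodup.append (List.Nodup.of_map Prod.snd ?_) (by simp) ?_
      · rw [List.map_map]
        have := map_tgt_chain r.src f (r.word ++ [Paren.roundOpen])
        simp only [Function.comp_def]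
        rw [this]
        exact List.nodup_range'
      · intro p hp hp'
        obtain ⟨e, he, rfl⟩ := List.mem_map.1 hp
        obtain ⟨i, hi, rfl⟩ := mem_chain he
        simp at hp'
        omega
    · intro p hp hp'
      obtain ⟨e, he, rfl⟩ := List.mem_map.1 hp
      obtain ⟨e', he', h⟩ := List.mem_map.1 hp'
      have hb := graph_bounds hr' (show H ≤ f + r.word.length + 1 by omega) he'
      simp only [Prod.mk.injEq] at h
      rcases mem_rulePath he with ⟨i, hi, rfl⟩ | rfl
      · simp only [List.length_append, List.length_singleton] at hi
        simp only at h
        split_ifs at h with h0 <;> omega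
      · simp only at h; omega

theorem reach_chain {es : List Edge} {w : List Paren} {u f : ℕ} {s s' : List Bool}
    (h : chain u f w ⊆ es) (hs : parenRun w s = some s') :
    ReflTransGen (EdgeStep es) (u, s) (chainEnd u f w, s') := by
  induction w generalizing u f s with
  | nil =>
    obtain rfl : s = s' := by simpa using hs
    exact .refl
  | cons l w ih =>
    rw [parenRun_cons, Option.bind_eq_some_iff] at hs
    obtain ⟨s₁, h₁, h₂⟩ := hs
    refine .head (b := (f, s₁)) ⟨l, h (by simp [chain]), h₁⟩ (ih (fun e he => h ?_) h₂)
    exact List.mem_cons_of_mem _ he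

theorem rulePath_subset_graph {rs : List Rule} {r : Rule} (hr : r ∈ rs) (f : ℕ) :
    ∃ f', rulePath f' r ⊆ graph f rs := by
  induction rs generalizing f with
  | nil => simp at hr
  | cons r' rs ih =>
    rcases List.mem_cons.1 hr with rfl | hr
    · exact ⟨f, List.subset_append_left _ _⟩
    · obtain ⟨f', h⟩ := ih hr (f + r'.word.length + 1)
      exact ⟨f', List.Subset.trans h (List.subset_append_right _ _)⟩

theorem reach_of_ruleStep {rs : List Rule} {f : ℕ} {c c' : ℕ × List Bool}
    (h : RuleStep rs c c') : ReflTransGen (EdgeStep (graph f rs)) c c' := by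
  obtain ⟨u, s⟩ := c
  obtain ⟨v, s'⟩ := c'
  obtain ⟨r, hr, h₁, h₂, h₃⟩ := h
  simp only at h₁ h₂ h₃
  subst h₁ h₂
  obtain ⟨f', hf'⟩ := rulePath_subset_graph hr f
  have hp : parenRun (r.word ++ [Paren.roundOpen]) s = some (false :: s') := by
    rw [parenRun_append, h₃]; rfl
  refine (reach_chain (f := f') (List.Subset.trans (List.subset_append_left _ _) hf') hp).tail
    ⟨.roundClose, hf' ?_, rfl⟩
  rw [chainEnd_concat]
  exact List.mem_append_right _ (by simp)

/-- What remains to be read from a vertex until the path that it lies on ends, and where it ends. -/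
def residual : ℕ → List Rule → ℕ → List Paren × ℕ
  | _, [], x => ([], x)
  | f, r :: rs, x =>
    if x < f then ([], x)
    else if x < f + r.word.length + 1 then
      -- The vertex `f + i` is entered by the edge with index `i`, so `i + 1` letters have been read
      -- there.
      ((r.word ++ [Paren.roundOpen, Paren.roundClose]).drop (x - f + 1), r.dst)
    else residual (f + r.word.length + 1) rs x

theorem residual_of_lt {f : ℕ} {rs : List Rule} {x : ℕ} (hx : x < f) :
    residual f rs x = ([], x) := by
  cases rs <;> simp [residual, hx]

/-- A new vertex has a single continuation, so an edge leaving it just removes its label from the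
residual word. A choice is made only at old vertices, and it is the choice of a rule. -/
theorem residual_edge {H : ℕ} {rs : List Rule} (hr : ∀ r ∈ rs, r.src < H ∧ r.dst < H) {f : ℕ}
    (hf : H ≤ f) {x y : ℕ} {l : Paren} (he : (x, l, y) ∈ graph f rs) :
    if x < H then ∃ r ∈ rs, r.src = x ∧ r.dst = (residual f rs y).2 ∧
      r.word ++ [Paren.roundOpen, Paren.roundClose] = l :: (residual f rs y).1
    else residual f rs x = (l :: (residual f rs y).1, (residual f rs y).2) := by
  induction rs generalizing f with
  | nil => simp [graph] at he
  | cons r rs ih =>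
    have hs := hr r (by simp)
    have hr' : ∀ r ∈ rs, r.src < H ∧ r.dst < H := fun r h => hr r (by simp [h])
    rcases List.mem_append.1 he with he | he
    · rcases mem_rulePath he with ⟨i, hi, h⟩ | h
      · have hi' : i < r.word.length + 1 := by simpa using hi
        simp only [Prod.mk.injEq] at h
        obtain ⟨rfl, rfl, rfl⟩ := h
        have hw : ∀ j (hj : j < (r.word ++ [Paren.roundOpen]).length),
            (r.word ++ [Paren.roundOpen, Paren.roundClose]).drop j =
              (r.word ++ [Paren.roundOpen])[j] :: (r.word ++ [Paren.roundOpen, Paren.roundClose]).drop (j + 1) := by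
          intro j hj
          rw [List.drop_eq_getElem_cons (by simp at hj ⊢; omega)]
          congr 1
          have : r.word ++ [Paren.roundOpen, Paren.roundClose] =
            (r.word ++ [Paren.roundOpen]) ++ [Paren.roundClose] := by simp
          simp only [this]
          rw [List.getElem_append_left hj]
        have hy : residual f (r :: rs) (f + i) =
            ((r.word ++ [Paren.roundOpen, Paren.roundClose]).drop (i + 1), r.dst) := by
          simp only [residual]
          rw [if_neg (by omega), if_pos (by omega), Nat.add_sub_cancel_left]
        rw [hy]
        rcases i with _ | i
        · rw [if_pos rfl, if_pos hs.1]
          exact ⟨r, by simp, rfl, rfl, hw 0 hi⟩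
        · have h0 : (if i + 1 = 0 then r.src else f + (i + 1) - 1) = f + i := if_neg (by omega)
          have : f + i - f + 1 = i + 1 := by omega
          rw [h0, if_neg (by omega), residual, if_neg (by omega), if_pos (by omega)]
          rw [this, hw (i + 1) hi]
      · simp only [Prod.mk.injEq] at h
        obtain ⟨rfl, rfl, rfl⟩ := h
        rw [if_neg (by omega), residual_of_lt (show r.dst < f by omega), residual,
          if_neg (by omega), if_pos (by omega)]
        simp
    · have hb := graph_bounds hr' (show H ≤ f + r.word.length + 1 by omega) he
      simp only at hb
      have key : ∀ z, z < H ∨ f + r.word.length + 1 ≤ z →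
          residual f (r :: rs) z = residual (f + r.word.length + 1) rs z := by
        rintro z (hz | hz)
        · rw [residual_of_lt (by omega), residual_of_lt (by omega)]
        · rw [residual, if_neg (by omega), if_neg (by omega)]
      have := ih hr' (by omega) he
      rw [key x hb.1, key y hb.2.1]
      split_ifs with hx
      · rw [if_pos hx] at this
        obtain ⟨r', hr', h⟩ := this
        exact ⟨r', by simp [hr'], h⟩
      · rwa [if_neg hx] at this

/-- Induction from the end of the run, started anywhere on a path: the run first completes this path
and then applies rules. The endpoint has to be old, so that no path is left unfinished. -/
theorem reach_rules_of_reach {H : ℕ} {rs : List Rule} (hr : ∀ r ∈ rs, r.src < H ∧ r.dst < H)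
    {f : ℕ} (hf : H ≤ f) {v : ℕ} (hv : v < H) {c : ℕ × List Bool} {s' : List Bool}
    (h : ReflTransGen (EdgeStep (graph f rs)) c (v, s')) :
    ∃ s₁, parenRun (residual f rs c.1).1 c.2 = some s₁ ∧
      ReflTransGen (RuleStep rs) ((residual f rs c.1).2, s₁) (v, s') := by
  induction h using ReflTransGen.head_induction_on with
  | refl => rw [residual_of_lt (by omega)]; exact ⟨s', rfl, .refl⟩
  | @head c c' h _ ih =>
    obtain ⟨x, s⟩ := c
    obtain ⟨y, s₂⟩ := c'
    obtain ⟨l, hl, ha⟩ := h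
    obtain ⟨s₁, h₁, h₂⟩ := ih
    simp only at hl ha h₁ h₂ ⊢
    have he := residual_edge hr hf hl
    have hrun : parenRun (l :: (residual f rs y).1) s = some s₁ := by
      rw [parenRun_cons, ha]; exact h₁
    split_ifs at he with hx
    · obtain ⟨r, hrr, rfl, hd, hw⟩ := he
      rw [residual_of_lt (by omega)]
      refine ⟨s, rfl, .head ⟨r, hrr, rfl, hd, ?_⟩ h₂⟩
      rw [← hw, parenRun_append] at hrun
      -- The final pair of parentheses pushes and pops one bit, so the word of the rule alone has
      -- the same effect.
      rcases hp : parenRun r.word s with _ | s₃ <;> rw [hp] at hrun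
      · simp at hrun
      · simpa [parenRun_cons, Paren.act] using hrun
    · rw [he]
      exact ⟨s₁, hrun, h₂⟩

theorem reach_iff {H : ℕ} {rs : List Rule} (hr : ∀ r ∈ rs, r.src < H ∧ r.dst < H)
    {f : ℕ} (hf : H ≤ f) {u v : ℕ} (hu : u < H) (hv : v < H) {s s' : List Bool} :
    ReflTransGen (EdgeStep (graph f rs)) (u, s) (v, s') ↔
      ReflTransGen (RuleStep rs) (u, s) (v, s') := by
  constructor
  · intro h
    obtain ⟨s₁, h₁, h₂⟩ := reach_rules_of_reach hr hf hv h
    rw [residual_of_lt (by simp only; omega)] at h₁ h₂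
    obtain rfl : s = s₁ := by simpa using h₁
    exact h₂
  · generalize (u, s) = c, (v, s') = c'
    intro h
    induction h with
    | refl => exact .refl
    | tail _ h ih => exact ih.trans (reach_of_ruleStep h)

/-! ### Instances of Dyck-2 reachability from edges between natural numbers -/

def toInstance (V s t : ℕ) (hs : s < V) (ht : t < V) (es : List Edge)
    (hes : ∀ e ∈ es, e.1 < V ∧ e.2.2 < V) (hnd : (es.map fun e => (e.1, e.2.2)).Nodup) :
    Dyck2Instance where
  numVertices := V
  source := ⟨s, hs⟩
  target := ⟨t, ht⟩
  edges := es.attach.map fun e => ⟨⟨e.1.1, (hes e.1 e.2).1⟩, e.1.2.1, ⟨e.1.2.2, (hes e.1 e.2).2⟩⟩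
  edges_nodup := by
    refine List.Nodup.of_map (fun p => (p.1.val, p.2.val)) ?_
    simp only [List.map_map, Function.comp_def]
    rw [List.attach_map_val (f := fun e : Edge => (e.1, e.2.2))]
    exact hnd

def edgeOutput (e : Edge) : List ℕ := [e.1, e.2.1.code, e.2.2]

variable {V s t : ℕ} {hs : s < V} {ht : t < V} {es : List Edge}
    {hes : ∀ e ∈ es, e.1 < V ∧ e.2.2 < V} {hnd : (es.map fun e => (e.1, e.2.2)).Nodup}

theorem encode_toInstance : (toInstance V s t hs ht es hes hnd).encode =
    [V, s, t] ++ List.range V ++ es.flatMap edgeOutput := by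
  rw [Dyck2Instance.encode]
  simp only [toInstance, List.flatMap_map]
  congr 1
  conv_rhs => rw [← List.attach_map_subtype_val es, List.flatMap_map]
  rfl

theorem walk_iff_reach {u v : Fin V} {a b : List Bool} :
    (∃ π, (toInstance V s t hs ht es hes hnd).IsWalk u π v ∧
      parenRun (π.map LabelledEdge.label) a = some b) ↔
    ReflTransGen (EdgeStep es) (u.val, a) (v.val, b) := by
  constructor
  · rintro ⟨π, hπ, hr⟩
    induction π generalizing u a with
    | nil =>
      obtain rfl : u = v := hπ
      obtain rfl : a = b := by simpa using hr
      exact .refl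
    | cons e π ih =>
      obtain ⟨he, rfl, hπ⟩ := hπ
      rw [List.map_cons, parenRun_cons, Option.bind_eq_some_iff] at hr
      obtain ⟨a', h₁, h₂⟩ := hr
      obtain ⟨⟨e', he'⟩, -, rfl⟩ := List.mem_map.1 he
      exact .head ⟨_, he', h₁⟩ (ih hπ h₂)
  · intro h
    generalize hc : ((u.val, a) : ℕ × List Bool) = c at h
    induction h using ReflTransGen.head_induction_on generalizing u a with
    | refl =>
      obtain ⟨h₁, rfl⟩ := Prod.mk.inj hc
      exact ⟨[], Fin.ext h₁, rfl⟩
    | @head c c' h _ ih =>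
      subst hc
      obtain ⟨l, hl, ha⟩ := h
      obtain ⟨π, hπ, hr⟩ := ih (u := ⟨c'.1, (hes _ hl).2⟩) (a := c'.2) rfl
      refine ⟨⟨u, l, ⟨c'.1, (hes _ hl).2⟩⟩ :: π, ⟨?_, rfl, hπ⟩, ?_⟩
      · exact List.mem_map.2 ⟨⟨_, hl⟩, List.mem_attach _ _, rfl⟩
      · simp only [List.map_cons, parenRun_cons]
        simp only at ha
        rw [ha]; exact hr

theorem yes_toInstance_iff : dyck2Reachability.yes (toInstance V s t hs ht es hes hnd) ↔
    ReflTransGen (EdgeStep es) (s, []) (t, []) := by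
  refine Iff.trans ?_ (walk_iff_reach (hs := hs) (ht := ht) (hes := hes) (hnd := hnd)
    (u := ⟨s, hs⟩) (v := ⟨t, ht⟩))
  exact exists_congr fun π => and_congr_right fun _ => dyck2_iff_parenRun

end PathGraph

/-! ## From emptiness to Dyck-2 reachability: the graph -/

/-- Read a number off the stack. -/
def popWord (L x : ℕ) : List Paren := (bitsOf L x).map Paren.closing

/-- Put a number on the stack. -/
def pushWord (L x : ℕ) : List Paren := (bitsOf L x).reverse.map Paren.opening

@[simp] theorem length_popWord (L x : ℕ) : (popWord L x).length = L := by simp [popWord]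

@[simp] theorem length_pushWord (L x : ℕ) : (pushWord L x).length = L := by simp [pushWord]

theorem parenRun_popWord {L x : ℕ} {s s' : List Bool} :
    parenRun (popWord L x) s = some s' ↔ s = bitsOf L x ++ s' := parenRun_closing_eq_some

theorem parenRun_pushWord (L x : ℕ) (s : List Bool) :
    parenRun (pushWord L x) s = some (bitsOf L x ++ s) := by
  rw [pushWord, parenRun_opening, List.reverse_reverse]

/-- The last number of the list is pushed first, so that the first one ends on top. -/
theorem parenRun_flatMap_pushWord (L : ℕ) (l : List ℕ) (s : List Bool) :
    parenRun (l.reverse.flatMap (pushWord L)) s = some (l.flatMap (bitsOf L) ++ s) := by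
  induction l with
  | nil => rfl
  | cons x l ih =>
    rw [List.reverse_cons, List.flatMap_append, parenRun_append, ih]
    simp [parenRun_pushWord]

theorem bitsOf_append_inj {L x y : ℕ} (hx : x < 2 ^ L) (hy : y < 2 ^ L) {s s' : List Bool}
    (h : bitsOf L x ++ s = bitsOf L y ++ s') : x = y ∧ s = s' := by
  obtain ⟨h₁, h₂⟩ := List.append_inj h (by simp)
  exact ⟨bitsOf_inj hx hy h₁, h₂⟩

/-! ### Path rules for the transitions of an automaton -/

namespace TwoNPDA

variable (M : TwoNPDA)

theorem eq_zero_of_tape_leftEnd {w : List (Fin M.numLetters)} {i : ℕ}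
    (h : (M.tape w)[i]? = some .leftEnd) : i = 0 := by
  rcases i with _ | i
  · rfl
  · simp only [tape, List.getElem?_cons_succ, List.getElem?_append, List.getElem?_map] at h
    split_ifs at h
    · simp [Option.map_eq_some_iff] at h
    · simp [List.getElem?_singleton] at h

theorem eq_of_tape_rightEnd {w : List (Fin M.numLetters)} {i : ℕ}
    (h : (M.tape w)[i]? = some .rightEnd) : i = w.length + 1 := by
  rcases i with _ | i
  · simp [tape] at h
  · simp only [tape, List.getElem?_cons_succ, List.getElem?_append, List.getElem?_map] at h
    split_ifs at h with hi
    · simp [Option.map_eq_some_iff] at h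
    · simp only [List.length_map] at hi
      simp [List.getElem?_singleton] at h
      omega

theorem tape_getElem?_last (w : List (Fin M.numLetters)) :
    (M.tape w)[w.length + 1]? = some .rightEnd := by
  simp [tape]

/-- One move on a tape of which only a part is known. -/
def TapeStep (tp : List (TapeSymbol M.numLetters)) (c c' : M.Config) : Prop :=
  ∃ τ ∈ M.trans, ∃ γ : List (Fin M.numStack),
    c.state = τ.src ∧ tp[c.pos]? = some τ.read ∧ c.stack = τ.top :: γ ∧
    c'.state = τ.dst ∧ c'.stack = τ.push ++ γ ∧
    (c'.pos : ℤ) = (c.pos : ℤ) + τ.move.toInt ∧ c'.pos < tp.length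

/-- A run remains valid when the tape is prolonged to the right; this allows the input word to be
guessed one symbol at a time. -/
theorem TapeStep.append {tp ts : List (TapeSymbol M.numLetters)} {c c' : M.Config}
    (h : M.TapeStep tp c c') : M.TapeStep (tp ++ ts) c c' := by
  obtain ⟨τ, hτ, γ, h₁, h₂, h₃, h₄, h₅, h₆, h₇⟩ := h
  refine ⟨τ, hτ, γ, h₁, ?_, h₃, h₄, h₅, h₆, by rw [List.length_append]; omega⟩
  obtain ⟨hi, -⟩ := List.getElem?_eq_some_iff.1 h₂
  rw [List.getElem?_append_left hi, h₂]

theorem reach_append {tp : List (TapeSymbol M.numLetters)} (ts : List (TapeSymbol M.numLetters))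
    {c c' : M.Config} (h : Relation.ReflTransGen (M.TapeStep tp) c c') :
    Relation.ReflTransGen (M.TapeStep (tp ++ ts)) c c' :=
  Relation.ReflTransGen.mono (p := M.TapeStep (tp ++ ts)) (fun _ _ h => h.append) _ _ h

/-- The number of bits for tape and stack symbols. -/
def width : ℕ := Nat.size (M.numLetters + 2 + M.numStack)

theorem code_lt_width (a : TapeSymbol M.numLetters) : a.code < 2 ^ M.width := by
  have := Nat.lt_size_self (M.numLetters + 2 + M.numStack)
  rw [width]
  cases a <;> simp only [TapeSymbol.code] <;> omega

theorem val_lt_width (Z : Fin M.numStack) : Z.val < 2 ^ M.width := by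
  have := Nat.lt_size_self (M.numLetters + 2 + M.numStack)
  rw [width]
  omega

theorem width_pos : 0 < M.width := Nat.size_pos.2 (by omega)

/-- The stack as a sequence of bits. -/
def stackBits (S : List (Fin M.numStack)) : List Bool :=
  (S.map Fin.val).flatMap (bitsOf M.width)

theorem stackBits_cons (Z : Fin M.numStack) (S : List (Fin M.numStack)) :
    M.stackBits (Z :: S) = bitsOf M.width Z ++ M.stackBits S := rfl

theorem stackBits_append (S S' : List (Fin M.numStack)) :
    M.stackBits (S ++ S') = M.stackBits S ++ M.stackBits S' := by simp [stackBits]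

/-- Blocks of equal length are uniquely decodable. The width is positive, so a block cannot come
from the empty stack. -/
theorem eq_cons_of_stackBits {S : List (Fin M.numStack)} {Z : Fin M.numStack} {s : List Bool}
    (h : M.stackBits S = bitsOf M.width Z ++ s) : ∃ γ, S = Z :: γ ∧ s = M.stackBits γ := by
  rcases S with _ | ⟨Y, γ⟩
  · have := congrArg List.length h
    have := M.width_pos
    simp [stackBits] at *
    omega
  · rw [stackBits_cons] at h
    obtain ⟨h₁, h₂⟩ := bitsOf_append_inj (M.val_lt_width _) (M.val_lt_width _) h
    exact ⟨γ, by rw [Fin.ext h₁], h₂.symm⟩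

open PathGraph

/-- The edges for a transition. The vertex `q` stands for the state `q` with the code of the scanned
symbol on top of the stack, the vertex `numStates + q` for the state `q` after a move to the right,
before the next symbol is guessed. -/
def transRules (τ : PDATransition M.numStates M.numLetters M.numStack) : List Rule :=
  [⟨τ.src, popWord M.width τ.read.code ++ (popWord M.width τ.top ++
      ((τ.push.map Fin.val).reverse.flatMap (pushWord M.width) ++
        -- The scanned symbol is put back only if the head stays; otherwise the next symbol has yet
        -- to be guessed.
        if τ.move.code = 1 then pushWord M.width τ.read.code else [])),
    -- A one-way head that does not stay moves right. From the right endmarker it would leave the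
    -- tape, and the path leads to a vertex that no rule leaves.
    if τ.move.code = 1 then τ.dst else if τ.read.code = 1 then 2 * M.numStates + 2
      else M.numStates + τ.dst⟩,
   -- Only symbols that some transition from the state reads are guessed, which keeps the number of
   -- rules linear. The left endmarker is never met after a move to the right, so its guess is
   -- attached to a vertex that no rule enters. Each transition thus has exactly two rules.
   ⟨if τ.read.code = 0 then 2 * M.numStates + 3 else M.numStates + τ.src,
    pushWord M.width τ.read.code, τ.src⟩]

/-- The right endmarker must be guessed here too, since in a final state no transition need read it.
The second rule removes it and the end-of-stack symbol, after which an empty stack means acceptance.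
-/
def finalRules (q : ℕ) : List Rule :=
  [⟨M.numStates + q, pushWord M.width 1, q⟩,
   ⟨q, popWord M.width 1 ++ popWord M.width M.bottom, 2 * M.numStates + 1⟩]

/-- The number pushed last, `0`, is the code of the left endmarker, scanned at the start. -/
def startRule : Rule :=
  ⟨2 * M.numStates, pushWord M.width M.bottom ++ pushWord M.width 0, M.start⟩

def rules : List Rule :=
  M.startRule :: ((List.finRange M.numStates).flatMap
    (fun q => if q ∈ M.final then M.finalRules q else []) ++ M.trans.flatMap M.transRules)

theorem mem_rules {r : Rule} : r ∈ M.rules ↔ r = M.startRule ∨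
    (∃ q ∈ M.final, r ∈ M.finalRules q) ∨ ∃ τ ∈ M.trans, r ∈ M.transRules τ := by
  simp only [rules, List.mem_cons, List.mem_append, List.mem_flatMap, List.mem_finRange, true_and]
  refine or_congr_right (or_congr_left (exists_congr fun q => ?_))
  split_ifs with h <;> simp [h]

theorem rules_bounds {r : Rule} (h : r ∈ M.rules) :
    r.src < 2 * M.numStates + 4 ∧ r.dst < 2 * M.numStates + 4 := by
  rcases M.mem_rules.1 h with rfl | ⟨q, -, h⟩ | ⟨τ, -, h⟩
  · simp only [startRule]; omega
  · simp only [finalRules, List.mem_cons, List.not_mem_nil, or_false] at h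
    rcases h with rfl | rfl <;> simp only <;> omega
  · simp only [transRules, List.mem_cons, List.not_mem_nil, or_false] at h
    rcases h with rfl | rfl <;> simp only <;> split_ifs <;> omega

end TwoNPDA

/-! ### Correctness of the path rules -/

namespace PDA

open PathGraph Relation

variable (A : PDA)

/-- `A` can reach the state `q` with this stack, having the head on the last of the known symbols of
the tape, which is on top of the stack. -/
def ScanState (q : Fin A.numStates) (s : List Bool) : Prop :=
  ∃ S a tp, ((∃ xs : List (Fin A.numLetters), tp ++ [a] = .leftEnd :: xs.map .letter) ∨ ∃ xs, tp ++ [a] = A.tape xs) ∧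
    s = bitsOf A.width a.code ++ A.stackBits S ∧
    ReflTransGen (A.TapeStep (tp ++ [a])) ⟨A.start, 0, [A.bottom]⟩ ⟨q, tp.length, S⟩

/-- `A` can reach the state `q` with this stack by a move to the right, the next symbol of the tape
being arbitrary. -/
def MoveState (q : Fin A.numStates) (s : List Bool) : Prop :=
  ∃ S, ∃ xs : List (Fin A.numLetters), s = A.stackBits S ∧
    ∀ b, ReflTransGen (A.TapeStep (.leftEnd :: xs.map .letter ++ [b])) ⟨A.start, 0, [A.bottom]⟩
      ⟨q, xs.length + 1, S⟩

/-- The part for the source guarantees that the start rule is applied to an empty stack, the one for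
the orphan that the left endmarker is not guessed. The vertex `2 * A.numStates + 2` needs no
condition because no rule starts there. -/
structure ReachInvariant (c : ℕ × List Bool) : Prop where
  scan : ∀ q : Fin A.numStates, c.1 = q → A.ScanState q c.2
  move : ∀ q : Fin A.numStates, c.1 = A.numStates + q → A.MoveState q c.2
  source : c.1 = 2 * A.numStates → c.2 = []
  target : c.1 = 2 * A.numStates + 1 → c.2 = [] → ∃ w, A.Accepts w
  orphan : c.1 ≠ 2 * A.numStates + 3

theorem reachInvariant_scan {q : Fin A.numStates} {s : List Bool} (h : A.ScanState q s) :
    A.ReachInvariant (q.val, s) := by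
  refine ⟨fun q' hq => ?_, fun q' hq => ?_, fun hq => ?_, fun hq => ?_, fun hq => ?_⟩ <;>
    simp only at hq
  · rwa [← Fin.ext hq]
  all_goals omega

theorem reachInvariant_move {q : Fin A.numStates} {s : List Bool} (h : A.MoveState q s) :
    A.ReachInvariant (A.numStates + q.val, s) := by
  refine ⟨fun q' hq => ?_, fun q' hq => ?_, fun hq => ?_, fun hq => ?_, fun hq => ?_⟩ <;>
    simp only at hq
  · omega
  · rwa [← Fin.ext (show q.val = q'.val by omega)]
  all_goals omega

theorem tapeStep_transition {tp : List (TapeSymbol A.numLetters)}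
    {τ : PDATransition A.numStates A.numLetters A.numStack} (hτ : τ ∈ A.trans) {i j : ℕ}
    {γ : List (Fin A.numStack)} (hi : tp[i]? = some τ.read) (hj : (j : ℤ) = i + τ.move.toInt)
    (hl : j < tp.length) : A.TapeStep tp ⟨τ.src, i, τ.top :: γ⟩ ⟨τ.dst, j, τ.push ++ γ⟩ :=
  ⟨τ, hτ, γ, rfl, hi, rfl, rfl, rfl, hj, hl⟩

/-- The run leading here is valid for every next symbol, so the guess may be made afterwards: a
letter prolongs the known prefix, the right endmarker completes the tape. -/
theorem scanState_of_moveState {q : Fin A.numStates} {s : List Bool} (h : A.MoveState q s)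
    {a : TapeSymbol A.numLetters} (ha : a.code ≠ 0) :
    A.ScanState q (bitsOf A.width a.code ++ s) := by
  obtain ⟨S, xs, rfl, h⟩ := h
  refine ⟨S, a, .leftEnd :: xs.map .letter, ?_, rfl, by simpa using h a⟩
  rcases a with _ | _ | x
  · exact absurd rfl ha
  · exact .inr ⟨xs, rfl⟩
  · exact .inl ⟨xs ++ [x], by simp⟩

/-- That the word can be executed forces the top block to be the code of the symbol read and the
next block to be the stack symbol replaced, so the transition applies. -/
theorem reachInvariant_transRules {τ : PDATransition A.numStates A.numLetters A.numStack}
    (hτ : τ ∈ A.trans) {s s' : List Bool} (h : A.ScanState τ.src s)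
    (hs : parenRun (popWord A.width τ.read.code ++ (popWord A.width τ.top ++
      ((τ.push.map Fin.val).reverse.flatMap (pushWord A.width) ++
        if τ.move.code = 1 then pushWord A.width τ.read.code else []))) s = some s') :
    A.ReachInvariant (if τ.move.code = 1 then τ.dst else if τ.read.code = 1 then
      2 * A.numStates + 2 else A.numStates + τ.dst, s') := by
  obtain ⟨S, a, tp, htp, rfl, h⟩ := h
  rw [parenRun_append, Option.bind_eq_some_iff] at hs
  obtain ⟨s₁, h₁, hs⟩ := hs
  rw [parenRun_popWord] at h₁
  obtain ⟨ha, rfl⟩ := bitsOf_append_inj (A.code_lt_width _) (A.code_lt_width _) h₁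
  obtain rfl := TapeSymbol.code_injective ha
  rw [parenRun_append, Option.bind_eq_some_iff] at hs
  obtain ⟨s₂, h₂, hs⟩ := hs
  obtain ⟨γ, rfl, rfl⟩ := A.eq_cons_of_stackBits (parenRun_popWord.1 h₂)
  rw [parenRun_append, parenRun_flatMap_pushWord, Option.bind_some] at hs
  change parenRun _ (A.stackBits τ.push ++ A.stackBits γ) = _ at hs
  rw [← A.stackBits_append] at hs
  have hat : (tp ++ [τ.read])[tp.length]? = some τ.read := by simp
  rcases hm : τ.move with _ | _ | _
  · exact absurd hm (A.one_way τ hτ)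
  · rw [hm] at hs
    simp only [HeadMove.code, if_true] at hs ⊢
    rw [parenRun_pushWord, Option.some_inj] at hs
    subst hs
    refine A.reachInvariant_scan ⟨_, τ.read, tp, htp, rfl, h.tail ?_⟩
    exact A.tapeStep_transition hτ hat (by simp [hm, HeadMove.toInt]) (by simp)
  · rw [hm] at hs
    simp only [HeadMove.code, OfNat.ofNat_ne_one, if_false, parenRun_nil, Option.some_inj] at hs ⊢
    subst hs
    split_ifs with hr
    · refine ⟨fun q' hq => ?_, fun q' hq => ?_, fun hq => ?_, fun hq => ?_, fun hq => ?_⟩ <;>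
        simp only at hq <;> omega
    · refine A.reachInvariant_move ?_
      -- A complete tape ends with the right endmarker, which is not the symbol read here; so the
      -- tape can still be prolonged by any symbol.
      have htp' : ∃ xs : List (Fin A.numLetters), tp ++ [τ.read] = .leftEnd :: xs.map .letter := by
        refine htp.resolve_right ?_
        rintro ⟨xs, hxs⟩
        rw [TwoNPDA.tape, ← List.cons_append] at hxs
        have := (List.append_inj' hxs rfl).2
        simp only [List.cons.injEq, and_true] at this
        rw [this] at hr
        exact hr rfl
      obtain ⟨xs, hxs⟩ := htp'
      have hlen := congrArg List.length hxs
      simp only [List.length_append, List.length_cons, List.length_map, List.length_nil] at hlen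
      obtain hlen : tp.length = xs.length := by omega
      refine ⟨_, xs, rfl, fun b => .tail (b := ⟨τ.src, tp.length, τ.top :: γ⟩) ?_ ?_⟩
      · rw [← hxs]; exact A.reach_append [b] h
      · rw [← hxs]
        refine A.tapeStep_transition hτ ?_ (by simp [hm, HeadMove.toInt, hlen]) (by simp [hlen])
        rw [List.getElem?_append_left (by simp), hat]

theorem reachInvariant_step {c c' : ℕ × List Bool} (h : A.ReachInvariant c)
    (hc : RuleStep A.rules c c') : A.ReachInvariant c' := by
  obtain ⟨u, s⟩ := c
  obtain ⟨v, s'⟩ := c'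
  obtain ⟨r, hr, h₁, h₂, h₃⟩ := hc
  simp only at h₁ h₂ h₃
  subst h₁ h₂
  rcases A.mem_rules.1 hr with rfl | ⟨q, hq, hr⟩ | ⟨τ, hτ, hr⟩
  · obtain rfl : s = [] := h.source rfl
    simp only [TwoNPDA.startRule, parenRun_append, parenRun_pushWord, Option.bind_some,
      Option.some_inj] at h₃ ⊢
    subst h₃
    exact A.reachInvariant_scan ⟨[A.bottom], .leftEnd, [], .inl ⟨[], rfl⟩, rfl, .refl⟩
  · simp only [TwoNPDA.finalRules, List.mem_cons, List.not_mem_nil, or_false] at hr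
    rcases hr with rfl | rfl
    · rw [parenRun_pushWord, Option.some_inj] at h₃
      subst h₃
      exact A.reachInvariant_scan (A.scanState_of_moveState (a := .rightEnd) (h.move q rfl)
        (by simp [TapeSymbol.code]))
    · obtain ⟨S, a, tp, htp, hs, hrun⟩ := h.scan q rfl
      simp only at hs
      subst hs
      refine ⟨fun q' hq => ?_, fun q' hq => ?_, fun hq => ?_, fun _ hs' => ?_, fun hq => ?_⟩
      · simp only at hq; omega
      · simp only at hq; omega
      · simp only at hq; omega
      · simp only at hs'
        subst hs'
        rw [parenRun_append, Option.bind_eq_some_iff] at h₃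
        obtain ⟨s₁, h₁, h₂⟩ := h₃
        rw [parenRun_popWord] at h₁ h₂
        obtain ⟨ha, rfl⟩ := bitsOf_append_inj (A.code_lt_width _)
          (A.code_lt_width TapeSymbol.rightEnd) h₁
        obtain rfl := TapeSymbol.code_injective ha
        obtain ⟨γ, rfl, hγ⟩ := A.eq_cons_of_stackBits h₂
        -- The target is considered only with an empty stack, hence nothing lay below the
        -- end-of-stack symbol.
        obtain rfl : γ = [] := by
          rcases γ with _ | ⟨Z, γ⟩
          · rfl
          · have := congrArg List.length hγ
            have := A.width_pos
            simp [TwoNPDA.stackBits] at *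
            omega
        have htp' : ∃ xs : List (Fin A.numLetters), tp ++ [.rightEnd] = A.tape xs := by
          refine htp.resolve_left ?_
          rintro ⟨xs, hxs⟩
          have : TapeSymbol.rightEnd ∈ tp ++ [TapeSymbol.rightEnd (k := A.numLetters)] := by simp
          rw [hxs] at this
          simp at this
        obtain ⟨xs, hxs⟩ := htp'
        have hlen := congrArg List.length hxs
        rw [A.tape_length] at hlen
        simp only [List.length_append, List.length_singleton] at hlen
        obtain hlen : tp.length = xs.length + 1 := by omega
        rw [hxs, hlen] at hrun
        exact ⟨xs, q, hq, hrun⟩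
      · simp only at hq; omega
  · simp only [TwoNPDA.transRules, List.mem_cons, List.not_mem_nil, or_false] at hr
    rcases hr with rfl | rfl
    · exact A.reachInvariant_transRules hτ (h.scan τ.src rfl) h₃
    · have ha : τ.read.code ≠ 0 := fun ha => h.orphan (by simp [ha])
      rw [parenRun_pushWord, Option.some_inj] at h₃
      subst h₃
      refine A.reachInvariant_scan (A.scanState_of_moveState (h.move τ.src ?_) ha)
      simp [ha]

/-- The configuration is represented by a reachable vertex and stack. -/
def Represented (w : List (Fin A.numLetters)) (c : A.Config) : Prop :=
  (∃ a, (A.tape w)[c.pos]? = some a ∧ ReflTransGen (RuleStep A.rules) (2 * A.numStates, [])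
    (c.state.val, bitsOf A.width a.code ++ A.stackBits c.stack)) ∨
  -- Position `0` is excluded because the left endmarker cannot be guessed.
  (c.pos ≠ 0 ∧ c.pos < w.length + 2 ∧ ReflTransGen (RuleStep A.rules) (2 * A.numStates, [])
    (A.numStates + c.state.val, A.stackBits c.stack))

/-- If the scanned symbol has not been guessed yet, the transition about to be taken itself supplies
the rule that guesses it. Guessing is therefore deferred until a transition, or acceptance, needs
the symbol. -/
theorem represented_step {w : List (Fin A.numLetters)} {c c' : A.Config}
    (h : A.Represented w c) (hc : A.Step w c c') : A.Represented w c' := by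
  obtain ⟨q, i, S⟩ := c
  obtain ⟨q', j, S'⟩ := c'
  obtain ⟨τ, hτ, γ, rfl, hi, hS, rfl, rfl, hj, hl⟩ := hc
  simp only at hi hS hj hl
  subst hS
  have hr : ∀ r ∈ A.transRules τ, r ∈ A.rules := fun r hr => A.mem_rules.2 (.inr (.inr ⟨τ, hτ, hr⟩))
  have hscan : ReflTransGen (RuleStep A.rules) (2 * A.numStates, [])
      (τ.src.val, bitsOf A.width τ.read.code ++ A.stackBits (τ.top :: γ)) := by
    rcases h with ⟨a, ha, h⟩ | ⟨hi0, -, h⟩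
    · simp only at ha h
      rw [hi, Option.some_inj] at ha
      rwa [ha]
    · refine h.tail ⟨_, hr _ (List.mem_cons_of_mem _ (List.mem_singleton.2 rfl)), ?_, rfl,
        parenRun_pushWord _ _ _⟩
      simp only
      rw [if_neg]
      intro h0
      have : τ.read = .leftEnd := TapeSymbol.code_injective h0
      rw [this] at hi
      exact hi0 (A.eq_zero_of_tape_leftEnd hi)
  have hstep : ∀ s, parenRun (if τ.move.code = 1 then pushWord A.width τ.read.code else [])
      (A.stackBits (τ.push ++ γ)) = some s → ReflTransGen (RuleStep A.rules) (2 * A.numStates, [])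
        (if τ.move.code = 1 then τ.dst else if τ.read.code = 1 then 2 * A.numStates + 2
          else A.numStates + τ.dst, s) := by
    intro s hs
    refine hscan.tail ⟨_, hr _ (List.mem_cons_self ..), rfl, rfl, ?_⟩
    simp only
    rw [parenRun_append, parenRun_popWord.2 rfl, Option.bind_some, parenRun_append,
      A.stackBits_cons, parenRun_popWord.2 rfl, Option.bind_some, parenRun_append,
      parenRun_flatMap_pushWord, Option.bind_some]
    change parenRun _ (A.stackBits τ.push ++ A.stackBits γ) = _
    rw [← A.stackBits_append, hs]
  rcases hm : τ.move with _ | _ | _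
  · exact absurd hm (A.one_way τ hτ)
  · rw [hm] at hj hstep
    simp only [HeadMove.toInt, add_zero, Nat.cast_inj] at hj
    subst hj
    simp only [HeadMove.code, if_true] at hstep
    exact .inl ⟨_, hi, hstep _ (parenRun_pushWord _ _ _)⟩
  · rw [hm] at hj hstep
    simp only [HeadMove.toInt] at hj
    obtain rfl : j = i + 1 := by omega
    rw [A.tape_length] at hl
    -- The head remains on the tape after moving right, so it was not on the right endmarker and the
    -- path does not lead to the sink.
    have hne : τ.read.code ≠ 1 := by
      intro h1
      have : τ.read = .rightEnd := TapeSymbol.code_injective h1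
      rw [this] at hi
      have := A.eq_of_tape_rightEnd hi
      omega
    simp only [HeadMove.code, OfNat.ofNat_ne_one, if_false, hne, parenRun_nil] at hstep
    exact .inr ⟨by simp, hl, hstep _ rfl⟩

theorem reach_rules_iff : ReflTransGen (RuleStep A.rules) (2 * A.numStates, [])
    (2 * A.numStates + 1, []) ↔ ∃ w, A.Accepts w := by
  constructor
  · have key : ∀ c, ReflTransGen (RuleStep A.rules) (2 * A.numStates, []) c →
        A.ReachInvariant c := by
      intro c h
      induction h with
      | refl =>
        refine ⟨fun q' hq => ?_, fun q' hq => ?_, fun _ => rfl, fun hq => ?_, fun hq => ?_⟩ <;>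
          simp only at hq <;> omega
      | tail _ h ih => exact A.reachInvariant_step ih h
    exact fun h => (key _ h).target rfl rfl
  · rintro ⟨w, q, hq, h⟩
    have key : ∀ c, ReflTransGen (A.Step w) ⟨A.start, 0, [A.bottom]⟩ c → A.Represented w c := by
      intro c h
      induction h with
      | refl =>
        refine .inl ⟨.leftEnd, rfl, .single ⟨_, A.mem_rules.2 (.inl rfl), rfl, rfl, ?_⟩⟩
        simp [TwoNPDA.startRule, parenRun_append, parenRun_pushWord, TapeSymbol.code,
          TwoNPDA.stackBits]
      | tail _ h ih => exact A.represented_step ih h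
    have hf : ∀ r ∈ A.finalRules q, r ∈ A.rules := fun r hr =>
      A.mem_rules.2 (.inr (.inl ⟨q, hq, hr⟩))
    have hscan : ReflTransGen (RuleStep A.rules) (2 * A.numStates, [])
        (q.val, bitsOf A.width 1 ++ A.stackBits [A.bottom]) := by
      rcases key _ h with ⟨a, ha, h⟩ | ⟨-, -, h⟩
      · simp only at ha h
        rw [A.tape_getElem?_last, Option.some_inj] at ha
        rwa [← ha] at h
      · exact h.tail ⟨_, hf _ (List.mem_cons_self ..), rfl, rfl, parenRun_pushWord _ _ _⟩
    refine hscan.tail ⟨_, hf _ (List.mem_cons_of_mem _ (List.mem_singleton.2 rfl)), rfl, rfl, ?_⟩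
    simp only
    rw [parenRun_append, parenRun_popWord.2 rfl, Option.bind_some]
    exact parenRun_popWord.2 (by simp [TwoNPDA.stackBits])

theorem language_ne_zero_iff : ¬ A.language = 0 ↔ ∃ w, A.Accepts w := by
  constructor
  · intro h
    by_contra! hw
    exact h (Set.eq_empty_of_forall_notMem hw)
  · rintro ⟨w, hw⟩ h
    have : w ∈ (0 : Language (Fin A.numLetters)) := h ▸ hw
    exact this

end PDA

/-! ## Programs that draw paths

The path under construction ends in the vertex in register `31`, and register `32` holds the next new
vertex. Registers from `30` on are scratch registers. -/

namespace PathGraph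

open RamProg

/-- Constants that the programs below rely on; the numbers to be pushed and popped have `L` bits. -/
structure PathRegs (L : ℕ) (σ : RamState) : Prop where
  one : σ.reg 1 = 1
  two : σ.reg 2 = 2
  width : σ.reg 4 = L
  pow : σ.reg 6 = 2 ^ L
  zero : σ.reg 10 = 0

theorem PathRegs.of_frame {L : ℕ} {σ σ' : RamState} (h : PathRegs L σ)
    (hr : ∀ r, r < 15 → σ'.reg r = σ.reg r) : PathRegs L σ' :=
  ⟨by rw [hr _ (by omega), h.one], by rw [hr _ (by omega), h.two], by rw [hr _ (by omega), h.width],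
    by rw [hr _ (by omega), h.pow], by rw [hr _ (by omega), h.zero]⟩

/-- The path has been extended by edges labelled with the word; of the registers only those from `30`
to `m - 1` have been used. -/
structure Emits (m : ℕ) (w : List Paren) (σ σ' : RamState) : Prop where
  vertex : σ'.reg 31 = chainEnd (σ.reg 31) (σ.reg 32) w
  fresh : σ'.reg 32 = σ.reg 32 + w.length
  out : σ'.out = σ.out ++ (chain (σ.reg 31) (σ.reg 32) w).flatMap edgeOutput
  frame : ∀ r, r < 30 ∨ m ≤ r → σ'.reg r = σ.reg r
  mem : σ'.mem = σ.mem

theorem Emits.append {m : ℕ} {w w' : List Paren} {σ σ₁ σ₂ : RamState} (h : Emits m w σ σ₁)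
    (h' : Emits m w' σ₁ σ₂) : Emits m (w ++ w') σ σ₂ where
  vertex := by rw [h'.vertex, h.vertex, h.fresh, chainEnd_append]
  fresh := by rw [h'.fresh, h.fresh, List.length_append, add_assoc]
  out := by
    rw [h'.out, h.out, h.vertex, h.fresh, chain_append, List.flatMap_append, List.append_assoc]
  frame r hr := by rw [h'.frame r hr, h.frame r hr]
  mem := by rw [h'.mem, h.mem]

theorem Emits.mono {m m' : ℕ} {w : List Paren} {σ σ' : RamState} (h : Emits m w σ σ')
    (hm : m ≤ m') : Emits m' w σ σ' :=
  { h with frame := fun r hr => h.frame r (by omega) }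

theorem Emits.of_frame {m : ℕ} {σ σ' : RamState} (hr : ∀ r, r < 30 ∨ r = 31 ∨ r = 32 ∨ m ≤ r →
    σ'.reg r = σ.reg r) (ho : σ'.out = σ.out) (hm : σ'.mem = σ.mem) : Emits m [] σ σ' where
  vertex := hr _ (by omega)
  fresh := hr _ (by omega)
  out := by simp [ho, chain]
  frame r h := hr r (by omega)
  mem := hm

theorem Emits.pathRegs {L m : ℕ} {w : List Paren} {σ σ' : RamState} (h : Emits m w σ σ')
    (R : PathRegs L σ) : PathRegs L σ' :=
  R.of_frame fun r hr => h.frame r (by omega)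

/-- Extend the path by an edge whose label is in register `33`. -/
def edgeStep : RamProg :=
  block [.write 31, .write 33, .write 32, .op .add 31 32 10, .op .add 32 32 1]

theorem runs_edgeStep {W L : ℕ} {σ : RamState} (R : PathRegs L σ) {l : Paren}
    (hl : σ.reg 33 = l.code) (hf : σ.reg 32 + 1 < W) : Runs W edgeStep σ 6 fun σ' =>
      Emits 33 [l] σ σ' ∧ ∀ r, r ≠ 31 → r ≠ 32 → σ'.reg r = σ.reg r := by
  simp only [edgeStep, Runs.write_iff, Runs.op_iff, Runs.block_nil_iff, RamOp.eval,
    RamState.setReg_reg, RamState.emit_reg, R.one, R.zero, hl]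
  norm_num only [if_true, if_false, R.one, true_and]
  refine ⟨by omega, by omega, ⟨?_, ?_, ?_, ?_, ?_⟩, ?_⟩
  · simp [chainEnd]
  · simp
  · simp [chain, edgeOutput]
  · intro r hr
    simp [show r ≠ 31 by omega, show r ≠ 32 by omega]
  · simp
  · intro r h₁ h₂
    simp [h₁, h₂]

/-- Extend the path by edges that read the content of register `a` off the stack. -/
def popNumber (a : ℕ) : RamProg :=
  block [.op .add 30 a 10, .op .add 34 4 10,
    .loop 34 (block [.op .mod 33 30 2, .op .mul 33 33 2, .op .add 33 33 1, edgeStep, .op .div 30 30 2,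
      .op .sub 34 34 1])]

/-- Extend the path by edges that put the content of register `a` on the stack. -/
def pushNumber (a : ℕ) : RamProg :=
  block [.op .add 30 a 10, .op .add 34 4 10,
    .loop 34 (block [.op .mul 30 30 2, .op .div 33 30 6, .op .mod 30 30 6, .op .mul 33 33 2, edgeStep,
      .op .sub 34 34 1])]

theorem code_closing (b : Bool) : (Paren.closing b).code = (if b then 1 else 0) * 2 + 1 := by
  cases b <;> rfl

theorem code_opening (b : Bool) : (Paren.opening b).code = (if b then 1 else 0) * 2 := by
  cases b <;> rfl

/-- The lowest bit is on top of the stack, so halving produces the labels in the right order. -/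
theorem runs_popNumber {W L a : ℕ} {σ : RamState} (R : PathRegs L σ)
    (hx : σ.reg a < 2 ^ L) (hW : 2 ^ (L + 1) + 3 < W) (hf : σ.reg 32 + L < W) :
    Runs W (popNumber a) σ (15 * (L + 1)) (Emits 35 (popWord L (σ.reg a)) σ) := by
  have hL := Nat.lt_two_pow_self (n := L)
  rw [pow_succ] at hW
  simp only [popNumber, Runs.op_iff, RamOp.eval, RamState.setReg_reg, R.zero, R.width, add_zero]
  norm_num only [if_true, if_false, R.width, R.zero, add_zero]
  refine ⟨by omega, by omega, by omega, by omega, ?_⟩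
  refine Runs.block_cons (Runs.loop_nat (F := 12) (I := fun n σ' => n ≤ L ∧ σ'.reg 34 = n ∧
    σ'.reg 30 < 2 ^ L ∧ ∃ w, Emits 35 w σ σ' ∧ w ++ popWord n (σ'.reg 30) = popWord L (σ.reg a))
    ?_ ?_ L _ ?_) (by omega) ?_
  · exact fun σ' h => h.2.1
  · rintro n σ' ⟨hn, h34, h30, w, hw, hwn⟩
    have R' := hw.pathRegs R
    have hlen := congrArg List.length hwn
    simp only [List.length_append, length_popWord] at hlen
    refine ⟨by omega, ?_⟩
    simp only [Runs.op_iff, RamOp.eval, RamState.setReg_reg]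
    norm_num only [if_true, if_false, R'.one, R'.two, true_and]
    refine ⟨by omega, by omega, by omega, ?_⟩
    refine Runs.block_cons (runs_edgeStep (L := L) (l := Paren.closing (decide (σ'.reg 30 % 2 = 1)))
      (R'.of_frame fun r hr => ?_) ?_ ?_) (by omega) ?_
    · simp [show r ≠ 33 by omega]
    · rw [code_closing]
      rcases Nat.mod_two_eq_zero_or_one (σ'.reg 30) with h | h <;> simp [h]
    · have := hw.fresh
      simp; omega
    · rintro σ₁ ⟨he, hr⟩
      have h30' := hr 30 (by omega) (by omega)
      have h34' := hr 34 (by omega) (by omega)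
      have h2' := hr 2 (by omega) (by omega)
      have h1' := hr 1 (by omega) (by omega)
      simp only [RamState.setReg_reg] at h30' h34' h2' h1'
      norm_num only [if_true, if_false] at h30' h34' h2' h1'
      simp only [Runs.op_iff, Runs.block_nil_iff, RamOp.eval, RamState.setReg_reg]
      norm_num only [if_true, if_false, h30', h34', h2', h1', R'.one, R'.two, true_and]
      refine ⟨by omega, by omega, by omega, by omega, by omega,
        w ++ [Paren.closing (decide (σ'.reg 30 % 2 = 1))], hw.append ?_, ?_⟩
      · have e₁ : Emits 35 [] σ' (((σ'.setReg 33 (σ'.reg 30 % 2)).setReg 33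
            (σ'.reg 30 % 2 * 2)).setReg 33 (σ'.reg 30 % 2 * 2 + 1)) :=
          .of_frame (fun r hr => by simp [show r ≠ 33 by omega]) rfl rfl
        have e₂ := (e₁.append (he.mono (by omega))).append (Emits.of_frame (m := 35)
          (σ' := (σ₁.setReg 30 (σ'.reg 30 / 2)).setReg 34 (σ'.reg 34 - 1))
          (fun r hr => by simp [show r ≠ 30 by omega, show r ≠ 34 by omega]) rfl rfl)
        simpa [h34] using e₂
      · rw [← hwn]
        simp [popWord, bitsOf]
  · refine ⟨le_rfl, by simp, by simpa using hx, [], .of_frame (fun r hr => ?_) rfl rfl, by simp⟩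
    simp [show r ≠ 30 by omega, show r ≠ 34 by omega]
  · rintro σ' ⟨-, -, -, w, hw, hwn⟩
    rw [Runs.block_nil_iff]
    refine ⟨by omega, ?_⟩
    rw [← hwn]
    simpa [popWord, bitsOf] using hw

/-- The highest bit comes first. With `n` bits left, register `30` holds them left-aligned, as `z *
2 ^ (L - n)`. Doubling moves the next bit to the place of `2 ^ L`, where division reads it and the
remainder clears it; the intermediate value may approach `2 ^ (L + 1)`, whence `hW`. -/
theorem runs_pushNumber {W L a : ℕ} {σ : RamState} (R : PathRegs L σ)
    (hx : σ.reg a < 2 ^ L) (hW : 2 ^ (L + 1) + 3 < W) (hf : σ.reg 32 + L < W) :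
    Runs W (pushNumber a) σ (15 * (L + 1)) (Emits 35 (pushWord L (σ.reg a)) σ) := by
  have hL := Nat.lt_two_pow_self (n := L)
  rw [pow_succ] at hW
  simp only [pushNumber, Runs.op_iff, RamOp.eval, RamState.setReg_reg, R.zero, R.width, add_zero]
  norm_num only [if_true, if_false, R.width, R.zero, add_zero]
  refine ⟨by omega, by omega, by omega, by omega, ?_⟩
  refine Runs.block_cons (Runs.loop_nat (F := 12) (I := fun n σ' => n ≤ L ∧ σ'.reg 34 = n ∧
    ∃ w z, z < 2 ^ n ∧ σ'.reg 30 = z * 2 ^ (L - n) ∧ Emits 35 w σ σ' ∧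
      w ++ pushWord n z = pushWord L (σ.reg a)) ?_ ?_ L _ ?_) (by omega) ?_
  · exact fun σ' h => h.2.1
  · rintro n σ' ⟨hn, h34, w, z, hz, h30, hw, hwn⟩
    have R' := hw.pathRegs R
    have hlen := congrArg List.length hwn
    simp only [List.length_append, length_pushWord] at hlen
    have hpn := Nat.two_pow_pos n
    have hpL := Nat.two_pow_pos L
    have hdm := Nat.div_add_mod' z (2 ^ n)
    have hzm := Nat.mod_lt z hpn
    have hb : z / 2 ^ n < 2 := by
      rw [Nat.div_lt_iff_lt_mul hpn]
      rw [pow_succ] at hz; omega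
    have hsplit : 2 ^ n * 2 ^ (L - n) = 2 ^ L := by rw [← pow_add]; congr 1; omega
    have hdouble : z * 2 ^ (L - (n + 1)) * 2 = z / 2 ^ n * 2 ^ L + z % 2 ^ n * 2 ^ (L - n) := by
      have : 2 ^ (L - n) = 2 ^ (L - (n + 1)) * 2 := by rw [← pow_succ]; congr 1; omega
      rw [mul_assoc, ← this, ← hsplit]
      conv_lhs => rw [← hdm]
      ring
    have hlow : z % 2 ^ n * 2 ^ (L - n) < 2 ^ L := by
      rw [← hsplit]; exact (Nat.mul_lt_mul_right (Nat.two_pow_pos _)).2 hzm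
    have hhigh : z / 2 ^ n * 2 ^ L ≤ 1 * 2 ^ L := Nat.mul_le_mul_right _ (by omega)
    have hq : (z / 2 ^ n * 2 ^ L + z % 2 ^ n * 2 ^ (L - n)) / 2 ^ L = z / 2 ^ n := by
      rw [Nat.add_comm, Nat.add_mul_div_right _ _ hpL, Nat.div_eq_of_lt hlow, zero_add]
    have hm : (z / 2 ^ n * 2 ^ L + z % 2 ^ n * 2 ^ (L - n)) % 2 ^ L = z % 2 ^ n * 2 ^ (L - n) := by
      rw [Nat.add_comm, Nat.add_mul_mod_self_right, Nat.mod_eq_of_lt hlow]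
    refine ⟨by omega, ?_⟩
    simp only [Runs.op_iff, RamOp.eval, RamState.setReg_reg]
    norm_num only [if_true, if_false, R'.one, R'.two, R'.pow, h30, hdouble, hq, hm, true_and]
    refine ⟨by omega, by omega, by omega, by omega, ?_⟩
    refine Runs.block_cons (runs_edgeStep (L := L) (l := Paren.opening (decide (z / 2 ^ n % 2 = 1)))
      (R'.of_frame fun r hr => ?_) ?_ ?_) (by omega) ?_
    · simp [show r ≠ 33 by omega, show r ≠ 30 by omega]
    · rw [code_opening]
      have := Nat.le_one_iff_eq_zero_or_eq_one.1 (Nat.lt_succ_iff.1 hb)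
      rcases this with h | h <;> rw [h] <;> simp
    · have := hw.fresh
      simp; omega
    · rintro σ₁ ⟨he, hr⟩
      have h30' := hr 30 (by omega) (by omega)
      have h34' := hr 34 (by omega) (by omega)
      have h1' := hr 1 (by omega) (by omega)
      simp only [RamState.setReg_reg] at h30' h34' h1'
      norm_num only [if_true, if_false] at h30' h34' h1'
      simp only [Runs.op_iff, Runs.block_nil_iff, RamOp.eval, RamState.setReg_reg]
      norm_num only [if_true, if_false, h34', h30', h1', R'.one, true_and]
      have e₁ : ∀ a b c d, Emits 35 [] σ'
          ((((σ'.setReg 30 a).setReg 33 b).setReg 30 c).setReg 33 d) := fun a b c d =>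
        .of_frame (fun r hr => by simp [show r ≠ 30 by omega, show r ≠ 33 by omega]) rfl rfl
      have e := ((e₁ _ _ _ _).append (he.mono (show 33 ≤ 35 by omega)))
      have e₂ : Emits 35 [] σ₁ (σ₁.setReg 34 (σ'.reg 34 - 1)) :=
        .of_frame (fun r hr => by simp [show r ≠ 34 by omega]) rfl rfl
      refine ⟨by omega, by omega, by omega,
        w ++ [Paren.opening (decide (z / 2 ^ n % 2 = 1))], z % 2 ^ n, hzm, rfl,
        hw.append (by simpa only [List.nil_append, List.append_nil] using e.append e₂), ?_⟩
      rw [← hwn, pushWord, pushWord, bitsOf_succ']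
      simp
  · refine ⟨le_rfl, by simp, [], σ.reg a, hx, by simp, .of_frame (fun r hr => ?_) rfl rfl, by simp⟩
    simp [show r ≠ 30 by omega, show r ≠ 34 by omega]
  · rintro σ' ⟨-, -, w, z, -, -, hw, hwn⟩
    rw [Runs.block_nil_iff]
    refine ⟨by omega, ?_⟩
    rw [← hwn]
    simpa [pushWord, bitsOf] using hw

/-- After the header `o`, the paths for the rules have been written. -/
structure Drawn (o : List ℕ) (f : ℕ) (rs : List Rule) (σ : RamState) : Prop where
  out : σ.out = o ++ (graph f rs).flatMap edgeOutput
  fresh : σ.reg 32 = f + numNew rs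

theorem Drawn.of_frame {o : List ℕ} {f : ℕ} {rs : List Rule} {σ σ' : RamState}
    (h : Drawn o f rs σ) (ho : σ'.out = σ.out) (hr : σ'.reg 32 = σ.reg 32) : Drawn o f rs σ' :=
  ⟨by rw [ho, h.out], by rw [hr, h.fresh]⟩

/-- Draw the path from the vertex in register `a` to the vertex in register `b` along the word for
which `p` is the program. -/
def drawPath (a : ℕ) (p : RamProg) (b : ℕ) : RamProg :=
  block [.op .add 31 a 10, p, .op .add 33 10 10, edgeStep, .write 31, .write 1, .write b]

theorem numNew_concat (rs : List Rule) (r : Rule) :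
    numNew (rs ++ [r]) = numNew rs + (r.word.length + 1) := by
  rw [numNew_append]; simp [numNew]

theorem runs_drawPath {W L T f a b : ℕ} {o : List ℕ} {rs : List Rule} {w : List Paren} {p : RamProg}
    {σ : RamState} (R : PathRegs L σ) (hD : Drawn o f rs σ) (hb : b < 30)
    (ha : σ.reg a < W) (hW : f + numNew rs + w.length + 1 < W)
    (hp : ∀ σ₁ : RamState, (∀ r, r ≠ 31 → σ₁.reg r = σ.reg r) → σ₁.mem = σ.mem →
      Runs W p σ₁ T (Emits 40 w σ₁)) :
    Runs W (drawPath a p b) σ (T + 12) fun σ' =>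
      Drawn o f (rs ++ [⟨σ.reg a, w, σ.reg b⟩]) σ' ∧ (∀ r < 30, σ'.reg r = σ.reg r) ∧
      σ'.mem = σ.mem := by
  simp only [drawPath, Runs.op_iff, RamOp.eval, R.zero, add_zero]
  refine ⟨ha, by omega, ?_⟩
  have hr₁ : ∀ r, r ≠ 31 → (σ.setReg 31 (σ.reg a)).reg r = σ.reg r := fun r hr => by simp [hr]
  refine Runs.block_cons (hp _ hr₁ rfl) (by omega) fun σ₂ h₂ => ?_
  have R₁ : PathRegs L (σ.setReg 31 (σ.reg a)) := R.of_frame fun r hr => hr₁ r (by omega)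
  have R₂ := h₂.pathRegs R₁
  have hf := h₂.fresh
  rw [hr₁ 32 (by omega), hD.fresh] at hf
  simp only [Runs.op_iff, RamOp.eval, R₂.zero, add_zero]
  refine ⟨by omega, by omega, ?_⟩
  refine Runs.block_cons (runs_edgeStep (L := L) (l := .roundOpen)
    (R₂.of_frame fun r hr => by simp [show r ≠ 33 by omega]) (by simp [Paren.code])
    (by simp; omega)) (by omega) ?_
  rintro σ₃ ⟨h₃, hr₃⟩
  have h₁₃ : Emits 40 (w ++ [.roundOpen]) (σ.setReg 31 (σ.reg a)) σ₃ := by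
    refine h₂.append (Emits.append (w := []) (σ₁ := σ₂.setReg 33 0) (.of_frame ?_ rfl rfl)
      (h₃.mono (by omega)))
    intro r hr
    simp [show r ≠ 33 by omega]
  have hv := h₁₃.vertex
  rw [chainEnd_concat, hr₁ 32 (by omega)] at hv
  have hframe : ∀ r < 30, σ₃.reg r = σ.reg r := fun r hr => by
    rw [h₁₃.frame r (.inl hr), hr₁ r (by omega)]
  simp only [Runs.write_iff, Runs.block_nil_iff, RamState.emit_reg]
  refine ⟨by omega, by omega, by omega, by omega, ⟨?_, ?_⟩, hframe, h₁₃.mem⟩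
  · simp only [RamState.emit_out, h₁₃.out, RamState.setReg_out, hD.out, hv, hframe 1 (by omega),
      hframe b hb, R.one, hr₁ 32 (by omega)]
    simp [graph_append, graph, rulePath, ← hD.fresh, edgeOutput, Paren.code]
  · have := h₁₃.fresh
    rw [hr₁ 32 (by omega), hD.fresh] at this
    rw [numNew_concat]
    simp only [RamState.emit_reg, this, List.length_append, List.length_singleton]
    omega

end PathGraph

/-! ## The program for the graph of a pushdown automaton -/

namespace RamProg

/-- If register `c` is nonzero, copy register `x` to register `r`. -/
def select (r c x : ℕ) : RamProg := .ite c (block [.op .add r x 10]) (block [])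

theorem Runs.select_cons {W T r c x : ℕ} {σ : RamState} {ps : List RamProg} {Q : RamState → Prop}
    (h0 : σ.reg 10 = 0) (hx : σ.reg x < W) (hT : 4 ≤ T)
    (h : Runs W (block ps) (σ.setReg r (if σ.reg c = 0 then σ.reg r else σ.reg x)) (T - 4) Q) :
    Runs W (block (select r c x :: ps)) σ T Q := by
  refine Runs.block_cons (T₁ := 4) (Q₁ := fun σ' => σ' = σ.setReg r
    (if σ.reg c = 0 then σ.reg r else σ.reg x)) ((Runs.ite (T := 3) ?_).mono (by omega)
      fun _ h => h) hT ?_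
  · by_cases hc : σ.reg c = 0
    · rw [if_neg (by simpa using hc), Runs.block_nil_iff, if_pos hc]
      refine ⟨by omega, ?_⟩
      simp [RamState.setReg]
    · rw [if_pos hc, if_neg hc, Runs.op_iff, Runs.block_nil_iff]
      simp only [RamOp.eval, h0, add_zero]
      exact ⟨hx, by omega, by omega, trivial⟩
  · rintro _ rfl
    exact h

end RamProg

namespace PathGraph

open RamProg

theorem emits_nil {W T : ℕ} {σ : RamState} (hT : 1 ≤ T) :
    Runs W (block []) σ T (Emits 40 [] σ) :=
  Runs.block_nil_iff.2 ⟨hT, .of_frame (fun _ _ => rfl) rfl rfl⟩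

theorem emits_cons {W m T₁ T₂ T : ℕ} {w w' : List Paren} {p : RamProg} {ps : List RamProg}
    {σ : RamState} (h₁ : Runs W p σ T₁ (Emits m w σ)) (hm : m ≤ 40) (hT : T₁ + T₂ ≤ T)
    (h₂ : ∀ σ₁, Emits 40 w σ σ₁ → Runs W (block ps) σ₁ T₂ (Emits 40 w' σ₁)) :
    Runs W (block (p :: ps)) σ T (Emits 40 (w ++ w') σ) :=
  Runs.block_cons h₁ (by omega) fun σ₁ hσ => (h₂ σ₁ (hσ.mono hm)).mono (by omega)
    fun _ h => (hσ.mono hm).append h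

/-- Extend the path by edges that put as many numbers as register `22` says on the stack; they end
before the address in register `15`, and the last one is taken first. -/
def pushNumbers : RamProg :=
  block [.op .add 36 22 10, .op .add 37 15 10,
    .loop 36 (block [.op .sub 37 37 1, .load 38 0 37, pushNumber 38, .op .sub 36 36 1])]

/-- The input lists the pushed word with its top first, whereas the top has to be pushed last, so
the address runs backwards. Accordingly the loop is over `l.reverse`, and the items left are always
the reversal of a prefix of `l`. -/
theorem runs_pushNumbers {W L b : ℕ} {l : List ℕ} {σ : RamState} (R : PathRegs L σ)
    (h22 : σ.reg 22 = l.length) (h15 : σ.reg 15 = b + l.length)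
    (hm : ∀ j < l.length, σ.mem 0 (b + j) = l.getD j 0) (hl : ∀ x ∈ l, x < 2 ^ L)
    (hW : 2 ^ (L + 1) + 3 < W) (hb : b + l.length < W)
    (hf : σ.reg 32 + l.length * L + 1 < W) :
    Runs W pushNumbers σ (20 * (l.length + 1) * (L + 1))
      (Emits 40 (l.reverse.flatMap (pushWord L)) σ) := by
  simp only [pushNumbers, Runs.op_iff, RamOp.eval, RamState.setReg_reg, R.zero, h22, h15, add_zero]
  norm_num only [if_true, if_false, h15, R.zero, add_zero]
  have hT : 20 * (l.length + 1) * (L + 1) =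
      20 * (l.length * (L + 1)) + 20 * (L + 1) := by ring
  have hT' : l.length * (15 * (L + 1) + 5) = 15 * (l.length * (L + 1)) + 5 * l.length := by ring
  have hT'' : l.length ≤ l.length * (L + 1) := Nat.le_mul_of_pos_right _ (Nat.succ_pos L)
  refine ⟨by omega, by omega, by omega, by omega, ?_⟩
  refine Runs.block_cons (T₁ := l.length * (15 * (L + 1) + 5) + 1) ((Runs.loop_list
    (F := fun _ => 15 * (L + 1) + 4) (I := fun l' σ' =>
      σ'.reg 36 = l'.length ∧ σ'.reg 37 = b + l'.length ∧ (∃ d, l = l'.reverse ++ d) ∧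
      ∃ w, Emits 40 w σ σ' ∧ w ++ l'.flatMap (pushWord L) = l.reverse.flatMap (pushWord L))
    ?_ ?_ l.reverse _ ?_).mono ?_ fun _ h => h) ?_ ?_
  · exact fun σ' h => h.1
  · rintro x l' σ' ⟨h36, h37, ⟨d, hd⟩, w, hw, hwl⟩
    have R' := hw.pathRegs R
    have hlen := congrArg List.length hd
    have hlen' := congrArg List.length hwl
    simp only [List.length_append, List.length_reverse, List.length_cons, List.length_flatMap,
      length_pushWord, List.map_const', List.sum_replicate, smul_eq_mul] at hlen hlen' h36 h37
    have hx : l.getD l'.length 0 = x := by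
      rw [hd]; simp
    have hxl : x < 2 ^ L := hl x (by rw [hd]; simp)
    have hmx : σ'.mem 0 (b + l'.length) = x := by rw [hw.mem, hm _ (by omega), hx]
    have hxW : x < W := by rw [pow_succ] at hW; omega
    refine ⟨by omega, ?_⟩
    simp only [Runs.op_iff, Runs.load_iff, RamOp.eval, RamState.setReg_reg, RamState.setReg_mem]
    have hsub : b + (l'.length + 1) - 1 = b + l'.length := by omega
    norm_num only [if_true, if_false, R'.one, h37, hsub, hmx]
    refine ⟨by omega, by omega, hxW, by omega, ?_⟩
    have hreg : ∀ r, r ≠ 37 → r ≠ 38 →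
        ((σ'.setReg 37 (b + l'.length)).setReg 38 x).reg r = σ'.reg r :=
      fun r h₁ h₂ => by simp [h₁, h₂]
    refine Runs.block_cons (runs_pushNumber (L := L)
      (R'.of_frame fun r hr => hreg r (by omega) (by omega)) (by simpa using hxl) hW ?_) (by omega) ?_
    · rw [hreg _ (by omega) (by omega), hw.fresh]
      have : (l'.length + 1) * L = l'.length * L + L := by ring
      omega
    · intro σ₁ he
      have h36' := he.frame 36 (by omega)
      have h37' := he.frame 37 (by omega)
      have h1' := he.frame 1 (by omega)
      rw [hreg _ (by omega) (by omega)] at h36' h1'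
      simp only [Runs.op_iff, Runs.block_nil_iff, RamOp.eval, RamState.setReg_reg]
      norm_num only [if_true, if_false, h36', h1', R'.one, h36, h37']
      refine ⟨by omega, by omega, by omega, by omega, by simp, ⟨x :: d, by simp [hd]⟩,
        w ++ pushWord L x, hw.append ?_, by rw [← hwl]; simp⟩
      have e := ((Emits.of_frame (m := 40) (σ := σ') (fun r hr => hreg r (by omega) (by omega)) rfl
        rfl).append (he.mono (by omega))).append (Emits.of_frame (m := 40)
          (σ' := σ₁.setReg 36 (l'.length + 1 - 1))
          (fun r hr => by simp [show r ≠ 36 by omega]) rfl rfl)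
      simpa using e
  · refine ⟨by simp, by simp, ⟨[], by simp⟩, [], .of_frame (fun r hr => ?_) rfl rfl, rfl⟩
    simp [show r ≠ 36 by omega, show r ≠ 37 by omega]
  · simp
  · omega
  · rintro σ' ⟨-, -, -, w, hw, hwl⟩
    rw [Runs.block_nil_iff]
    refine ⟨by omega, ?_⟩
    rw [← hwl]
    simpa using hw

end PathGraph

/-! ### Size of the graph -/

namespace PDA

open RamProg PathGraph

/-- The registers that stay the same while the edges are written. -/
structure GraphRegs (A : PDA) (σ : RamState) : Prop where
  path : PathRegs A.width σ
  length : σ.reg 0 = A.encode.length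
  states : σ.reg 3 = A.numStates
  bottom : σ.reg 5 = A.bottom
  source : σ.reg 7 = 2 * A.numStates
  target : σ.reg 8 = 2 * A.numStates + 1
  sink : σ.reg 9 = 2 * A.numStates + 2
  orphan : σ.reg 11 = 2 * A.numStates + 3
  start : σ.reg 13 = A.start
  offset : σ.reg 14 = A.numStates + (A.numLetters + 2) + A.numStack + 5
  mem : σ.mem 0 = fun i => A.encode.getD i 0

variable {A : PDA}

theorem GraphRegs.of_frame {σ σ' : RamState} (h : A.GraphRegs σ)
    (hr : ∀ r < 15, σ'.reg r = σ.reg r) (hm : σ'.mem = σ.mem) : A.GraphRegs σ' where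
  path := h.path.of_frame hr
  length := by rw [hr _ (by omega), h.length]
  states := by rw [hr _ (by omega), h.states]
  bottom := by rw [hr _ (by omega), h.bottom]
  source := by rw [hr _ (by omega), h.source]
  target := by rw [hr _ (by omega), h.target]
  sink := by rw [hr _ (by omega), h.sink]
  orphan := by rw [hr _ (by omega), h.orphan]
  start := by rw [hr _ (by omega), h.start]
  offset := by rw [hr _ (by omega), h.offset]
  mem := by rw [hm, h.mem]

variable (A)

/-- The number of vertices of the graph; not all of them need to have edges. -/
def vertexBound : ℕ := 3 * ((A.width + 1) * A.encode.length) + (2 * A.numStates + 4)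

theorem length_encode : A.encode.length = A.numStates + (A.numLetters + 2) + A.numStack + 5 +
    (A.trans.map fun τ => τ.push.length + 6).sum := by
  simp only [TwoNPDA.encode, List.length_append, List.length_cons, List.length_nil,
    List.length_ofFn, List.length_range, List.length_flatMap, List.length_map]
  have : (fun τ : PDATransition A.numStates A.numLetters A.numStack =>
    0 + 1 + 1 + 1 + 1 + 1 + 1 + τ.push.length) = fun τ => τ.push.length + 6 := by
    funext τ; omega
  rw [this]; omega

theorem length_encode_le_vertexBound : A.encode.length + 4 ≤ A.vertexBound := by
  have := Nat.le_mul_of_pos_left A.encode.length (Nat.succ_pos A.width)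
  rw [vertexBound]
  rw [Nat.succ_eq_add_one] at this
  omega

theorem numNew_finalRules (q : ℕ) : numNew (A.finalRules q) = 3 * A.width + 2 := by
  simp [numNew, TwoNPDA.finalRules]; omega

theorem numNew_transRules_le (τ : PDATransition A.numStates A.numLetters A.numStack) :
    numNew (A.transRules τ) ≤ (τ.push.length + 4) * (A.width + 1) := by
  simp only [numNew, TwoNPDA.transRules, List.map_cons, List.map_nil, List.sum_cons, List.sum_nil,
    List.length_append, length_popWord, length_pushWord, List.length_flatMap, List.map_const',
    List.length_reverse, List.length_map, List.sum_replicate, smul_eq_mul]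
  have : (τ.push.length + 4) * (A.width + 1) =
    τ.push.length * A.width + τ.push.length + 4 * A.width + 4 := by ring
  split_ifs <;> simp <;> omega

/-- The number of vertices is written before any path is drawn, so it has to be bounded in terms of
the input length. New vertices are charged to entries, at most `3 * (A.width + 1)` each: the mark of
a state pays for its final rules, the `τ.push.length + 6` entries of a transition for its two rules,
and the first entries for the start rule. -/
theorem numNew_rules_le : 2 * A.numStates + 4 + numNew A.rules ≤ A.vertexBound := by
  have h₁ : ∀ l : List (Fin A.numStates), numNew (l.flatMap fun q =>
      if q ∈ A.final then A.finalRules q else []) ≤ l.length * (3 * (A.width + 1)) := by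
    intro l
    induction l with
    | nil => simp [numNew]
    | cons q l ih =>
      rw [List.flatMap_cons, numNew_append, List.length_cons, add_mul, one_mul]
      have : numNew (if q ∈ A.final then A.finalRules q else []) ≤ 3 * (A.width + 1) := by
        split_ifs
        · rw [numNew_finalRules]; omega
        · simp [numNew]
      omega
  have h₂ : ∀ l : List (PDATransition A.numStates A.numLetters A.numStack),
      numNew (l.flatMap A.transRules) ≤ (l.map fun τ => τ.push.length + 6).sum * (A.width + 1) := by
    intro l
    induction l with
    | nil => simp [numNew]
    | cons τ l ih =>
      rw [List.flatMap_cons, numNew_append, List.map_cons, List.sum_cons, add_mul]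
      have := A.numNew_transRules_le τ
      have : (τ.push.length + 4) * (A.width + 1) ≤ (τ.push.length + 6) * (A.width + 1) :=
        Nat.mul_le_mul_right _ (by omega)
      omega
  have h₁ := h₁ (List.finRange A.numStates)
  have h₂ := h₂ A.trans
  rw [List.length_finRange] at h₁
  rw [TwoNPDA.rules, ← List.singleton_append, numNew_append, numNew_append, vertexBound, length_encode]
  have h₃ : numNew [A.startRule] = 2 * A.width + 1 := by
    simp [numNew, TwoNPDA.startRule]; omega
  generalize (A.trans.map fun τ => τ.push.length + 6).sum = t at *
  have h₄ : (A.width + 1) * (A.numStates + (A.numLetters + 2) + A.numStack + 5 + t) =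
    A.numStates * (A.width + 1) + (A.numLetters + 2 + A.numStack) * (A.width + 1) +
      5 * (A.width + 1) + t * (A.width + 1) := by ring
  have h₅ : A.numStates * (3 * (A.width + 1)) = 3 * (A.numStates * (A.width + 1)) := by ring
  omega

end PDA

/-! ### Drawing the paths of a transition -/

namespace PDA

open RamProg PathGraph

/-- Load the next transition into the registers from `16` on; register `15` then holds the address
after it. -/
def loadTransition : RamProg :=
  block [.load 16 0 15, .op .add 15 15 1, .load 18 0 15, .op .add 15 15 1, .load 19 0 15,
    .op .add 15 15 1, .load 20 0 15, .op .add 15 15 1, .load 21 0 15, .op .add 15 15 1,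
    .load 22 0 15, .op .add 15 15 1, .op .add 15 15 22]

/-- Compute the ends of the paths for a transition in the registers `17` and `24`, and in register
`25` whether the head stays. -/
def transitionEnds : RamProg :=
  -- Later selections override earlier ones, so the test whether the head stays comes last. Its
  -- result remains in register `25` for the construction of the word.
  block [.op .add 17 3 16, .op .eq 25 18 10, select 17 25 11, .op .add 24 3 20, .op .eq 25 18 1,
    select 24 25 9, .op .eq 25 21 1, select 24 25 20]

def transitionWord : RamProg :=
  block [popNumber 18, popNumber 19, pushNumbers, .ite 25 (pushNumber 18) (block [])]

def drawTransition : RamProg :=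
  block [loadTransition, transitionEnds, drawPath 16 transitionWord 24,
    drawPath 17 (pushNumber 18) 16, .op .sub 26 0 15]

variable {A : PDA}

/-- The transition has been loaded. -/
structure Loaded (τ : PDATransition A.numStates A.numLetters A.numStack) (σ : RamState) : Prop where
  src : σ.reg 16 = τ.src
  read : σ.reg 18 = τ.read.code
  top : σ.reg 19 = τ.top
  dst : σ.reg 20 = τ.dst
  move : σ.reg 21 = τ.move.code
  count : σ.reg 22 = τ.push.length

theorem getD_encode {pre l : List ℕ} (h : A.encode = pre ++ l) (j : ℕ) :
    A.encode.getD (pre.length + j) 0 = l.getD j 0 := by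
  rw [h, List.getD_append_right _ _ _ _ (by omega), Nat.add_sub_cancel_left]

theorem code_le_two (d : HeadMove) : d.code ≤ 2 := by cases d <;> decide

theorem code_lt (a : TapeSymbol A.numLetters) : a.code < A.numLetters + 2 := by
  cases a <;> simp only [TapeSymbol.code] <;> omega

theorem runs_loadTransition {W : ℕ} {σ : RamState} (R : A.GraphRegs σ)
    (hW : A.vertexBound + 2 < W) {τ : PDATransition A.numStates A.numLetters A.numStack}
    {pre rest : List ℕ} (he : A.encode = pre ++ (TwoNPDA.encodeTransition τ ++ rest))
    (h15 : σ.reg 15 = pre.length) : Runs W loadTransition σ 14 fun σ' => Loaded τ σ' ∧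
      σ'.reg 15 = pre.length + 6 + τ.push.length ∧
      (∀ r, r < 15 ∨ 22 < r → σ'.reg r = σ.reg r) ∧ σ'.mem = σ.mem ∧ σ'.out = σ.out := by
  have hlen := congrArg List.length he
  have hN := A.length_encode_le_vertexBound
  have hN' := A.length_encode
  simp only [TwoNPDA.encodeTransition, List.length_append, List.length_cons, List.length_nil,
    List.length_map] at hlen
  have hc := code_lt τ.read
  have hm := code_le_two τ.move
  have hq := τ.src.isLt
  have hq' := τ.dst.isLt
  have hZ := τ.top.isLt
  have e0 : A.encode.getD pre.length 0 = τ.src := getD_encode he 0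
  have e1 : A.encode.getD (pre.length + 1) 0 = τ.read.code := getD_encode he 1
  have e2 : A.encode.getD (pre.length + 2) 0 = τ.top := getD_encode he 2
  have e3 : A.encode.getD (pre.length + 3) 0 = τ.dst := getD_encode he 3
  have e4 : A.encode.getD (pre.length + 4) 0 = τ.move.code := getD_encode he 4
  have e5 : A.encode.getD (pre.length + 5) 0 = τ.push.length := getD_encode he 5
  simp only [loadTransition, Runs.op_iff, Runs.load_iff, Runs.block_nil_iff, RamOp.eval,
    RamState.setReg_reg, RamState.setReg_mem, R.mem]
  norm_num only [if_true, if_false, R.path.one, h15, true_and, add_assoc, e0, e1, e2, e3, e4, e5]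
  refine ⟨by omega, by omega, by omega, by omega, by omega, by omega, by omega, by omega, by omega,
    by omega, by omega, by omega, by omega, ⟨by simp, by simp, by simp, by simp, by simp, by simp⟩,
    fun r hr => ?_, rfl⟩
  simp [show r ≠ 15 by omega, show r ≠ 16 by omega, show r ≠ 18 by omega, show r ≠ 19 by omega,
    show r ≠ 20 by omega, show r ≠ 21 by omega, show r ≠ 22 by omega]

/-- The first vertex of the path for guessing the symbol that a transition reads. -/
def transitionSrc (τ : PDATransition A.numStates A.numLetters A.numStack) : ℕ :=
  if τ.read.code = 0 then 2 * A.numStates + 3 else A.numStates + τ.src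

/-- The last vertex of the path for a transition. -/
def transitionDst (τ : PDATransition A.numStates A.numLetters A.numStack) : ℕ :=
  if τ.move.code = 1 then τ.dst else if τ.read.code = 1 then 2 * A.numStates + 2
    else A.numStates + τ.dst

theorem runs_transitionEnds {W : ℕ} {σ : RamState} (R : A.GraphRegs σ)
    (hW : A.vertexBound + 2 < W) {τ : PDATransition A.numStates A.numLetters A.numStack}
    (h : Loaded τ σ) : Runs W transitionEnds σ 18 fun σ' => Loaded τ σ' ∧
      σ'.reg 17 = transitionSrc τ ∧ σ'.reg 24 = transitionDst τ ∧
      σ'.reg 25 = (if τ.move.code = 1 then 1 else 0) ∧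
      (∀ r, r < 17 ∨ 25 < r → σ'.reg r = σ.reg r) ∧ σ'.mem = σ.mem ∧ σ'.out = σ.out := by
  have hN := A.length_encode_le_vertexBound
  have hV : 2 * A.numStates + 4 ≤ A.vertexBound := by rw [vertexBound]; omega
  have hq := τ.src.isLt
  have hq' := τ.dst.isLt
  simp only [transitionEnds, Runs.op_iff, RamOp.eval, RamState.setReg_reg]
  norm_num only [if_true, if_false, R.path.zero, R.states, h.src, h.read, true_and]
  refine ⟨by omega, by split_ifs <;> omega, ?_⟩
  refine Runs.select_cons (by simp [R.path.zero]) (by simp [R.orphan]; omega) (by omega) ?_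
  simp only [Runs.op_iff, RamOp.eval, RamState.setReg_reg]
  norm_num only [if_true, if_false, R.path.one, R.states, h.dst, h.read, R.orphan, true_and]
  refine ⟨by omega, by split_ifs <;> omega, ?_⟩
  refine Runs.select_cons (by simp [R.path.zero]) (by simp [R.sink]; omega) (by omega) ?_
  simp only [Runs.op_iff, RamOp.eval, RamState.setReg_reg]
  norm_num only [if_true, if_false, R.path.one, h.move, R.sink, true_and]
  refine ⟨by split_ifs <;> omega, ?_⟩
  refine Runs.select_cons (by simp [R.path.zero]) (by simp [h.dst]; omega) (by omega) ?_
  rw [Runs.block_nil_iff]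
  refine ⟨by omega, ⟨by simp [h.src], by simp [h.read], by simp [h.top], by simp [h.dst],
    by simp [h.move], by simp [h.count]⟩, ?_, ?_, by simp, fun r hr => ?_, by simp, by simp⟩
  · by_cases h0 : τ.read.code = 0 <;> simp [transitionSrc, h0]
  · by_cases h0 : τ.read.code = 1 <;> by_cases h1 : τ.move.code = 1 <;>
      simp [transitionDst, h0, h1, h.dst]
  · simp [show r ≠ 17 by omega, show r ≠ 24 by omega, show r ≠ 25 by omega]

theorem Loaded.of_frame {τ : PDATransition A.numStates A.numLetters A.numStack} {σ σ' : RamState}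
    (h : Loaded τ σ) (hr : ∀ r, 15 < r → r < 23 → σ'.reg r = σ.reg r) : Loaded τ σ' :=
  ⟨by rw [hr _ (by omega) (by omega), h.src], by rw [hr _ (by omega) (by omega), h.read],
    by rw [hr _ (by omega) (by omega), h.top], by rw [hr _ (by omega) (by omega), h.dst],
    by rw [hr _ (by omega) (by omega), h.move], by rw [hr _ (by omega) (by omega), h.count]⟩

theorem runs_transitionWord {W b : ℕ} {σ : RamState} (R : PathRegs A.width σ)
    (hP : 2 ^ (A.width + 1) + 3 < W)
    {τ : PDATransition A.numStates A.numLetters A.numStack} (h : Loaded τ σ)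
    (h15 : σ.reg 15 = b + τ.push.length) (h25 : σ.reg 25 = if τ.move.code = 1 then 1 else 0)
    (hm : ∀ j < τ.push.length, σ.mem 0 (b + j) = (τ.push.map Fin.val).getD j 0)
    (hb : b + τ.push.length < W)
    (hf : σ.reg 32 + (τ.push.length + 3) * A.width + 1 < W) :
    Runs W transitionWord σ (20 * (τ.push.length + 4) * (A.width + 1))
      (Emits 40 (popWord A.width τ.read.code ++ (popWord A.width τ.top ++
      ((τ.push.map Fin.val).reverse.flatMap (pushWord A.width) ++
        if τ.move.code = 1 then pushWord A.width τ.read.code else []))) σ) := by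
  have hT : 20 * (τ.push.length + 4) * (A.width + 1) =
    20 * (τ.push.length + 1) * (A.width + 1) + 60 * (A.width + 1) := by ring
  have hf' : (τ.push.length + 3) * A.width = τ.push.length * A.width + 3 * A.width := by ring
  have hlen : (τ.push.map Fin.val).length = τ.push.length := List.length_map ..
  have hra := A.code_lt_width τ.read
  refine emits_cons (T₁ := 15 * (A.width + 1)) (T₂ := 20 * (τ.push.length + 1) * (A.width + 1) +
    45 * (A.width + 1)) (m := 35) ?_ (by omega) (by omega) fun σ₁ h₁ => ?_
  · rw [← h.read] at hra ⊢
    exact runs_popNumber R hra hP (by omega)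
  have R₁ := h₁.pathRegs R
  have L₁ : Loaded τ σ₁ := h.of_frame fun r _ _ => h₁.frame r (by omega)
  have f₁ := h₁.fresh
  rw [length_popWord] at f₁
  refine emits_cons (T₁ := 15 * (A.width + 1)) (T₂ := 20 * (τ.push.length + 1) * (A.width + 1) +
    30 * (A.width + 1)) (m := 35) ?_ (by omega) (by omega) fun σ₂ h₂ => ?_
  · rw [← L₁.top]
    exact runs_popNumber R₁ (by rw [L₁.top]; exact A.val_lt_width _) hP (by omega)
  have R₂ := h₂.pathRegs R₁
  have L₂ : Loaded τ σ₂ := L₁.of_frame fun r _ _ => h₂.frame r (by omega)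
  have f₂ := h₂.fresh
  rw [length_popWord] at f₂
  refine emits_cons (T₁ := 20 * (τ.push.length + 1) * (A.width + 1))
    (T₂ := 30 * (A.width + 1)) (m := 40) ?_ (by omega) (by omega) fun σ₃ h₃ => ?_
  · have := runs_pushNumbers (W := W) (b := b) (l := τ.push.map Fin.val) R₂ (by rw [L₂.count, hlen])
      (by rw [h₂.frame _ (by omega), h₁.frame _ (by omega), h15, hlen])
      (by rw [hlen, h₂.mem, h₁.mem]; exact hm) ?_ hP (by rw [hlen]; exact hb)
      (by rw [hlen]; omega)
    · rwa [hlen] at this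
    · intro x hx
      obtain ⟨Z, -, rfl⟩ := List.mem_map.1 hx
      exact A.val_lt_width _
  have R₃ := h₃.pathRegs R₂
  have L₃ : Loaded τ σ₃ := L₂.of_frame fun r _ _ => h₃.frame r (by omega)
  have f₃ := h₃.fresh
  simp only [List.length_flatMap, length_pushWord, List.map_const', List.length_reverse, hlen,
    List.sum_replicate, smul_eq_mul] at f₃
  have h25' : σ₃.reg 25 = if τ.move.code = 1 then 1 else 0 := by
    rw [h₃.frame _ (by omega), h₂.frame _ (by omega), h₁.frame _ (by omega), h25]
  rw [← List.append_nil (if τ.move.code = 1 then pushWord A.width τ.read.code else [])]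
  refine emits_cons (T₁ := 15 * (A.width + 1) + 1) (T₂ := 1) (m := 40) (Runs.ite ?_) (by omega)
    (by omega) fun σ₄ h₄ => emits_nil le_rfl
  rw [h25']
  by_cases hs : τ.move.code = 1
  · simp only [hs, if_true, ne_eq, one_ne_zero, not_false_eq_true]
    rw [← L₃.read] at hra ⊢
    exact (runs_pushNumber R₃ hra hP (by omega)).mono le_rfl fun _ h => h.mono (by omega)
  · simp only [hs, if_false, ne_eq, not_true_eq_false]
    exact emits_nil (by omega)

theorem runs_drawTransition {W : ℕ} {o : List ℕ} {rs : List Rule} {σ : RamState}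
    (R : A.GraphRegs σ) (hD : Drawn o (2 * A.numStates + 4) rs σ)
    (hW : A.vertexBound + 2 < W) (hP : 2 ^ (A.width + 1) + 3 < W)
    {τ : PDATransition A.numStates A.numLetters A.numStack} {pre rest : List ℕ}
    (he : A.encode = pre ++ (TwoNPDA.encodeTransition τ ++ rest)) (h15 : σ.reg 15 = pre.length)
    (hf : 2 * A.numStates + 4 + numNew (rs ++ A.transRules τ) ≤ A.vertexBound) :
    Runs W drawTransition σ (20 * (τ.push.length + 8) * (A.width + 1)) fun σ' =>
      A.GraphRegs σ' ∧ Drawn o (2 * A.numStates + 4) (rs ++ A.transRules τ) σ' ∧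
      σ'.reg 15 = pre.length + (τ.push.length + 6) ∧
      σ'.reg 26 = A.encode.length - (pre.length + (τ.push.length + 6)) := by
  have hT : 20 * (τ.push.length + 8) * (A.width + 1) =
    20 * (τ.push.length + 4) * (A.width + 1) + 80 * (A.width + 1) := by ring
  have hw := A.width_pos
  have hlen := congrArg List.length he
  have hN := A.length_encode_le_vertexBound
  simp only [TwoNPDA.encodeTransition, List.length_append, List.length_cons, List.length_nil,
    List.length_map] at hlen
  have hrules : A.transRules τ = [⟨τ.src, popWord A.width τ.read.code ++ (popWord A.width τ.top ++
      ((τ.push.map Fin.val).reverse.flatMap (pushWord A.width) ++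
        if τ.move.code = 1 then pushWord A.width τ.read.code else [])), transitionDst τ⟩] ++
      [⟨transitionSrc τ, pushWord A.width τ.read.code, τ.src⟩] := rfl
  rw [hrules, ← List.append_assoc, numNew_concat, numNew_concat] at hf
  have hV : 2 * A.numStates + 4 ≤ A.vertexBound := by omega
  refine Runs.block_cons (runs_loadTransition R hW he h15) (by omega) ?_
  rintro σ₁ ⟨L₁, h15₁, hr₁, hm₁, ho₁⟩
  have R₁ := R.of_frame (fun r hr => hr₁ r (by omega)) hm₁
  have D₁ := hD.of_frame ho₁ (hr₁ 32 (by omega))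
  refine Runs.block_cons (runs_transitionEnds R₁ hW L₁) (by omega) ?_
  rintro σ₂ ⟨L₂, h17, h24, h25, hr₂, hm₂, ho₂⟩
  have R₂ := R₁.of_frame (fun r hr => hr₂ r (by omega)) hm₂
  have D₂ := D₁.of_frame ho₂ (hr₂ 32 (by omega))
  have hq := τ.src.isLt
  have hdst : transitionDst τ < 2 * A.numStates + 4 := by
    rw [transitionDst]; split_ifs <;> omega
  have hsrc : transitionSrc τ < 2 * A.numStates + 4 := by
    rw [transitionSrc]; split_ifs <;> omega
  have hwl : (popWord A.width τ.read.code ++ (popWord A.width τ.top ++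
      ((τ.push.map Fin.val).reverse.flatMap (pushWord A.width) ++
        if τ.move.code = 1 then pushWord A.width τ.read.code else []))).length + A.width + 1 ≥
        (τ.push.length + 3) * A.width + 1 := by
    have : (τ.push.length + 3) * A.width = τ.push.length * A.width + 3 * A.width := by ring
    simp only [List.length_append, length_popWord, List.length_flatMap, length_pushWord,
      List.map_const', List.length_reverse, List.length_map, List.sum_replicate, smul_eq_mul]
    omega
  simp only [length_pushWord] at hf
  refine Runs.block_cons (runs_drawPath (p := transitionWord) R₂.path D₂ (by omega)
    (by rw [L₂.src]; omega) (by omega) fun σ' hr hm => runs_transitionWord (b := pre.length + 6)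
    (R₂.path.of_frame fun r _ => hr r (by omega)) hP (L₂.of_frame fun r _ _ => hr r (by omega))
    (by rw [hr _ (by omega), hr₂ _ (by omega), h15₁]) (by rw [hr _ (by omega), h25]) ?_
    (by omega) ?_) (by omega) ?_
  · intro j hj
    rw [hm, R₂.mem, add_assoc]
    refine (getD_encode he _).trans ?_
    rw [TwoNPDA.encodeTransition, List.append_assoc, List.getD_append_right _ _ _ _ (by simp)]
    simp only [List.length_cons, List.length_nil]
    rw [show 6 + j - (0 + 1 + 1 + 1 + 1 + 1 + 1) = j by omega,
      List.getD_append _ _ _ _ (by simpa using hj)]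
  · rw [hr _ (by omega), D₂.fresh]
    omega
  rintro σ₃ ⟨D₃, hr₃, hm₃⟩
  rw [L₂.src, h24] at D₃
  have R₃ := R₂.of_frame (fun r hr => hr₃ r (by omega)) hm₃
  have L₃ : Loaded τ σ₃ := L₂.of_frame fun r _ _ => hr₃ r (by omega)
  refine Runs.block_cons (runs_drawPath (L := A.width) (w := pushWord A.width τ.read.code)
    (p := pushNumber 18) (T := 15 * (A.width + 1)) R₃.path D₃ (by omega)
    (by rw [hr₃ _ (by omega), h17]; omega) ?_ fun σ' hr hm => ?_) (by omega) ?_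
  · rw [numNew_concat, length_pushWord]; dsimp only; omega
  · have hra := A.code_lt_width τ.read
    rw [← L₃.read, ← hr _ (by omega)] at hra ⊢
    refine (runs_pushNumber (R₃.path.of_frame fun r _ => hr r (by omega)) hra hP ?_).mono le_rfl
      fun _ h => h.mono (by omega)
    rw [hr _ (by omega), D₃.fresh, numNew_concat]
    dsimp only
    omega
  rintro σ₄ ⟨D₄, hr₄, hm₄⟩
  rw [L₃.src, hr₃ 17 (by omega), h17] at D₄
  have R₄ := R₃.of_frame (fun r hr => hr₄ r (by omega)) hm₄
  have h15₄ : σ₄.reg 15 = pre.length + (τ.push.length + 6) := by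
    rw [hr₄ _ (by omega), hr₃ _ (by omega), hr₂ _ (by omega), h15₁]; omega
  rw [Runs.op_iff, Runs.block_nil_iff]
  simp only [RamOp.eval, R₄.length, h15₄]
  refine ⟨by omega, by omega, by omega, R₄.of_frame (fun r hr => ?_) rfl, ?_, ?_, by simp⟩
  · simp [show r ≠ 26 by omega]
  · rw [hrules, ← List.append_assoc]
    exact D₄.of_frame rfl (by simp)
  · simp [h15₄]

end PDA

/-! ### Drawing the paths of all transitions and final states -/

namespace PDA

open RamProg PathGraph

/-- Draw the paths for all transitions. -/
def drawTransitions : RamProg :=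
  block [.op .add 15 14 10, .op .sub 26 0 15, .loop 26 drawTransition]

/-- Draw the paths for the final states. -/
def drawFinals : RamProg :=
  block [.const 16 0, .op .add 17 3 10, .const 15 5, .op .add 26 3 10,
    .loop 26 (block [.load 25 0 15,
      .ite 25 (block [drawPath 17 (pushNumber 1) 16,
        drawPath 16 (block [popNumber 1, popNumber 5]) 8]) (block []),
      .op .add 15 15 1, .op .add 16 16 1, .op .add 17 17 1, .op .sub 26 26 1])]

variable {A : PDA}

theorem runs_drawTransitions {W : ℕ} {o : List ℕ} {rs : List Rule} {σ : RamState}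
    (R : A.GraphRegs σ) (hD : Drawn o (2 * A.numStates + 4) rs σ)
    (hW : A.vertexBound + 2 < W) (hP : 2 ^ (A.width + 1) + 3 < W)
    (hrs : rs ++ A.trans.flatMap A.transRules = A.rules) :
    Runs W drawTransitions σ (40 * ((A.width + 1) * A.encode.length) + 4)
      (Drawn o (2 * A.numStates + 4) A.rules) := by
  have hN := A.length_encode_le_vertexBound
  have hN' := A.length_encode
  have hrl := A.numNew_rules_le
  simp only [drawTransitions, Runs.op_iff, RamOp.eval, RamState.setReg_reg]
  norm_num only [if_true, if_false, R.path.zero, R.offset, R.length, add_zero]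
  refine ⟨by omega, by omega, by omega, by omega, ?_⟩
  -- The cost of a transition is charged to its `τ.push.length + 6` input entries, at `40 * (A.width
  -- + 1)` each.
  have hsum : ((A.trans.map fun τ => 20 * (τ.push.length + 8) * (A.width + 1) + 1).sum) ≤
      40 * ((A.width + 1) * A.encode.length) := by
    have h : ∀ l : List (PDATransition A.numStates A.numLetters A.numStack),
        (l.map fun τ => 20 * (τ.push.length + 8) * (A.width + 1) + 1).sum ≤
          40 * ((A.width + 1) * (l.map fun τ => τ.push.length + 6).sum) := by
      intro l
      induction l with
      | nil => simp
      | cons τ l ih =>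
        simp only [List.map_cons, List.sum_cons]
        have h₁ : 20 * (τ.push.length + 8) * (A.width + 1) =
          20 * ((A.width + 1) * τ.push.length) + 160 * A.width + 160 := by ring
        have h₂ : 40 * ((A.width + 1) * (τ.push.length + 6 +
            (l.map fun τ => τ.push.length + 6).sum)) = 40 * ((A.width + 1) * τ.push.length) +
            240 * A.width + 240 + 40 * ((A.width + 1) * (l.map fun τ => τ.push.length + 6).sum) := by
          ring
        omega
    refine (h A.trans).trans (Nat.mul_le_mul_left _ (Nat.mul_le_mul_left _ (by omega)))
  refine Runs.block_cons (Runs.loop_list (F := fun τ => 20 * (τ.push.length + 8) * (A.width + 1))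
    (I := fun l σ' => A.GraphRegs σ' ∧ ∃ pre done,
      A.encode = pre ++ l.flatMap TwoNPDA.encodeTransition ∧ σ'.reg 15 = pre.length ∧
      σ'.reg 26 = (l.flatMap TwoNPDA.encodeTransition).length ∧
      Drawn o (2 * A.numStates + 4) done σ' ∧ done ++ l.flatMap A.transRules = A.rules)
    ?_ ?_ A.trans _ ?_) (by omega) ?_
  · rintro σ' ⟨-, pre, done, -, -, h, -⟩
    simpa using h
  · rintro τ l σ' ⟨R', pre, done, he, h15, h26, hD', hd⟩
    rw [List.flatMap_cons] at he h26 hd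
    refine ⟨by rw [h26]; simp [TwoNPDA.encodeTransition], ?_⟩
    refine (runs_drawTransition R' hD' hW hP he h15 ?_).mono le_rfl ?_
    · rw [← List.append_assoc] at hd
      rw [← hd, numNew_append] at hrl
      omega
    · rintro σ₁ ⟨R₁, D₁, h15₁, h26₁⟩
      have hlen := congrArg List.length he
      have hel : (TwoNPDA.encodeTransition τ).length = τ.push.length + 6 := by
        simp [TwoNPDA.encodeTransition]
      simp only [List.length_append, hel] at hlen
      refine ⟨R₁, pre ++ TwoNPDA.encodeTransition τ, done ++ A.transRules τ, ?_, ?_, ?_, D₁, ?_⟩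
      · rw [he, List.append_assoc]
      · rw [h15₁, List.length_append, hel]
      · rw [h26₁]; omega
      · rw [← hd, List.append_assoc]
  · refine ⟨R.of_frame (fun r hr => ?_) rfl, A.encode.take (A.numStates + (A.numLetters + 2) +
      A.numStack + 5), rs, ?_, ?_, ?_, hD.of_frame rfl (by simp), hrs⟩
    · simp [show r ≠ 26 by omega, show r ≠ 15 by omega]
    · rw [TwoNPDA.encode]
      rw [List.take_left' (by simp; omega)]
      rfl
    · simp; omega
    · have : (A.trans.flatMap TwoNPDA.encodeTransition).length =
          (A.trans.map fun τ => τ.push.length + 6).sum := by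
        rw [List.length_flatMap]
        congr 2; funext τ
        simp [TwoNPDA.encodeTransition]
      rw [this, RamState.setReg_reg, if_pos rfl]; omega
  · rintro σ' ⟨-, pre, done, -, -, -, hD', hd⟩
    rw [Runs.block_nil_iff]
    rw [List.flatMap_nil, List.append_nil] at hd
    exact ⟨by omega, hd ▸ hD'⟩

theorem runs_pushTwo {W a b : ℕ} {σ : RamState} (R : PathRegs A.width σ)
    (hP : 2 ^ (A.width + 1) + 3 < W) (hb : b < 30) (ha' : σ.reg a < 2 ^ A.width)
    (hb' : σ.reg b < 2 ^ A.width) (hf : σ.reg 32 + 2 * A.width < W) :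
    Runs W (block [pushNumber a, pushNumber b]) σ (31 * (A.width + 1))
      (Emits 40 (pushWord A.width (σ.reg a) ++ pushWord A.width (σ.reg b)) σ) := by
  rw [← List.append_nil (pushWord A.width (σ.reg b))]
  refine emits_cons (T₁ := 15 * (A.width + 1)) (T₂ := 16 * (A.width + 1)) (m := 35)
    (runs_pushNumber R ha' hP (by omega)) (by omega) (by omega) fun σ₁ h₁ => ?_
  have f₁ := h₁.fresh
  rw [length_pushWord] at f₁
  have hb₁ := h₁.frame b (.inl hb)
  rw [← hb₁] at hb' ⊢
  exact emits_cons (T₁ := 15 * (A.width + 1)) (T₂ := 1 * (A.width + 1)) (m := 35)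
    (runs_pushNumber (h₁.pathRegs R) hb' hP (by omega)) (by omega) (by omega)
    fun σ₂ h₂ => emits_nil (by omega)

theorem runs_popTwo {W a b : ℕ} {σ : RamState} (R : PathRegs A.width σ)
    (hP : 2 ^ (A.width + 1) + 3 < W) (hb : b < 30) (ha' : σ.reg a < 2 ^ A.width)
    (hb' : σ.reg b < 2 ^ A.width) (hf : σ.reg 32 + 2 * A.width < W) :
    Runs W (block [popNumber a, popNumber b]) σ (31 * (A.width + 1))
      (Emits 40 (popWord A.width (σ.reg a) ++ popWord A.width (σ.reg b)) σ) := by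
  rw [← List.append_nil (popWord A.width (σ.reg b))]
  refine emits_cons (T₁ := 15 * (A.width + 1)) (T₂ := 16 * (A.width + 1)) (m := 35)
    (runs_popNumber R ha' hP (by omega)) (by omega) (by omega) fun σ₁ h₁ => ?_
  have f₁ := h₁.fresh
  rw [length_popWord] at f₁
  have hb₁ := h₁.frame b (.inl hb)
  rw [← hb₁] at hb' ⊢
  exact emits_cons (T₁ := 15 * (A.width + 1)) (T₂ := 1 * (A.width + 1)) (m := 35)
    (runs_popNumber (h₁.pathRegs R) hb' hP (by omega)) (by omega) (by omega)
    fun σ₂ h₂ => emits_nil (by omega)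

theorem getD_encode_flag (q : Fin A.numStates) :
    A.encode.getD (5 + q) 0 = if q ∈ A.final then 1 else 0 := by
  have : A.encode = [A.numStates, A.numLetters, A.numStack, A.start.val, A.bottom.val] ++
      (List.ofFn (fun q : Fin A.numStates => if q ∈ A.final then 1 else 0) ++
        (List.range (A.numLetters + 2) ++ (List.range A.numStack ++
          A.trans.flatMap TwoNPDA.encodeTransition))) := by
    simp only [TwoNPDA.encode, List.append_assoc]; rfl
  refine (getD_encode this q.val).trans ?_
  rw [List.getD_append _ _ _ _ (by simp)]
  simp

/-- The rules for a state that may be final. -/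
def flagRules (q : Fin A.numStates) : List Rule := if q ∈ A.final then A.finalRules q else []

theorem runs_drawFinals {W : ℕ} {o : List ℕ} {rs : List Rule} {σ : RamState}
    (R : A.GraphRegs σ) (hD : Drawn o (2 * A.numStates + 4) rs σ)
    (hW : A.vertexBound + 2 < W) (hP : 2 ^ (A.width + 1) + 3 < W)
    (hrs : 2 * A.numStates + 4 + numNew (rs ++ (List.finRange A.numStates).flatMap flagRules) ≤
      A.vertexBound) :
    Runs W drawFinals σ (80 * (A.numStates * (A.width + 1)) + A.numStates + 6) fun σ' =>
      A.GraphRegs σ' ∧ Drawn o (2 * A.numStates + 4)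
        (rs ++ (List.finRange A.numStates).flatMap flagRules) σ' := by
  have hN := A.length_encode_le_vertexBound
  have hN' := A.length_encode
  have hw := A.width_pos
  have h1w : 1 < 2 ^ A.width := A.code_lt_width TapeSymbol.rightEnd
  have hZw := A.val_lt_width A.bottom
  simp only [drawFinals, Runs.op_iff, Runs.const_iff, RamOp.eval, RamState.setReg_reg]
  norm_num only [if_true, if_false, R.path.zero, R.states, add_zero]
  refine ⟨by omega, by omega, by omega, by omega, by omega, by omega, by omega, by omega, ?_⟩
  have hT : (80 * (A.width + 1) + 1) * A.numStates =
    80 * (A.numStates * (A.width + 1)) + A.numStates := by ring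
  refine Runs.block_cons (T₁ := (80 * (A.width + 1) + 1) * A.numStates + 1) ((Runs.loop_list
    (F := fun _ => 80 * (A.width + 1)) (I := fun l σ' => A.GraphRegs σ' ∧ ∃ d,
      d ++ l = List.finRange A.numStates ∧ σ'.reg 26 = l.length ∧ σ'.reg 15 = 5 + d.length ∧
      σ'.reg 16 = d.length ∧ σ'.reg 17 = A.numStates + d.length ∧
      Drawn o (2 * A.numStates + 4) (rs ++ d.flatMap flagRules) σ')
    ?_ ?_ (List.finRange A.numStates) _ ?_).mono ?_ fun _ h => h) (by omega) ?_
  · rintro σ' ⟨-, d, -, h, -⟩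
    simpa using h
  · rintro q l σ' ⟨R', d, hd, h26, h15, h16, h17, hD'⟩
    have hdq : d.length = q.val := by
      have h := congrArg (fun l => l[d.length]?) hd
      simp only [List.getElem?_append_right le_rfl, Nat.sub_self, List.getElem?_cons_zero] at h
      obtain ⟨hlt, h⟩ := List.getElem?_eq_some_iff.1 h.symm
      rw [← h]; simp
    have hlt := q.isLt
    have hlen := congrArg List.length hd
    simp only [List.length_append, List.length_cons, List.length_finRange] at hlen
    rw [hdq] at h15 h16 h17
    have hmem : σ'.mem 0 (5 + q.val) = if q ∈ A.final then 1 else 0 := by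
      rw [R'.mem]; exact getD_encode_flag q
    have hload : (if q ∈ A.final then 1 else 0) < W := by split_ifs <;> omega
    refine ⟨by rw [h26]; simp, ?_⟩
    rw [Runs.load_iff, h15, hmem]
    refine ⟨hload, by omega, ?_⟩
    have R₁ : A.GraphRegs (σ'.setReg 25 (if q ∈ A.final then 1 else 0)) :=
      R'.of_frame (fun r hr => by simp [show r ≠ 25 by omega]) rfl
    refine Runs.block_cons (T₁ := 46 * (A.width + 1) + 26) (Q₁ := fun σ₂ => A.GraphRegs σ₂ ∧
      (∀ r, 14 < r → r < 25 → σ₂.reg r = σ'.reg r) ∧ σ₂.reg 26 = σ'.reg 26 ∧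
      Drawn o (2 * A.numStates + 4) (rs ++ (d ++ [q]).flatMap flagRules) σ₂) (Runs.ite ?_)
      (by omega) ?_
    · have D₁ := hD'.of_frame (σ' := σ'.setReg 25 (if q ∈ A.final then 1 else 0)) rfl (by simp)
      have hnew : numNew (rs ++ d.flatMap flagRules) + numNew (flagRules q) ≤
          numNew (rs ++ (List.finRange A.numStates).flatMap flagRules) := by
        simp only [← hd, List.flatMap_append, List.flatMap_cons, numNew_append]
        omega
      have hflag : rs ++ (d ++ [q]).flatMap flagRules =
          rs ++ d.flatMap flagRules ++ flagRules q := by simp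
      rw [hflag]
      by_cases hq : q ∈ A.final
      · simp only [flagRules, hq, if_true] at hnew D₁ R₁ ⊢
        rw [numNew_finalRules] at hnew
        simp only [RamState.setReg_reg, if_true, ne_eq, one_ne_zero, not_false_eq_true]
        refine Runs.block_cons (T₁ := 15 * (A.width + 1) + 12) (runs_drawPath (L := A.width)
          (w := pushWord A.width 1) (p := pushNumber 1) R₁.path D₁ (by omega) (by simp [h17]; omega)
          (by rw [length_pushWord]; omega) fun σ₂ hr hm => ?_) (by omega) ?_
        · have h1 : σ₂.reg 1 = 1 := by rw [hr _ (by omega), R₁.path.one]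
          have := runs_pushNumber (W := W) (a := 1) (R₁.path.of_frame (σ' := σ₂)
            fun r _ => hr r (by omega)) (by omega) hP (by rw [hr _ (by omega), D₁.fresh]; omega)
          rw [h1] at this
          exact this.mono le_rfl fun _ h => h.mono (by omega)
        rintro σ₂ ⟨D₂, hr₂, hm₂⟩
        have R₂ := R₁.of_frame (fun r hr => hr₂ r (by omega)) hm₂
        refine Runs.block_cons (T₁ := 31 * (A.width + 1) + 12) (runs_drawPath (L := A.width)
          (w := popWord A.width 1 ++ popWord A.width A.bottom)
          (p := block [popNumber 1, popNumber 5]) R₂.path D₂ (by omega)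
          (by rw [hr₂ _ (by omega)]; simp [h16]; omega) ?_ fun σ₃ hr hm => ?_) (by omega) ?_
        · rw [numNew_concat, List.length_append, length_popWord, length_popWord]
          simp only [length_pushWord]
          omega
        · have R₃ := R₂.path.of_frame (σ' := σ₃) fun r _ => hr r (by omega)
          have h5 : σ₃.reg 5 = A.bottom := by rw [hr _ (by omega), R₂.bottom]
          have := runs_popTwo (W := W) (a := 1) (b := 5) R₃ hP (by omega) (by rw [R₃.one]; omega)
            (by rw [h5]; omega) ?_
          · rwa [R₃.one, h5] at this
          · rw [hr _ (by omega), D₂.fresh, numNew_concat, length_pushWord]; omega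
        rintro σ₃ ⟨D₃, hr₃, hm₃⟩
        have R₃ := R₂.of_frame (fun r hr => hr₃ r (by omega)) hm₃
        rw [Runs.block_nil_iff]
        refine ⟨by omega, R₃, fun r h₁ h₂ => ?_, ?_, ?_⟩
        · rw [hr₃ _ (by omega), hr₂ _ (by omega)]; simp [show r ≠ 25 by omega]
        · rw [hr₃ _ (by omega), hr₂ _ (by omega)]; simp
        · rw [hr₂ _ (by omega), hr₂ _ (by omega), R₁.target] at D₃
          rw [List.append_assoc] at D₃
          simpa [TwoNPDA.finalRules, h16, h17] using D₃
      · simp only [flagRules, hq, if_false, List.append_nil] at D₁ R₁ ⊢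
        simp only [RamState.setReg_reg, if_true, ne_eq, not_true_eq_false, if_false]
        rw [Runs.block_nil_iff]
        exact ⟨by omega, R₁, fun r h₁ h₂ => by simp [show r ≠ 25 by omega], by simp, D₁⟩
    · rintro σ₂ ⟨R₂, hr₂, hr26, D₂⟩
      simp only [Runs.op_iff, Runs.block_nil_iff, RamOp.eval, RamState.setReg_reg]
      have h15₂ := hr₂ 15 (by omega) (by omega)
      have h16₂ := hr₂ 16 (by omega) (by omega)
      have h17₂ := hr₂ 17 (by omega) (by omega)
      norm_num only [if_true, if_false, R₂.path.one, h15₂, h16₂, h17₂, hr26, h15, h16, h17, h26]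
      rw [List.length_cons]
      refine ⟨by omega, by omega, by omega, by omega, by omega, by omega, by omega, by omega, by omega,
        R₂.of_frame (fun r hr => ?_) rfl, d ++ [q], by simpa using hd, by simp, ?_, ?_, ?_,
        D₂.of_frame rfl (by simp)⟩
      · simp [show r ≠ 15 by omega, show r ≠ 16 by omega, show r ≠ 17 by omega,
          show r ≠ 26 by omega]
      · simp [hdq]; omega
      · simp [hdq]
      · simp [hdq]; omega
  · refine ⟨R.of_frame (fun r hr => ?_) rfl, [], rfl, by simp, by simp, by simp, by simp, ?_⟩
    swap
    · rw [List.flatMap_nil, List.append_nil]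
      exact hD.of_frame rfl (by simp)
    simp [show r ≠ 15 by omega, show r ≠ 16 by omega, show r ≠ 17 by omega, show r ≠ 26 by omega]
  · simp; ring_nf; omega
  · rintro σ' ⟨R', d, hd, -, -, -, -, hD'⟩
    rw [List.append_nil] at hd
    subst hd
    rw [Runs.block_nil_iff]
    exact ⟨by omega, R', hD'⟩

end PDA

/-! ### The complete program and its linear running time -/

namespace PDA

open RamProg PathGraph

/-- Load the input parameters and compute the constants. -/
def graphSetup : RamProg :=
  -- Register `5` first holds the number of tape and stack symbols, whose binary length is the
  -- width, and later the end-of-stack symbol. Register `14` becomes the address of the first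
  -- transition, `6` the power `2 ^ L`, and `12` the number of vertices; its factor `3` is the last
  -- address left in register `26`.
  block [.const 1 1, .const 2 2, .load 3 0 10, .load 25 0 1, .load 14 0 2, .op .add 5 25 2,
    .op .add 5 5 14, .op .add 14 5 3, .const 26 5, .op .add 14 14 26, sizeLoop,
    .const 26 4, .load 5 0 26, .const 26 3, .load 13 0 26, .op .shl 6 1 4,
    .op .add 7 3 3, .op .add 8 7 1, .op .add 9 8 1, .op .add 11 9 1, .op .add 32 11 1,
    .op .add 12 4 1, .op .mul 12 12 0, .op .mul 12 26 12, .op .add 12 12 32]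

/-- Write the source, the target and the list of vertices. -/
def graphHeader : RamProg :=
  block [.write 12, .write 7, .write 8, .const 25 0, .op .add 26 12 10,
    .loop 26 (block [.write 25, .op .add 25 25 1, .op .sub 26 26 1])]

def graphProgram : RamProg :=
  block [graphSetup, graphHeader, drawPath 7 (block [pushNumber 5, pushNumber 10]) 13, drawFinals,
    drawTransitions]

variable (A : PDA)

theorem runs_graphSetup {W : ℕ} (hW : A.vertexBound + 2 < W) (hP : 2 ^ (A.width + 1) + 3 < W) :
    Runs W graphSetup (RamState.init A.encode) (4 * A.width + 30) fun σ => A.GraphRegs σ ∧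
      σ.reg 12 = A.vertexBound ∧ σ.reg 32 = 2 * A.numStates + 4 ∧ σ.out = [] := by
  have hN := A.length_encode_le_vertexBound
  have hN' := A.length_encode
  have e0 : A.encode.getD 0 0 = A.numStates := rfl
  have e1 : A.encode.getD 1 0 = A.numLetters := rfl
  have e2 : A.encode.getD 2 0 = A.numStack := rfl
  have e3 : A.encode.getD 3 0 = A.start := rfl
  have e4 : A.encode.getD 4 0 = A.bottom := rfl
  have hs := A.start.isLt
  have hb := A.bottom.isLt
  have hsz : Nat.size (A.numLetters + 2 + A.numStack) = A.width := rfl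
  have hsz' := Nat.size_le_self (A.numLetters + 2 + A.numStack)
  simp only [graphSetup, Runs.op_iff, Runs.const_iff, Runs.load_iff, RamOp.eval,
    RamState.setReg_reg, RamState.setReg_mem, RamState.init_reg, RamState.init_mem_zero]
  norm_num only [if_true, if_false, e0, e1, e2]
  refine ⟨by omega, by omega, by omega, by omega, by omega, by omega, by omega, by omega, by omega,
    by omega, by omega, by omega, by omega, by omega, by omega, by omega, by omega, by omega,
    by omega, by omega, ?_⟩
  refine Runs.block_cons (runs_sizeLoop (x := A.numLetters + 2 + A.numStack) (by simp) (by simp)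
    (by simp [RamState.init_reg]) (by simp) (by omega)) (by omega) ?_
  rintro σ ⟨h4, hr, hm, ho⟩
  rw [hsz] at h4
  simp only [RamState.setReg_mem] at hm
  have r0 := hr 0 (by omega) (by omega)
  have r1 := hr 1 (by omega) (by omega)
  have r2 := hr 2 (by omega) (by omega)
  have r3 := hr 3 (by omega) (by omega)
  have r10 := hr 10 (by omega) (by omega)
  have r14 := hr 14 (by omega) (by omega)
  simp only [RamState.setReg_reg, RamState.init_reg] at r0 r1 r2 r3 r10 r14
  norm_num only [if_true, if_false] at r0 r1 r2 r3 r10 r14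
  simp only [Runs.op_iff, Runs.const_iff, Runs.load_iff, Runs.block_nil_iff, RamOp.eval,
    RamState.setReg_reg, RamState.setReg_mem, hm, RamState.init_mem_zero]
  norm_num only [if_true, if_false, e3, e4, h4, r0, r1, r3, Nat.one_shiftLeft]
  have hV : A.vertexBound = 3 * ((A.width + 1) * A.encode.length) + (2 * A.numStates + 4) := rfl
  rw [pow_succ] at hP
  iterate 28 refine ⟨by omega, ?_⟩
  refine ⟨by omega, ⟨⟨?_, ?_, ?_, ?_, ?_⟩, ?_, ?_, ?_, ?_, ?_, ?_, ?_, ?_, ?_, ?_⟩, by omega,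
    by omega, ?_⟩
  · simp [r1]
  · simp [r2]
  · simp [h4]
  · simp
  · simp [r10]
  · simp [r0]
  · simp [r3]
  · simp
  · simp; omega
  · simp; omega
  · simp; omega
  · simp; omega
  · simp
  · simp [r14]; omega
  · simp [hm, RamState.init_mem_zero]
  · simp [ho, RamState.init_out]

/-- The output of the program before the first edge. -/
def headerOutput : List ℕ :=
  [A.vertexBound, 2 * A.numStates, 2 * A.numStates + 1] ++ List.range A.vertexBound

variable {A}

theorem runs_graphHeader {W : ℕ} {σ : RamState} (R : A.GraphRegs σ) (hW : A.vertexBound + 2 < W)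
    (h12 : σ.reg 12 = A.vertexBound) (h32 : σ.reg 32 = 2 * A.numStates + 4) (ho : σ.out = []) :
    Runs W graphHeader σ (5 * A.vertexBound + 10) fun σ' => A.GraphRegs σ' ∧
      Drawn A.headerOutput (2 * A.numStates + 4) [] σ' := by
  simp only [graphHeader, Runs.op_iff, Runs.const_iff, Runs.write_iff, RamOp.eval,
    RamState.setReg_reg, RamState.emit_reg]
  norm_num only [if_true, if_false, R.path.zero, h12, R.source, R.target, add_zero]
  iterate 7 refine ⟨by omega, ?_⟩
  refine Runs.block_cons (Runs.loop_nat (F := 4)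
    (I := fun n σ' => n ≤ A.vertexBound ∧ A.GraphRegs σ' ∧ σ'.reg 26 = n ∧
      σ'.reg 25 = A.vertexBound - n ∧ σ'.reg 32 = 2 * A.numStates + 4 ∧
      σ'.out = [A.vertexBound, 2 * A.numStates, 2 * A.numStates + 1] ++
        List.range (A.vertexBound - n)) ?_ ?_ A.vertexBound _ ?_) (by omega) ?_
  · exact fun σ' h => h.2.2.1
  · rintro n σ' ⟨hn, R', h26, h25, h32, ho⟩
    refine ⟨by omega, ?_⟩
    simp only [Runs.op_iff, Runs.write_iff, Runs.block_nil_iff, RamOp.eval, RamState.setReg_reg,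
      RamState.emit_reg]
    norm_num only [if_true, if_false, R'.path.one, h25, h26, true_and]
    refine ⟨by omega, by omega, by omega, R'.of_frame (fun r hr => ?_) rfl, by omega, by omega, h32, ?_⟩
    · simp [show r ≠ 25 by omega, show r ≠ 26 by omega]
    · have : A.vertexBound - n = A.vertexBound - (n + 1) + 1 := by omega
      rw [this, List.range_succ]
      simp [ho]
  · refine ⟨le_rfl, R.of_frame (fun r hr => ?_) rfl, by simp, by simp, by simpa using h32, by simp [ho]⟩
    simp [show r ≠ 25 by omega, show r ≠ 26 by omega]
  · rintro σ' ⟨-, R', -, -, h32, ho⟩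
    rw [Runs.block_nil_iff]
    exact ⟨by omega, R', by simpa [graph, headerOutput] using ho, by simpa [numNew] using h32⟩

theorem runs_graphProgram {W : ℕ} (hW : A.vertexBound + 2 < W) (hP : 2 ^ (A.width + 1) + 3 < W) :
    Runs W graphProgram (RamState.init A.encode) (300 * ((A.width + 1) * A.encode.length))
      fun σ => σ.out = A.headerOutput ++ (graph (2 * A.numStates + 4) A.rules).flatMap edgeOutput := by
  have hN' := A.length_encode
  have hrl := A.numNew_rules_le
  have hV : A.vertexBound = 3 * ((A.width + 1) * A.encode.length) + (2 * A.numStates + 4) := rfl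
  have h₁ : (A.width + 1) * 7 ≤ (A.width + 1) * A.encode.length :=
    Nat.mul_le_mul_left _ (by have := A.bottom.isLt; omega)
  have h₂ : A.encode.length ≤ (A.width + 1) * A.encode.length :=
    Nat.le_mul_of_pos_left _ (Nat.succ_pos _)
  have h₃ : A.numStates * (A.width + 1) ≤ (A.width + 1) * A.encode.length := by
    rw [mul_comm]
    exact Nat.mul_le_mul_left _ (by omega)
  have hw := A.width_pos
  have hrules : A.rules = [A.startRule] ++ (List.finRange A.numStates).flatMap flagRules ++
    A.trans.flatMap A.transRules := by rw [List.append_assoc]; rfl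
  have hrl' := hrl
  rw [hrules, numNew_append] at hrl'
  have hrl₁ := hrl'
  rw [numNew_append] at hrl₁
  refine Runs.block_cons (A.runs_graphSetup hW hP) (by omega) ?_
  rintro σ₁ ⟨R₁, h12, h32, ho₁⟩
  refine Runs.block_cons (runs_graphHeader R₁ hW h12 h32 ho₁) (by omega) ?_
  rintro σ₂ ⟨R₂, D₂⟩
  have hlen : numNew [A.startRule] = 2 * A.width + 1 := by
    simp [numNew, TwoNPDA.startRule]; omega
  refine Runs.block_cons (T₁ := 31 * (A.width + 1) + 12) (runs_drawPath (L := A.width)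
    (w := pushWord A.width A.bottom ++ pushWord A.width 0)
    (p := block [pushNumber 5, pushNumber 10]) R₂.path D₂ (by omega) (by rw [R₂.source]; omega)
    ?_ fun σ hr hm => ?_) (by omega) ?_
  · rw [List.length_append, length_pushWord, length_pushWord]
    simp only [numNew, List.map_nil, List.sum_nil]
    omega
  · have R := R₂.path.of_frame (σ' := σ) fun r _ => hr r (by omega)
    have h5 : σ.reg 5 = A.bottom := by rw [hr _ (by omega), R₂.bottom]
    have := runs_pushTwo (W := W) (a := 5) (b := 10) R hP (by omega)
      (by rw [h5]; exact A.val_lt_width _) (by rw [R.zero]; exact Nat.two_pow_pos _) ?_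
    · rwa [R.zero, h5] at this
    · rw [hr _ (by omega), D₂.fresh]
      simp only [numNew, List.map_nil, List.sum_nil]
      omega
  rintro σ₃ ⟨D₃, hr₃, hm₃⟩
  have R₃ := R₂.of_frame (fun r hr => hr₃ r (by omega)) hm₃
  rw [R₂.source, R₂.start, List.nil_append] at D₃
  refine Runs.block_cons (runs_drawFinals R₃ D₃ hW hP ?_) (by omega) ?_
  · change _ + numNew ([A.startRule] ++ _) ≤ _
    rw [numNew_append]
    omega
  rintro σ₄ ⟨R₄, D₄⟩
  refine Runs.block_cons (runs_drawTransitions R₄ D₄ hW hP hrules.symm) (by omega) ?_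
  rintro σ₅ D₅
  rw [Runs.block_nil_iff]
  exact ⟨by omega, D₅.out⟩

variable (A)

/-- The instance of Dyck-2 reachability for a pushdown automaton. -/
def dyckInstance : Dyck2Instance :=
  toInstance A.vertexBound (2 * A.numStates) (2 * A.numStates + 1)
    (by have := A.numNew_rules_le; omega) (by have := A.numNew_rules_le; omega)
    (graph (2 * A.numStates + 4) A.rules)
    (fun e he => by
      have := A.numNew_rules_le
      have := graph_bounds (fun _ h => A.rules_bounds h) le_rfl he
      omega)
    (graph_nodup (fun _ h => A.rules_bounds h) le_rfl)

theorem yes_dyckInstance_iff : dyck2Reachability.yes A.dyckInstance ↔ ¬ A.language = 0 := by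
  rw [dyckInstance, yes_toInstance_iff, reach_iff (fun _ h => A.rules_bounds h) le_rfl (by omega)
    (by omega), reach_rules_iff, language_ne_zero_iff]

/-- The numbers of letters and of stack symbols are input entries, so their sum plus two has at most
two bits more than the largest entry. -/
theorem width_le : A.width ≤ Nat.size (A.encode.foldr max 1) + 2 := by
  have h₁ : A.numLetters ≤ A.encode.foldr max 1 := List.le_foldr_max (by simp [TwoNPDA.encode])
  have h₂ : A.numStack ≤ A.encode.foldr max 1 := List.le_foldr_max (by simp [TwoNPDA.encode])
  have h₃ := List.one_le_foldr_max A.encode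
  have h₄ := Nat.lt_size_self (A.encode.foldr max 1)
  rw [TwoNPDA.width, Nat.size_le, pow_add]
  omega

/-- The tape and stack symbols are listed in the input, so their number is at most its length. Hence
the powers of two used for extracting bits are linear in the input length and fit into a word. -/
theorem pow_width_le : 2 ^ (A.width + 1) ≤ 4 * A.encode.length := by
  have hN := A.length_encode
  have : 2 ^ (A.width - 1) ≤ A.numLetters + 2 + A.numStack :=
    Nat.lt_size.1 (Nat.sub_lt A.width_pos Nat.one_pos)
  have hw : A.width + 1 = A.width - 1 + 2 := by have := A.width_pos; omega
  rw [hw, pow_add]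
  omega

/-- The logarithmic factor from the binary codes is already contained in the bit length, which
counts all bits of every entry. This is why drawing bitwise paths takes linear time. -/
theorem width_mul_length_le : (A.width + 1) * A.encode.length ≤ 4 * bitLength A.encode := by
  have h := A.width_le
  have h₁ : 1 ≤ Nat.size (A.encode.foldr max 1) := Nat.size_pos.2 (List.one_le_foldr_max _)
  rw [bitLength, mul_left_comm, mul_comm]
  exact Nat.mul_le_mul_left _ (by omega)

end PDA

open PDA in
theorem linearTimeReduces_emptiness_dyck :
    LinearTimeReduces pdaEmptiness.compl dyck2Reachability := by
  refine ⟨PDA.dyckInstance, ⟨graphProgram, 40, 1200, fun A : PDA => ?_⟩,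
    fun A => (yes_dyckInstance_iff A).symm⟩
  change ∃ t, RamProg.Computes graphProgram ((bitLength A.encode + 2) ^ 40) A.encode
    A.dyckInstance.encode t ∧ t ≤ 1200 * (bitLength A.encode + 1)
  have h₁ := length_le_bitLength A.encode
  have h₂ := width_mul_length_le A
  have h₃ := pow_width_le A
  have h₄ := mul_pow_le_pow_add 39 (bitLength A.encode) 1
  have h₅ := A.length_encode
  have hV : A.vertexBound = 3 * ((A.width + 1) * A.encode.length) + (2 * A.numStates + 4) := rfl
  rw [pow_one, show 1 + 39 = 40 from rfl] at h₄
  obtain ⟨t, ht, hT⟩ := RamProg.Runs.computes ((runs_graphProgram (A := A)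
    (W := (bitLength A.encode + 2) ^ 40) (by omega) (by omega)).mono le_rfl fun σ h => h)
  refine ⟨t, ?_, hT.trans (by omega)⟩
  rw [dyckInstance, PathGraph.encode_toInstance]
  exact ht

/-! ### The cycle of reductions -/

theorem mainTheorem6 :
    List.TFAE [∀ M : TwoNPDA, (recognitionProblem M).TrulySubcubic,
      pdaEmptiness.TrulySubcubic,
      dyck2Reachability.TrulySubcubic] ∧
    (∀ M : TwoNPDA, LinearTimeReduces (recognitionProblem M) pdaEmptiness.compl) ∧
    LinearTimeReduces pdaEmptiness.compl dyck2Reachability ∧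
    ∃ R : TwoNPDA, LinearTimeReduces dyck2Reachability (recognitionProblem R) := by
  refine ⟨?_, linearTimeReduces_recognition_emptiness, linearTimeReduces_emptiness_dyck,
    Recognizer.automaton, linearTimeReduces_dyck_recognition⟩
  tfae_have 1 → 3 := by
    intro h
    obtain ⟨f, hf, hyes⟩ := linearTimeReduces_dyck_recognition
    exact .of_reduction hf (h _) false (by simpa using hyes)
  tfae_have 3 → 2 := by
    intro h
    obtain ⟨f, hf, hyes⟩ := linearTimeReduces_emptiness_dyck
    -- The reduction starts from non-emptiness, whose instances and encoding are those of emptiness,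
    -- so the answer is negated.
    refine .of_reduction (P := pdaEmptiness) hf h true fun x => ?_
    have := hyes x
    simp only [DecisionProblem.compl] at this
    simp only [if_true, ← this, not_not]
  tfae_have 2 → 1 := by
    intro h M
    obtain ⟨f, hf, hyes⟩ := linearTimeReduces_recognition_emptiness M
    -- Here the algorithm for emptiness is run on the simulating automaton, and acceptance is the
    -- negation of its answer.
    exact .of_reduction (Q := pdaEmptiness) hf h true hyes
  tfae_finish
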